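/- Let $G=(V,E)$ be a finite simple connected graph with $V\neq\emptyset$, with node capacities $\kappa_v\in\mathbb{N}_{\ge 0}$ (if none are given, $\kappa_v$ is the maximum degree $\Delta$). A star coloring $C$ of $G$ assigns to each edge one of its two end nodes as its color; $x(G,C,v)$ is the number of different colors of the edges incident to $v$, $x(G,C)=\max_{v} x(G,C,v)$, and $C$ is valid if $x(G,C,v)\le\kappa_v$ for all $v$. Let $x^*(G)$ be the minimum of $x(G,C)$ over all valid star colorings $C$, and $x^*(G)=\infty$ if there is none. For an orientation of $G$ with outdegrees $\delta^+(v)$ and for $x\in\mathbb{N}_{\ge 0}$, let $l(v,x)=\max\{0,\delta(v)-\min\{\kappa_v,x\}+1\}$, where $\delta(v)$ is the degree of $v$. The slackness of $v$ is $s(v)=\delta^+(v)$ if $l(v,x)\le 1$ and $s(v)=\delta^+(v)-l(v,x)$ otherwise. The slackness network is the directed multigraph with unit capacities on $V\cup\{s,t\}$ that consists of the oriented edges of $G$, of $s(v)$ parallel edges $(s,v)$ for each $v$ with $s(v)>0$, and of $-s(v)$ parallel edges $(v,t)$ for each $v$ with $s(v)<0$. The algorithm MinimumStarColoringFlow keeps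 an orientation of $G$, initially the one given by the order in which the ends of each edge are listed in the input. To test a number $x$, it builds the slackness network and calls a max-flow subroutine that returns an integral maximum $s$-$t$ flow; the test succeeds if all edges into $t$ are saturated, and then every edge of $G$ with flow one is reversed. The algorithm first tests $x=\Delta$ and returns $\infty$ if this fails; otherwise it finds the smallest $x$ for which the test succeeds by binary search between $0$ and $\Delta$, and returns it, together with the coloring of the edges by their tails in the final orientation. A max-flow subroutine is admissible if it computes an integral maximum flow in every unit-capacity directed multigraph $\tilde G=(\tilde V,\tilde E)$ with a source $s$ and a sink $t\ne s$ in which all parallel edges have $s$ or $t$ as an endpoint, in time $O\big((|\tilde V|+|\tilde E|)(1+\min\{|\tilde V|^{2/3},|\tilde E|^{1/2}\})\big)$. **Theorem.** On a unit-cost random access machine with addition and subtraction, admissible max-flow subroutines exist. With every admissible max-flow subroutine, MinimumStarColoringFlow halts on every instance $(G,\kappa)$ as above, given by a list of edges and a list of capacities, and returns $x^*(G)$; if $x^*(G)<\infty$, the returned coloring is a valid star coloring $C$ with $x(G,C)=x^*(G)$. The number of steps is at most $$c\cdot\Big(1+\log(\Delta)\cdot|E|\cdot\min\{|V|^{2/3},|E|^{1/2}\}\Big)$$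 for a constant $c$ that depends only on the subroutine; that is, it is $O\big(\log(\Delta)\cdot|E|\cdot\min\{|V|^{2/3},|E|^{1/2}\}\big)$ whenever $\Delta\ge 2$, and bounded by a constant for the one-node graph and the one-edge graph. -/

import Mathlib

/-! ### Star colorings and the min-max star partitioning number -/

/-- A star coloring of `G`. The unique color of a node is the node itself, so a star coloring assigns
to each edge one of its two end nodes. -/
structure StarColoring {V : Type*} (G : SimpleGraph V) where
  color : G.edgeSet → V
  color_mem : ∀ e : G.edgeSet, color e ∈ (e : Sym2 V)

namespace StarColoring

variable {V : Type*} {G : SimpleGraph V}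

/-- `x(G, C, v)`: the number of different colors of the edges incident to `v`. -/
noncomputable def numColors (C : StarColoring G) (v : V) : ℕ :=
  Set.ncard {c : V | ∃ e : G.edgeSet, v ∈ (e : Sym2 V) ∧ C.color e = c}

/-- The coloring respects the node capacities. -/
def IsValid (C : StarColoring G) (κ : V → ℕ) : Prop :=
  ∀ v, C.numColors v ≤ κ v

/-- `x(G, C)`: the maximum over all nodes `v` of `x(G, C, v)`. -/
noncomputable def value [Fintype V] (C : StarColoring G) : ℕ :=
  Finset.univ.sup C.numColors

end StarColoring

/-- `x*(G)`: the minimum of `x(G, C)` over all valid star colorings `C`, and `⊤` if there is none. -/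
noncomputable def minMaxStar {V : Type*} [Fintype V] (G : SimpleGraph V) (κ : V → ℕ) : ℕ∞ :=
  ⨅ (C : StarColoring G) (_ : C.IsValid κ), (C.value : ℕ∞)

/-! ### The machine: a random access machine with unit costs

The memory consists of arrays of natural numbers; a scalar variable is cell `0` of an array. A program
mentions only finitely many arrays, and the only arithmetic is addition and (truncated) subtraction.
Every executed assignment and every evaluated test counts as one step; the expressions in a fixed
program have bounded size. -/

/-- A memory: `σ a i` is the content of cell `i` of array `a`. -/
abbrev Memory := ℕ → ℕ → ℕ

inductive Expr where
  | lit (k : ℕ)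
  | get (a : ℕ) (i : Expr)
  | add (e₁ e₂ : Expr)
  | sub (e₁ e₂ : Expr)

def Expr.eval (σ : Memory) : Expr → ℕ
  | .lit k => k
  | .get a i => σ a (i.eval σ)
  | .add e₁ e₂ => e₁.eval σ + e₂.eval σ
  | .sub e₁ e₂ => e₁.eval σ - e₂.eval σ

/-- Programs. A test succeeds if its expression is nonzero. -/
inductive Program where
  | skip
  | set (a : ℕ) (i e : Expr)
  | seq (p q : Program)
  | ite (b : Expr) (p q : Program)
  | loop (b : Expr) (p : Program)

/-- The memory after writing `k` into cell `i` of array `a`. -/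
def Memory.write (σ : Memory) (a i k : ℕ) : Memory :=
  Function.update σ a (Function.update (σ a) i k)

/-- `Exec p σ σ' t`: started in memory `σ`, the program `p` halts after exactly `t` steps in memory
`σ'`. -/
inductive Exec : Program → Memory → Memory → ℕ → Prop where
  | skip (σ : Memory) : Exec .skip σ σ 1
  | set (σ : Memory) (a : ℕ) (i e : Expr) :
      Exec (.set a i e) σ (σ.write a (i.eval σ) (e.eval σ)) 1
  | seq {p q : Program} {σ σ₁ σ₂ : Memory} {t₁ t₂ : ℕ} :
      Exec p σ σ₁ t₁ → Exec q σ₁ σ₂ t₂ → Exec (.seq p q) σ σ₂ (t₁ + t₂)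
  | ite_true {b : Expr} {p q : Program} {σ σ' : Memory} {t : ℕ} :
      b.eval σ ≠ 0 → Exec p σ σ' t → Exec (.ite b p q) σ σ' (t + 1)
  | ite_false {b : Expr} {p q : Program} {σ σ' : Memory} {t : ℕ} :
      b.eval σ = 0 → Exec q σ σ' t → Exec (.ite b p q) σ σ' (t + 1)
  | loop_done {b : Expr} {p : Program} {σ : Memory} :
      b.eval σ = 0 → Exec (.loop b p) σ σ 1
  | loop_step {b : Expr} {p : Program} {σ σ₁ σ₂ : Memory} {t₁ t₂ : ℕ} :
      b.eval σ ≠ 0 → Exec p σ σ₁ t₁ → Exec (.loop b p) σ₁ σ₂ t₂ →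
        Exec (.loop b p) σ σ₂ (t₁ + t₂ + 1)

namespace Program

/-- Run the listed programs one after the other. -/
def block : List Program → Program
  | [] => skip
  | p :: ps => seq p (block ps)

/-- The value of the scalar variable `a`. -/
def val (a : ℕ) : Expr := .get a (.lit 0)

/-- The content of the cell of `a` whose number is held by the scalar variable `i`. -/
def cell (a i : ℕ) : Expr := .get a (val i)

/-- Nonzero if and only if `e₁ < e₂`. -/
def lt (e₁ e₂ : Expr) : Expr := .sub e₂ e₁

/-- Assignment to the scalar variable `a`. -/
def assign (a : ℕ) (e : Expr) : Program := set a (.lit 0) e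

def incr (a : ℕ) : Program := assign a (.add (val a) (.lit 1))

def decr (a : ℕ) : Program := assign a (.sub (val a) (.lit 1))

/-- Increment cell `i` of array `a`. -/
def incrCell (a : ℕ) (i : Expr) : Program := set a i (.add (.get a i) (.lit 1))

/-- For `i = start, …, bound - 1`: run `p`. -/
def forRange (i : ℕ) (start bound : Expr) (p : Program) : Program :=
  seq (assign i start) (loop (lt (val i) bound) (seq p (incr i)))

end Program

/-! ### Array names -/

namespace Mem

/-- Input: number of nodes. -/
abbrev numV : ℕ := 0
/-- Input: number of edges. -/
abbrev numE : ℕ := 1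
/-- Tails of the edges in the current orientation (initially the order in which the two ends of an
edge are listed; finally the output coloring). -/
abbrev src : ℕ := 2
/-- Heads of the edges in the current orientation. -/
abbrev dst : ℕ := 3
/-- Input: node capacities. -/
abbrev cap : ℕ := 4
/-- Output: `0` if no valid star coloring exists, else `1`. -/
abbrev finite : ℕ := 5
/-- Output: the computed number, if it is finite. -/
abbrev result : ℕ := 6
/-- Node degrees. -/
abbrev deg : ℕ := 7
/-- Outdegrees in the current orientation. -/
abbrev out : ℕ := 8
/-- The maximum degree. -/
abbrev maxDeg : ℕ := 9
abbrev lo : ℕ := 10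
abbrev hi : ℕ := 11
/-- The number that is being tested. -/
abbrev x : ℕ := 12
/-- The outcome of the test, `0` or `1`. -/
abbrev feasible : ℕ := 13
/-- Loop counter. -/
abbrev i : ℕ := 14
/-- Auxiliary variables. -/
abbrev k : ℕ := 15
abbrev need : ℕ := 16
abbrev pos : ℕ := 17
abbrev neg : ℕ := 18
/-- The flow network: number of nodes, number of edges, source, sink, tails and heads of the edges. -/
abbrev netV : ℕ := 20
abbrev netE : ℕ := 21
abbrev netS : ℕ := 22
abbrev netT : ℕ := 23
abbrev netTail : ℕ := 24
abbrev netHead : ℕ := 25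
/-- The flow through each edge of the network. -/
abbrev netFlow : ℕ := 26
/-- All arrays from this one on are free for the max-flow subroutine. -/
abbrev scratch : ℕ := 32

end Mem

/-! ### Maximum flows in unit-capacity networks -/

/-- A directed multigraph with a source and a sink; every edge has capacity one. -/
structure UnitNetwork where
  numNodes : ℕ
  numEdges : ℕ
  tail : Fin numEdges → Fin numNodes
  head : Fin numEdges → Fin numNodes
  source : Fin numNodes
  sink : Fin numNodes
  source_ne_sink : source ≠ sink

namespace UnitNetwork

variable (N : UnitNetwork)

/-- Total flow on the edges leaving `v`. -/
noncomputable def outflow (f : Fin N.numEdges → ℝ) (v : Fin N.numNodes) : ℝ :=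
  ∑ e with N.tail e = v, f e

/-- Total flow on the edges entering `v`. -/
noncomputable def inflow (f : Fin N.numEdges → ℝ) (v : Fin N.numNodes) : ℝ :=
  ∑ e with N.head e = v, f e

/-- `f` respects the unit capacities and is conserved at all nodes but the source and the sink. -/
def IsFlow (f : Fin N.numEdges → ℝ) : Prop :=
  (∀ e, 0 ≤ f e ∧ f e ≤ 1) ∧
    ∀ v, v ≠ N.source → v ≠ N.sink → N.inflow f v = N.outflow f v

/-- The value of a flow: the net amount leaving the source. -/
noncomputable def flowValue (f : Fin N.numEdges → ℝ) : ℝ :=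
  N.outflow f N.source - N.inflow f N.source

def IsMaxFlow (f : Fin N.numEdges → ℝ) : Prop :=
  N.IsFlow f ∧ ∀ g, N.IsFlow g → N.flowValue g ≤ N.flowValue f

/-- Parallel edges occur only at the source or the sink. -/
def ParallelOnlyAtTerminals : Prop :=
  ∀ e e', N.tail e = N.tail e' → N.head e = N.head e' → e ≠ e' →
    N.tail e = N.source ∨ N.tail e = N.sink ∨ N.head e = N.source ∨ N.head e = N.sink

/-- The network `N` is stored in the memory `σ`. -/
def StoredIn (σ : Memory) : Prop :=
  σ Mem.netV 0 = N.numNodes ∧ σ Mem.netE 0 = N.numEdges ∧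
    σ Mem.netS 0 = N.source ∧ σ Mem.netT 0 = N.sink ∧
    (∀ e : Fin N.numEdges, σ Mem.netTail e = N.tail e) ∧
    ∀ e : Fin N.numEdges, σ Mem.netHead e = N.head e

end UnitNetwork

/-- `F` is a max-flow subroutine with the running time of Even and Tarjan: in every memory holding a
unit-capacity network whose parallel edges all touch the source or the sink, it halts in time
`O((|V| + |E|) · (1 + min {|V|^(2/3), |E|^(1/2)}))`, leaves an integral maximum flow in `Mem.netFlow`,
and alters no other array below `Mem.scratch`. Nothing is assumed about the rest of the memory. -/
def IsUnitMaxFlowSubroutine (F : Program) : Prop :=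
  ∃ c : ℝ, ∀ (N : UnitNetwork) (σ : Memory), N.ParallelOnlyAtTerminals → N.StoredIn σ →
    ∃ (σ' : Memory) (t : ℕ), Exec F σ σ' t ∧
      N.IsMaxFlow (fun e => (σ' Mem.netFlow e : ℝ)) ∧
      (∀ a < Mem.scratch, a ≠ Mem.netFlow → σ' a = σ a) ∧
      (t : ℝ) ≤ c * (((N.numNodes : ℝ) + N.numEdges) *
        (1 + min ((N.numNodes : ℝ) ^ (2 / 3 : ℝ)) ((N.numEdges : ℝ) ^ (1 / 2 : ℝ))))

/-! ### The algorithm -/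

namespace StarColoringFlow

open Program

/-- Compute all degrees and the maximum degree. -/
def computeDegrees : Program := block [
  forRange Mem.i (.lit 0) (val Mem.numV) (set Mem.deg (val Mem.i) (.lit 0)),
  forRange Mem.i (.lit 0) (val Mem.numE) (block [
    incrCell Mem.deg (cell Mem.src Mem.i),
    incrCell Mem.deg (cell Mem.dst Mem.i)]),
  assign Mem.maxDeg (.lit 0),
  forRange Mem.i (.lit 0) (val Mem.numV)
    (ite (lt (val Mem.maxDeg) (cell Mem.deg Mem.i))
      (assign Mem.maxDeg (cell Mem.deg Mem.i)) skip)]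

/-- Append an edge from `u` to `w` to the network. -/
def addEdge (u w : Expr) : Program := block [
  set Mem.netTail (val Mem.netE) u,
  set Mem.netHead (val Mem.netE) w,
  incr Mem.netE]

/-- The source of the network is node `|V|`. -/
def source : Expr := val Mem.numV

/-- The sink of the network is node `|V| + 1`. -/
def sink : Expr := .add (val Mem.numV) (.lit 1)

/-- For the node `v = i`, compute `need`, which is `l(v, x) = max {0, δ(v) - min {κ_v, x} + 1}` if this
exceeds `1`, and `0` otherwise; the slackness of `v` is its outdegree minus `need`. Store the positive
part of the slackness in `pos` and its negative part in `neg`. -/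
def computeSlackness : Program := block [
  ite (lt (cell Mem.cap Mem.i) (val Mem.x))
    (assign Mem.k (cell Mem.cap Mem.i)) (assign Mem.k (val Mem.x)),
  assign Mem.need (.sub (.add (cell Mem.deg Mem.i) (.lit 1)) (val Mem.k)),
  ite (lt (.lit 1) (val Mem.need)) skip (assign Mem.need (.lit 0)),
  assign Mem.pos (.sub (cell Mem.out Mem.i) (val Mem.need)),
  assign Mem.neg (.sub (val Mem.need) (cell Mem.out Mem.i))]

/-- The slackness network for `x` and the current orientation: all oriented edges of the graph, and for
each node `v` of slackness `s(v)` a number `s(v)` of edges from the source to `v` if `s(v) > 0`, and a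
number `-s(v)` of edges from `v` to the sink if `s(v) < 0`. -/
def buildNetwork : Program := block [
  assign Mem.netV (.add (val Mem.numV) (.lit 2)),
  assign Mem.netE (.lit 0),
  assign Mem.netS source,
  assign Mem.netT sink,
  forRange Mem.i (.lit 0) (val Mem.numV) (set Mem.out (val Mem.i) (.lit 0)),
  forRange Mem.i (.lit 0) (val Mem.numE) (block [
    incrCell Mem.out (cell Mem.src Mem.i),
    addEdge (cell Mem.src Mem.i) (cell Mem.dst Mem.i)]),
  forRange Mem.i (.lit 0) (val Mem.numV) (block [
    computeSlackness,
    loop (val Mem.pos) (block [addEdge source (val Mem.i), decr Mem.pos]),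
    loop (val Mem.neg) (block [addEdge (val Mem.i) sink, decr Mem.neg])])]

/-- The test is positive if all edges into the sink are saturated. -/
def checkSaturation : Program := block [
  assign Mem.feasible (.lit 1),
  forRange Mem.i (val Mem.numE) (val Mem.netE)
    (ite (lt (val Mem.numV) (cell Mem.netHead Mem.i))
      (ite (cell Mem.netFlow Mem.i) skip (assign Mem.feasible (.lit 0))) skip)]

/-- Reverse the orientation of all edges of the graph that carry flow. -/
def flipOrientation : Program :=
  forRange Mem.i (.lit 0) (val Mem.numE)
    (ite (cell Mem.netFlow Mem.i) (block [
      assign Mem.k (cell Mem.src Mem.i),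
      set Mem.src (val Mem.i) (cell Mem.dst Mem.i),
      set Mem.dst (val Mem.i) (val Mem.k)]) skip)

/-- Test whether `x*(G) ≤ x`, with the max-flow subroutine `F`. -/
def test (F : Program) : Program := block [
  buildNetwork,
  F,
  checkSaturation,
  ite (val Mem.feasible) flipOrientation skip]

/-- Set `x` to the midpoint of `lo` and `hi`, rounded up. -/
def midpoint : Program := block [
  assign Mem.x (val Mem.lo),
  assign Mem.k (val Mem.hi),
  loop (lt (val Mem.x) (val Mem.k)) (block [incr Mem.x, decr Mem.k])]

end StarColoringFlow

open Program StarColoringFlow in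
/-- The algorithm, with the max-flow subroutine `F`: it tests `x = Δ` to detect infeasibility, and then
finds the smallest feasible `x` by binary search. -/
def minimumStarColoringFlow (F : Program) : Program := block [
  computeDegrees,
  assign Mem.x (val Mem.maxDeg),
  test F,
  ite (val Mem.feasible)
    (block [
      assign Mem.lo (.lit 0),
      assign Mem.hi (val Mem.maxDeg),
      loop (lt (.add (val Mem.lo) (.lit 1)) (val Mem.hi)) (block [
        midpoint,
        test F,
        ite (val Mem.feasible)
          (assign Mem.hi (val Mem.x)) (assign Mem.lo (val Mem.x))]),
      assign Mem.finite (.lit 1),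
      assign Mem.result (val Mem.hi)])
    (assign Mem.finite (.lit 0))]

/-- The memory `σ` holds the instance `(G, κ)` as a list of edges, numbered by `edge`, each given by its
two ends in any order, and a list of capacities. Nothing is assumed about the rest of the memory. -/
def InstanceStoredIn {n m : ℕ} (G : SimpleGraph (Fin n)) (κ : Fin n → ℕ)
    (edge : Fin m ≃ G.edgeSet) (σ : Memory) : Prop :=
  σ Mem.numV 0 = n ∧ σ Mem.numE 0 = m ∧ (∀ v : Fin n, σ Mem.cap v = κ v) ∧
    ∀ e : Fin m, Sym2.map Fin.val (edge e : Sym2 (Fin n)) = s(σ Mem.src e, σ Mem.dst e)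

/-- The number computed by the algorithm, read off the final memory. -/
def outputNumber (σ : Memory) : ℕ∞ :=
  if σ Mem.finite 0 = 0 then ⊤ else (σ Mem.result 0 : ℕ∞)

/-! ### Reasoning about programs -/

/-! Coloring every edge by its tail identifies star colorings with orientations of `G`. Around a
node `v`, the outgoing edges all have color `v`, while the incoming ones have their other ends as
colors, and these are pairwise distinct because `G` is simple. So `v` sees δ(v) - δ⁺(v) colors, plus
one if δ⁺(v) > 0. Seeing at most `k` colors is therefore no restriction if δ(v) ≤ k, and means δ⁺(v)
≥ δ(v) - k + 1 otherwise (`numColors_eq`, `numColors_le_iff`). With `k = min (κ v) x`, testing `x`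
amounts to asking for an orientation with prescribed lower bounds ("needs") on the outdegrees.

Reversing a directed path moves one unit of outdegree from its first node to its last. A flow in the
slackness network thus moves outdegree from nodes with a surplus to nodes with a deficit. If it
saturates the edges into the sink, conservation shows that reversing the edges with flow meets all
needs (`need_le_of_saturated`). Conversely, among the reorientations that meet all needs, one with
the fewest reversals raises no outdegree above both its old value and the need
(`exists_flip_le_max`). Its reversed edges extend to a flow that saturates the sink edges
(`exists_flow`), hence every maximum flow saturates them (`saturated_of_exists`). So a test is
correct for every starting orientation (`runs_test`). Feasibility is monotone in `x`, no value
exceeds Δ, and 0 is infeasible if Δ > 0. A failed test does not touch the orientation, so throughout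
the binary search the orientation attains `hi`.

A max-flow subroutine is obtained from augmenting paths with distance labels and current arcs. Let
`D ≥ 1` be least with `D ^ 2 ≥ |E|` or `D ^ 3 ≥ |V| ^ 2`. Once the label of the source is at least
`D + 2`, the argument of Even and Tarjan applies: a residual arc lowers the label by at most one, so
some level cut is crossed by at most `2 * D` residual arcs, and at most `2 * D` units are missing
(`IsPartialFlow.le_add_of_label`). These are found by linear-time depth-first searches, one unit
each. The cost is O((|V| + |E|) (D + 1)), and minimality gives D ≤ 1 + min {|V|^(2/3), |E|^(1/2)}.

For the total time, the slackness network has `n + 2` nodes and at most `4 * m + n` edges,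
connectedness gives `n ≤ m + 1`, and there are at most `1 + Nat.clog 2 Δ` tests. -/

theorem Memory.write_apply (σ : Memory) (a i k b : ℕ) :
    σ.write a i k b = if b = a then Function.update (σ a) i k else σ b := by
  by_cases h : b = a
  · subst h; simp [Memory.write]
  · simp [Memory.write, h]

theorem Memory.write_same (σ : Memory) (a i k : ℕ) :
    σ.write a i k a = Function.update (σ a) i k := by
  rw [Memory.write_apply, if_pos rfl]

theorem Memory.write_of_ne (σ : Memory) {a b : ℕ} (h : b ≠ a) (i k : ℕ) : σ.write a i k b = σ b := by
  rw [Memory.write_apply, if_neg h]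

/-- Started in `σ`, the program `p` halts in a memory and after a number of steps that satisfy `Q`. -/
def Runs (p : Program) (σ : Memory) (Q : Memory → ℕ → Prop) : Prop :=
  ∃ σ' t, Exec p σ σ' t ∧ Q σ' t

namespace Program

/-- The arrays that a program may write to. -/
def writes : Program → Set ℕ
  | skip => ∅
  | set a _ _ => {a}
  | seq p q => p.writes ∪ q.writes
  | ite _ p q => p.writes ∪ q.writes
  | loop _ p => p.writes

end Program

theorem Exec.eq_of_notMem_writes {p : Program} {σ σ' : Memory} {t : ℕ} (h : Exec p σ σ' t) :
    ∀ a ∉ p.writes, σ' a = σ a := by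
  induction h with
  | skip => intro a _; rfl
  | set σ b i e =>
    intro a ha
    rw [Memory.write_apply, if_neg (by simpa [Program.writes] using ha)]
  | seq _ _ ih₁ ih₂ =>
    intro a ha
    simp only [Program.writes, Set.mem_union, not_or] at ha
    rw [ih₂ a ha.2, ih₁ a ha.1]
  | ite_true _ _ ih =>
    intro a ha
    simp only [Program.writes, Set.mem_union, not_or] at ha
    exact ih a ha.1
  | ite_false _ _ ih =>
    intro a ha
    simp only [Program.writes, Set.mem_union, not_or] at ha
    exact ih a ha.2
  | loop_done => intro a _; rfl
  | loop_step _ _ _ ih₁ ih₂ =>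
    intro a ha
    rw [ih₂ a ha, ih₁ a ha]

namespace Runs

variable {p q : Program} {σ : Memory} {Q Q' : Memory → ℕ → Prop}

theorem mono (h : Runs p σ Q) (hQ : ∀ σ' t, Q σ' t → Q' σ' t) : Runs p σ Q' := by
  obtain ⟨σ', t, h₁, h₂⟩ := h
  exact ⟨σ', t, h₁, hQ _ _ h₂⟩

/-- Postconditions then need to describe only what changes; every array that the program text never
writes to is known to be untouched. -/
theorem frame (h : Runs p σ Q) : Runs p σ fun σ' t => Q σ' t ∧ ∀ a ∉ p.writes, σ' a = σ a := by
  obtain ⟨σ', t, h₁, h₂⟩ := h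
  exact ⟨σ', t, h₁, h₂, h₁.eq_of_notMem_writes⟩

/-- This and the next equivalences are weakest-precondition rules: rewriting with them executes
straight-line code symbolically and counts its steps. -/
theorem skip_iff : Runs .skip σ Q ↔ Q σ 1 := by
  constructor
  · rintro ⟨σ', t, h, hQ⟩
    cases h
    exact hQ
  · exact fun h => ⟨_, _, .skip σ, h⟩

theorem set_iff {a : ℕ} {i e : Expr} :
    Runs (.set a i e) σ Q ↔ Q (σ.write a (i.eval σ) (e.eval σ)) 1 := by
  constructor
  · rintro ⟨σ', t, h, hQ⟩
    cases h
    exact hQ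
  · exact fun h => ⟨_, _, .set σ a i e, h⟩

theorem seq_iff :
    Runs (.seq p q) σ Q ↔ Runs p σ fun σ₁ t₁ => Runs q σ₁ fun σ₂ t₂ => Q σ₂ (t₁ + t₂) := by
  constructor
  · rintro ⟨σ', t, h, hQ⟩
    cases h with
    | seq h₁ h₂ => exact ⟨_, _, h₁, _, _, h₂, hQ⟩
  · rintro ⟨σ₁, t₁, h₁, σ₂, t₂, h₂, hQ⟩
    exact ⟨_, _, .seq h₁ h₂, hQ⟩

theorem ite_iff {b : Expr} :
    Runs (.ite b p q) σ Q ↔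
      if b.eval σ = 0 then Runs q σ (fun σ' t => Q σ' (t + 1))
      else Runs p σ (fun σ' t => Q σ' (t + 1)) := by
  constructor
  · rintro ⟨σ', t, h, hQ⟩
    cases h with
    | ite_true hb h => rw [if_neg hb]; exact ⟨_, _, h, hQ⟩
    | ite_false hb h => rw [if_pos hb]; exact ⟨_, _, h, hQ⟩
  · split_ifs with hb
    · rintro ⟨σ', t, h, hQ⟩
      exact ⟨_, _, .ite_false hb h, hQ⟩
    · rintro ⟨σ', t, h, hQ⟩
      exact ⟨_, _, .ite_true hb h, hQ⟩

theorem block_nil_iff : Runs (Program.block []) σ Q ↔ Q σ 1 := skip_iff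

theorem block_cons_iff {ps : List Program} :
    Runs (Program.block (p :: ps)) σ Q ↔
      Runs p σ fun σ₁ t₁ => Runs (Program.block ps) σ₁ fun σ₂ t₂ => Q σ₂ (t₁ + t₂) := seq_iff

/-- Amortized analysis of a loop: each round is paid for by a decrease of the potential `Φ`. -/
theorem loop {b : Expr} {Inv : Memory → Prop} {Φ : Memory → ℕ} (h₀ : Inv σ)
    (hbody : ∀ τ, Inv τ → (∀ a ∉ p.writes, τ a = σ a) → b.eval τ ≠ 0 →
      Runs p τ fun τ' t => Inv τ' ∧ t + 1 + Φ τ' ≤ Φ τ) :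
    Runs (.loop b p) σ fun σ' t => Inv σ' ∧ b.eval σ' = 0 ∧ t + Φ σ' ≤ Φ σ + 1 := by
  -- Induction on an upper bound for `Φ`. At bound zero another round is impossible, since every
  -- round consumes at least one unit of `Φ`.
  have key : ∀ k τ, Φ τ ≤ k → Inv τ → (∀ a ∉ p.writes, τ a = σ a) →
      Runs (.loop b p) τ fun σ' t => Inv σ' ∧ b.eval σ' = 0 ∧ t + Φ σ' ≤ Φ τ + 1 := by
    intro k
    induction k with
    | zero =>
      intro τ hk hτ hf
      by_cases hb : b.eval τ = 0
      · exact ⟨τ, 1, .loop_done hb, hτ, hb, by omega⟩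
      · obtain ⟨τ₁, t₁, _, _, h⟩ := hbody τ hτ hf hb
        omega
    | succ k ih =>
      intro τ hk hτ hf
      by_cases hb : b.eval τ = 0
      · exact ⟨τ, 1, .loop_done hb, hτ, hb, by omega⟩
      · obtain ⟨τ₁, t₁, e₁, hτ₁, h₁⟩ := hbody τ hτ hf hb
        obtain ⟨τ₂, t₂, e₂, hτ₂, hb₂, h₂⟩ := ih τ₁ (by omega) hτ₁
          (fun a ha => (e₁.eq_of_notMem_writes a ha).trans (hf a ha))
        exact ⟨τ₂, _, .loop_step hb e₁ e₂, hτ₂, hb₂, by omega⟩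
  exact key _ σ le_rfl h₀ fun _ _ => rfl

/-- A counting loop whose round `j` takes at most `c j` steps. -/
theorem forRange_sum {i : ℕ} {start bound : Expr} {Inv : ℕ → Memory → Prop} {c : ℕ → ℕ} {lo hi : ℕ}
    (hlo : start.eval σ = lo) (hle : lo ≤ hi) (h₀ : Inv lo (σ.write i 0 lo))
    (hbound : ∀ τ j, Inv j τ → τ i 0 = j → (∀ a ∉ p.writes, a ≠ i → τ a = σ a) →
      bound.eval τ = hi)
    (hbody : ∀ τ j, lo ≤ j → j < hi → Inv j τ → τ i 0 = j →
      (∀ a ∉ p.writes, a ≠ i → τ a = σ a) →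
      Runs p τ fun τ' t => (τ' i 0 = j ∧ Inv (j + 1) (τ'.write i 0 (j + 1))) ∧ t ≤ c j) :
    Runs (Program.forRange i start bound p) σ fun σ' t =>
      Inv hi σ' ∧ σ' i 0 = hi ∧ t ≤ ∑ j ∈ Finset.Ico lo hi, (c j + 3) + 2 := by
  rw [Program.forRange, seq_iff, Program.assign, set_iff]
  have hfr : ∀ τ : Memory, (∀ a ∉ (p.seq (Program.incr i)).writes,
      τ a = (σ.write i (Expr.eval σ (.lit 0)) (Expr.eval σ start)) a) →
      ∀ a ∉ p.writes, a ≠ i → τ a = σ a := by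
    intro τ hτ a ha hai
    rw [hτ a (by simp [Program.writes, Program.incr, Program.assign, ha, hai]), Memory.write_apply,
      if_neg hai]
  refine mono (loop (Inv := fun τ => lo ≤ τ i 0 ∧ τ i 0 ≤ hi ∧ Inv (τ i 0) τ ∧
      (∀ a ∉ p.writes, a ≠ i → τ a = σ a))
    (Φ := fun τ => ∑ j ∈ Finset.Ico (τ i 0) hi, (c j + 3)) ?_ ?_) ?_
  · simp only [Memory.write_apply, Expr.eval, hlo, if_true, Function.update_self]
    refine ⟨le_rfl, hle, h₀, fun a _ hai => by rw [if_neg hai]⟩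
  · rintro τ ⟨hl, hh, hI, -⟩ hf hb
    have hf := hfr τ hf
    have hj : τ i 0 < hi := by
      have := hbound τ _ hI rfl hf
      simp only [Program.lt, Program.val, Expr.eval, this] at hb
      omega
    rw [seq_iff]
    refine mono (frame (hbody τ _ hl hj hI rfl hf)) ?_
    rintro τ' t ⟨⟨⟨h1, h2⟩, h3⟩, hf'⟩
    rw [Program.incr, Program.assign, set_iff]
    simp only [Memory.write_apply, Expr.eval, Program.val, if_true, Function.update_self, h1]
    refine ⟨⟨by omega, by omega, h2, fun a ha hai => ?_⟩, ?_⟩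
    · rw [if_neg hai, hf' a ha, hf a ha hai]
    · rw [Finset.sum_eq_sum_Ico_succ_bot hj]
      omega
  · rintro σ' t ⟨⟨hl, hh, hI, hf⟩, hb, ht⟩
    have := hbound σ' _ hI rfl hf
    simp only [Program.lt, Program.val, Expr.eval, this] at hb
    have he : σ' i 0 = hi := by omega
    simp only [Memory.write_apply, Expr.eval, hlo, if_true, Function.update_self, he,
      Finset.Ico_self, Finset.sum_empty] at ht
    exact ⟨he ▸ hI, he, by omega⟩

/-- A counting loop whose rounds take at most `c` steps each. -/
theorem forRange {i : ℕ} {start bound : Expr} {Inv : ℕ → Memory → Prop} {c lo hi : ℕ}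
    (hlo : start.eval σ = lo) (hle : lo ≤ hi) (h₀ : Inv lo (σ.write i 0 lo))
    (hbound : ∀ τ j, Inv j τ → τ i 0 = j → (∀ a ∉ p.writes, a ≠ i → τ a = σ a) →
      bound.eval τ = hi)
    (hbody : ∀ τ j, lo ≤ j → j < hi → Inv j τ → τ i 0 = j →
      (∀ a ∉ p.writes, a ≠ i → τ a = σ a) →
      Runs p τ fun τ' t => (τ' i 0 = j ∧ Inv (j + 1) (τ'.write i 0 (j + 1))) ∧ t ≤ c) :
    Runs (Program.forRange i start bound p) σ fun σ' t =>
      Inv hi σ' ∧ σ' i 0 = hi ∧ t ≤ (c + 3) * (hi - lo) + 2 := by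
  refine (forRange_sum (c := fun _ => c) hlo hle h₀ hbound hbody).mono ?_
  rintro σ' t ⟨h₁, h₂, h₃⟩
  rw [Finset.sum_const, Nat.card_Ico, smul_eq_mul, mul_comm] at h₃
  exact ⟨h₁, h₂, h₃⟩

end Runs

/-! ### Residual networks and depth-first search with distance labels -/

/-- The arcs of a network with `E` edges: arc `e < E` is edge `e`, and arc `E + e` is its reverse. The
arcs leaving a node `v` are listed in increasing order by `first v` and `next`, with end mark `2 * E`. -/
structure ArcNet where
  n : ℕ
  E : ℕ
  s : ℕ
  t : ℕ
  tl : ℕ → ℕ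
  hd : ℕ → ℕ
  first : ℕ → ℕ
  next : ℕ → ℕ
  s_lt : s < n
  t_lt : t < n
  s_ne_t : s ≠ t
  tl_lt : ∀ a < 2 * E, tl a < n
  tl_add : ∀ e < E, tl (E + e) = hd e
  hd_add : ∀ e < E, hd (E + e) = tl e
  first_le : ∀ v < n, first v ≤ 2 * E
  tl_first : ∀ v < n, first v < 2 * E → tl (first v) = v
  first_min : ∀ v < n, ∀ b < first v, tl b ≠ v
  next_le : ∀ a < 2 * E, next a ≤ 2 * E
  tl_next : ∀ a < 2 * E, next a < 2 * E → tl (next a) = tl a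
  lt_next : ∀ a < 2 * E, a < next a
  next_min : ∀ a < 2 * E, ∀ b, a < b → b < next a → tl b ≠ tl a

namespace ArcNet

variable (N : ArcNet)

def mate (a : ℕ) : ℕ := if a < N.E then N.E + a else a - N.E

variable {N} {res res' par d cur : ℕ → ℕ} {a u v w k k' x D : ℕ} {l : List ℕ}

theorem mate_lt (h : a < 2 * N.E) : N.mate a < 2 * N.E := by
  unfold mate; split_ifs <;> omega

theorem mate_mate (h : a < 2 * N.E) : N.mate (N.mate a) = a := by
  unfold mate; split_ifs <;> omega

theorem mate_ne (h : a < 2 * N.E) : N.mate a ≠ a := by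
  unfold mate; split_ifs <;> omega

theorem tl_mate (h : a < 2 * N.E) : N.tl (N.mate a) = N.hd a := by
  unfold mate
  split_ifs with h'
  · exact N.tl_add a h'
  · have := N.hd_add (a - N.E) (by omega)
    rw [show N.E + (a - N.E) = a by omega] at this
    exact this.symm

theorem hd_mate (h : a < 2 * N.E) : N.hd (N.mate a) = N.tl a := by
  rw [← tl_mate (mate_lt h), mate_mate h]

theorem hd_lt (h : a < 2 * N.E) : N.hd a < N.n := by
  rw [← tl_mate h]; exact N.tl_lt _ (mate_lt h)

variable (N) in
/-- Exactly one of an arc and its reverse is residual. -/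
def Complementary (res : ℕ → ℕ) : Prop :=
  ∀ a < 2 * N.E, res a + res (N.mate a) = 1

variable (N) in
/-- Send one unit along arc `a`. -/
def flip (res : ℕ → ℕ) (a : ℕ) : ℕ → ℕ :=
  Function.update (Function.update res a 0) (N.mate a) 1

theorem flip_mate (res : ℕ → ℕ) (a : ℕ) : N.flip res a (N.mate a) = 1 := by
  simp [flip]

theorem flip_self (h : a < 2 * N.E) : N.flip res a a = 0 := by
  simp [flip, Function.update_of_ne (mate_ne h).symm]

theorem flip_of_ne {b : ℕ} (h₁ : b ≠ a) (h₂ : b ≠ N.mate a) : N.flip res a b = res b := by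
  simp [flip, Function.update_of_ne, h₁, h₂]

theorem Complementary.flip (hc : N.Complementary res) (h : a < 2 * N.E) :
    N.Complementary (N.flip res a) := by
  intro b hb
  by_cases h₁ : b = a
  · subst h₁; rw [flip_self h, flip_mate]
  by_cases h₂ : b = N.mate a
  · subst h₂; rw [mate_mate h, flip_self h, flip_mate]
  rw [flip_of_ne h₁ h₂, flip_of_ne, hc b hb]
  · rintro rfl; exact h₂ (mate_mate hb).symm
  · intro e; apply h₁; rw [← mate_mate hb, e, mate_mate h]

variable (N) in
/-- The net amount of flow entering `v`; edge `e` carries `1 - res e`. -/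
def excess (res : ℕ → ℕ) (v : ℕ) : ℤ :=
  ∑ e ∈ Finset.range N.E,
    (1 - (res e : ℤ)) * ((if N.hd e = v then 1 else 0) - (if N.tl e = v then 1 else 0))

/-- Only the edge underlying `a` changes its flow: it gains a unit if `a` is that edge and loses one
if `a` is its reverse. Both amount to moving a unit from `tl a` to `hd a`. -/
theorem excess_flip (hc : N.Complementary res) (h : a < 2 * N.E) (ha : res a = 1) (v : ℕ) :
    N.excess (N.flip res a) v =
      N.excess res v + ((if N.hd a = v then 1 else 0) - (if N.tl a = v then 1 else 0)) := by
  unfold excess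
  rw [← sub_eq_iff_eq_add', ← Finset.sum_sub_distrib]
  by_cases h' : a < N.E
  · rw [Finset.sum_eq_single_of_mem a (by simpa using h')]
    · rw [flip_self h, ha]; push_cast; ring
    · intro b hb hba
      have hb := Finset.mem_range.mp hb
      rw [flip_of_ne hba, sub_self]
      unfold mate; split_ifs; omega
  · have hm : N.mate a = a - N.E := by unfold mate; rw [if_neg h']
    rw [Finset.sum_eq_single_of_mem (N.mate a) (by simp; omega)]
    · have := hc a h
      rw [flip_mate, tl_mate h, hd_mate h, show res (N.mate a) = 0 by omega]; push_cast; ring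
    · intro b hb hba
      have hb := Finset.mem_range.mp hb
      rw [flip_of_ne _ hba, sub_self]
      omega

variable (N) in
/-- `res` describes a flow of value `k`, plus one unit on its way from the source to `u`. -/
structure IsPartialFlow (res : ℕ → ℕ) (u k : ℕ) : Prop where
  complementary : N.Complementary res
  excess_eq : ∀ v, N.excess res v =
    k * ((if N.t = v then 1 else 0) - (if N.s = v then 1 else 0)) +
      ((if u = v then 1 else 0) - (if N.s = v then 1 else 0))

/-- The travelling unit crosses the flipped arc. This serves both for walking forward and, with the
reverse arc, for undoing a step. -/
theorem IsPartialFlow.flip (hf : N.IsPartialFlow res (N.tl a) k) (h : a < 2 * N.E)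
    (ha : res a = 1) : N.IsPartialFlow (N.flip res a) (N.hd a) k where
  complementary := hf.complementary.flip h
  excess_eq v := by rw [excess_flip hf.complementary h ha, hf.excess_eq]; ring

/-- A unit that has reached the sink is counted in the value. The next one starts at the source,
where a unit in transit contributes nothing to the excess. -/
theorem IsPartialFlow.arrive (hf : N.IsPartialFlow res N.t k) :
    N.IsPartialFlow res N.s (k + 1) where
  complementary := hf.complementary
  excess_eq v := by rw [hf.excess_eq]; push_cast; ring

variable (N) in
/-- `l` is the list of nodes, from `u` back to the source, of a path along which one unit is being sent;
`par w` is the reverse of the arc by which the path enters `w`. -/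
inductive Path (res par d : ℕ → ℕ) : ℕ → List ℕ → Prop
  | base : Path res par d N.s [N.s]
  | step {p w : ℕ} {l : List ℕ} : Path res par d p l → par w < 2 * N.E → N.tl (par w) = w →
      N.hd (par w) = p → res (par w) = 1 → w ∉ l → w ≠ N.t → (∀ v ∈ l, d w ≤ d v) →
      d p ≤ d w + 1 → Path res par d w (w :: l)

namespace Path

variable {res' par' d' : ℕ → ℕ}

theorem head_mem (h : N.Path res par d u l) : u ∈ l := by
  cases h <;> simp

theorem source_mem (h : N.Path res par d u l) : N.s ∈ l := by
  induction h with
  | base => simp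
  | step _ _ _ _ _ _ _ _ _ ih => exact List.mem_cons_of_mem _ ih

theorem le_of_mem (h : N.Path res par d u l) : ∀ v ∈ l, d u ≤ d v := by
  cases h with
  | base => simp
  | step _ _ _ _ _ _ _ h _ => simpa using h

theorem lt (h : N.Path res par d u l) : u < N.n := by
  cases h with
  | base => exact N.s_lt
  | step _ h₁ h₂ => rw [← h₂]; exact N.tl_lt _ h₁

/-- Only the data on the path matter, so the path survives flips of other arcs and label changes at
other nodes. -/
theorem congr (h : N.Path res par d u l) (hp : ∀ v ∈ l, par' v = par v) (hd : ∀ v ∈ l, d' v = d v)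
    (hr : ∀ v ∈ l, par v < 2 * N.E → N.tl (par v) = v → N.hd (par v) ∈ l → res (par v) = 1 →
      res' (par v) = 1) : N.Path res' par' d' u l := by
  induction h with
  | base => exact .base
  | @step p w l h h₁ h₂ h₃ h₄ h₅ h₆ h₇ h₈ ih =>
    have hw : w ∈ w :: l := by simp
    have hpl := h.head_mem
    refine .step (p := p) (ih (fun v hv => hp v (by simp [hv])) (fun v hv => hd v (by simp [hv]))
      fun v hv a b c e => hr v (by simp [hv]) a b (by simp [c]) e) ?_ ?_ ?_ ?_ h₅ h₆ ?_ ?_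
    · rwa [hp w hw]
    · rwa [hp w hw]
    · rwa [hp w hw]
    · rw [hp w hw]; exact hr w hw h₁ h₂ (by simp [h₃, hpl]) h₄
    · intro v hv; rw [hd w hw, hd v (by simp [hv])]; exact h₇ v hv
    · rw [hd w hw, hd p (by simp [hpl])]; exact h₈

end Path

variable (N) in
/-- The labels `d` are valid, and no arc before the current arc `cur v` of a node `v` is admissible. -/
structure Labels (res d cur : ℕ → ℕ) : Prop where
  valid : ∀ a < 2 * N.E, res a = 1 → d (N.tl a) ≤ d (N.hd a) + 1
  cur_le : ∀ v < N.n, cur v ≤ 2 * N.E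
  tl_cur : ∀ v < N.n, cur v < 2 * N.E → N.tl (cur v) = v
  scanned : ∀ a < 2 * N.E, a < cur (N.tl a) → res a = 1 → d (N.tl a) ≠ d (N.hd a) + 1

/-! ### Validity of the labels under the moves of the search. -/

namespace Labels

/-- The only new residual arc is the reverse of `a`. It leads to a label at least as large as that
of its tail, so it is valid and inadmissible, wherever the current arc of its tail stands. -/
theorem flip (h : N.Labels res d cur) (ha : a < 2 * N.E) (hd : d (N.hd a) ≤ d (N.tl a)) :
    N.Labels (N.flip res a) d cur where
  valid b hb hr := by
    by_cases h₂ : b = N.mate a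
    · subst h₂; rw [tl_mate ha, hd_mate ha]; omega
    by_cases h₁ : b = a
    · subst h₁; rw [flip_self ha] at hr; omega
    exact h.valid b hb (by rwa [flip_of_ne h₁ h₂] at hr)
  cur_le := h.cur_le
  tl_cur := h.tl_cur
  scanned b hb hc hr := by
    by_cases h₂ : b = N.mate a
    · subst h₂; rw [tl_mate ha, hd_mate ha]; omega
    by_cases h₁ : b = a
    · subst h₁; rw [flip_self ha] at hr; omega
    exact h.scanned b hb hc (by rwa [flip_of_ne h₁ h₂] at hr)

/-- `next` skips only arcs with other tails, so the abandoned current arc is the only newly scanned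
one. -/
theorem advance (h : N.Labels res d cur) (hu : u < N.n) (hc : cur u < 2 * N.E)
    (hadm : res (cur u) = 1 → d u ≠ d (N.hd (cur u)) + 1) :
    N.Labels res d (Function.update cur u (N.next (cur u))) where
  valid := h.valid
  cur_le v hv := by
    by_cases e : v = u
    · subst e; rw [Function.update_self]; exact N.next_le _ hc
    · rw [Function.update_of_ne e]; exact h.cur_le v hv
  tl_cur v hv := by
    by_cases e : v = u
    · subst e; rw [Function.update_self]; intro h'
      rw [N.tl_next _ hc h', h.tl_cur v hv hc]
    · rw [Function.update_of_ne e]; exact h.tl_cur v hv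
  scanned b hb hlt hr := by
    by_cases e : N.tl b = u
    · rw [e, Function.update_self] at hlt
      rcases lt_trichotomy b (cur u) with hb' | hb' | hb'
      · exact h.scanned b hb (by rwa [e]) hr
      · subst hb'; rw [e]; exact hadm hr
      · exact absurd (e.trans (h.tl_cur u hu hc).symm) (N.next_min _ hc b hb' hlt)
    · rw [Function.update_of_ne e] at hlt; exact h.scanned b hb hlt hr

/-- When the list of `u` is exhausted, no residual arc leaving `u` is admissible, so the label may
rise by one. Arcs into `u` satisfied validity before the rise and are therefore inadmissible after
it; the list of `u` restarts with nothing scanned. -/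
theorem relabel (h : N.Labels res d cur) (hu : u < N.n) (hc : cur u = 2 * N.E) :
    N.Labels res (Function.update d u (d u + 1)) (Function.update cur u (N.first u)) where
  valid b hb hr := by
    have h₁ := h.valid b hb hr
    by_cases e : N.tl b = u
    · have h₂ := h.scanned b hb (by rw [e, hc]; exact hb) hr
      by_cases e' : N.hd b = u
      · rw [e, e']; omega
      · rw [e, Function.update_self, Function.update_of_ne e']; rw [e] at h₁ h₂; omega
    · rw [Function.update_of_ne e]
      by_cases e' : N.hd b = u
      · rw [e', Function.update_self]; rw [e'] at h₁; omega
      · rwa [Function.update_of_ne e']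
  cur_le v hv := by
    by_cases e : v = u
    · subst e; rw [Function.update_self]; exact N.first_le _ hv
    · rw [Function.update_of_ne e]; exact h.cur_le v hv
  tl_cur v hv := by
    by_cases e : v = u
    · subst e; rw [Function.update_self]; exact N.tl_first _ hv
    · rw [Function.update_of_ne e]; exact h.tl_cur v hv
  scanned b hb hlt hr := by
    by_cases e : N.tl b = u
    · rw [e, Function.update_self] at hlt
      exact absurd e (N.first_min u hu b hlt)
    · rw [Function.update_of_ne e] at hlt ⊢
      by_cases e' : N.hd b = u
      · have h₁ := h.valid b hb hr
        rw [e', Function.update_self]; rw [e'] at h₁; omega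
      · rw [Function.update_of_ne e']; exact h.scanned b hb hlt hr

/-- This marks a node as visited in the search for a single path. A label 1 is always valid, and no
arc leaving `w` has been scanned yet. -/
theorem raise (h : N.Labels res d cur) (hw : w < N.n) (hd : d w = 0) (hc : cur w = N.first w) :
    N.Labels res (Function.update d w 1) cur where
  valid b hb hr := by
    have h₁ := h.valid b hb hr
    by_cases e : N.tl b = w
    · rw [e, Function.update_self]; omega
    · rw [Function.update_of_ne e]
      by_cases e' : N.hd b = w
      · rw [e', Function.update_self]; rw [e'] at h₁; omega
      · rwa [Function.update_of_ne e']
  cur_le := h.cur_le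
  tl_cur := h.tl_cur
  scanned b hb hlt hr := by
    by_cases e : N.tl b = w
    · rw [e, hc] at hlt
      exact absurd e (N.first_min w hw b hlt)
    · rw [Function.update_of_ne e]
      by_cases e' : N.hd b = w
      · have h₁ := h.valid b hb hr
        rw [e', Function.update_self]; rw [e'] at h₁; omega
      · rw [Function.update_of_ne e']; exact h.scanned b hb hlt hr

end Labels

variable (N) in
/-- The state of the search. If `x = 0`, the labels bound the distances to the sink. If `x = 1`, the
labels `0`, `1`, `2` mean that a node is unvisited, on the current path, and exhausted. The search ends
when the label of the source reaches `D`. -/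
structure SearchState (x D : ℕ) (res par d cur : ℕ → ℕ) (u : ℕ) (l : List ℕ) (k : ℕ) : Prop where
  flow : N.IsPartialFlow res u k
  path : N.Path res par d u l
  labels : N.Labels res d cur
  label_sink : d N.t = 0
  le_bound : ∀ v < N.n, d v ≤ D
  source_lt : d N.s < D ∨ u = N.s
  unvisited : x = 1 → ∀ v < N.n, d v = 0 → cur v = N.first v
  mem_path : x = 1 → ∀ v < N.n, d v = 1 → v ∈ l
  visited : x = 1 → ∀ v ∈ l, d v ≠ 0

variable (N) in
/-- A quantity that grows with every step of the search. -/
def potential (d cur : ℕ → ℕ) : ℕ :=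
  ∑ a ∈ Finset.range (2 * N.E), (d (N.tl a) + if a < cur (N.tl a) then 1 else 0) +
    ∑ v ∈ Finset.range N.n, d v

theorem potential_le (h : ∀ v < N.n, d v ≤ D) :
    N.potential d cur ≤ 2 * N.E * (D + 1) + N.n * D := by
  unfold potential
  refine Nat.add_le_add ?_ ?_
  · refine (Finset.sum_le_card_nsmul _ _ (D + 1) fun a ha => ?_).trans (by simp)
    have := h _ (N.tl_lt a (Finset.mem_range.mp ha))
    split_ifs <;> omega
  · exact (Finset.sum_le_card_nsmul _ _ D fun a ha => h a (Finset.mem_range.mp ha)).trans (by simp)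

/-- The current arc becomes a scanned one, and no scanned arc is lost. -/
theorem potential_advance (hc : cur u < 2 * N.E) (htl : N.tl (cur u) = u) :
    N.potential d cur + 1 ≤ N.potential d (Function.update cur u (N.next (cur u))) := by
  unfold potential
  have hlt := N.lt_next _ hc
  have : ∑ a ∈ Finset.range (2 * N.E), (d (N.tl a) + if a < cur (N.tl a) then 1 else 0) <
      ∑ a ∈ Finset.range (2 * N.E), (d (N.tl a) +
        if a < Function.update cur u (N.next (cur u)) (N.tl a) then 1 else 0) := by
    refine Finset.sum_lt_sum (fun a ha => ?_) ⟨cur u, Finset.mem_range.mpr hc, ?_⟩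
    · by_cases e : N.tl a = u
      · rw [e, Function.update_self]; split_ifs <;> omega
      · rw [Function.update_of_ne e]
    · rw [htl, Function.update_self, if_neg (lt_irrefl _), if_pos hlt]; omega
  omega

theorem sum_update_range (d : ℕ → ℕ) (u y n : ℕ) (hu : u < n) :
    ∑ v ∈ Finset.range n, Function.update d u y v + d u = ∑ v ∈ Finset.range n, d v + y := by
  rw [Finset.sum_update_of_mem (Finset.mem_range.mpr hu), Finset.sdiff_singleton_eq_erase]
  have := Finset.add_sum_erase (Finset.range n) d (Finset.mem_range.mpr hu)
  omega

/-- An arc leaving `u` may lose its scanned mark, but the label term makes up for it. The sum of the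
node labels makes the increase strict even if no arc leaves `u`. -/
theorem potential_relabel (hu : u < N.n) (_hc : cur u = 2 * N.E) :
    N.potential d cur + 1 ≤
      N.potential (Function.update d u (d u + 1)) (Function.update cur u (N.first u)) := by
  unfold potential
  have h₁ := sum_update_range d u (d u + 1) N.n hu
  have h₂ : ∑ a ∈ Finset.range (2 * N.E), (d (N.tl a) + if a < cur (N.tl a) then 1 else 0) ≤
      ∑ a ∈ Finset.range (2 * N.E), (Function.update d u (d u + 1) (N.tl a) +
        if a < Function.update cur u (N.first u) (N.tl a) then 1 else 0) := by
    refine Finset.sum_le_sum fun a ha => ?_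
    by_cases e : N.tl a = u
    · rw [e, Function.update_self]; split_ifs <;> omega
    · rw [Function.update_of_ne e, Function.update_of_ne e]
  omega

theorem potential_raise : N.potential d cur ≤ N.potential (Function.update d w (d w + x)) cur := by
  unfold potential
  have h : ∀ v, d v ≤ Function.update d w (d w + x) v := by
    intro v
    by_cases e : v = w
    · subst e; rw [Function.update_self]; omega
    · rw [Function.update_of_ne e]
  gcongr <;> exact h _

namespace SearchState

theorem label_lt (h : N.SearchState x D res par d cur u l k) (hs : d N.s < D) : d u < D :=
  (h.path.le_of_mem _ h.path.source_mem).trans_lt hs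

theorem advance (h : N.SearchState x D res par d cur u l k) (hc : cur u < 2 * N.E)
    (hadm : res (cur u) = 1 → d u ≠ d (N.hd (cur u)) + 1) :
    N.SearchState x D res par d (Function.update cur u (N.next (cur u))) u l k where
  __ := h
  labels := h.labels.advance h.path.lt hc hadm
  unvisited hx v hv hd := by
    by_cases e : v = u
    · subst e; exact absurd hd (h.visited hx v h.path.head_mem)
    · rw [Function.update_of_ne e]; exact h.unvisited hx v hv hd

theorem labels_push (h : N.SearchState x D res par d cur u l k) (hc : cur u < 2 * N.E)
    (hadm : d u = d (N.hd (cur u)) + 1) :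
    N.Labels (N.flip res (cur u)) d (Function.update cur u (N.next (cur u))) := by
  have htl := h.labels.tl_cur u h.path.lt hc
  refine (h.labels.flip hc (by rw [htl]; omega)).advance h.path.lt hc fun hr => ?_
  rw [flip_self hc] at hr; omega

theorem flow_push (h : N.SearchState x D res par d cur u l k) (hc : cur u < 2 * N.E)
    (hr : res (cur u) = 1) : N.IsPartialFlow (N.flip res (cur u)) (N.hd (cur u)) k :=
  IsPartialFlow.flip (by rw [h.labels.tl_cur u h.path.lt hc]; exact h.flow) hc hr

/-- The new node lies lower than every node of the path, since the current node has the smallest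
label there; so the path stays simple. -/
theorem push (h : N.SearchState x D res par d cur u l k) (hx : x ≤ 1) (hxD : x = 1 → D ≤ 2)
    (hs : d N.s < D) (hc : cur u < 2 * N.E) (hr : res (cur u) = 1)
    (hadm : d u = d (N.hd (cur u)) + 1) (ht : N.hd (cur u) ≠ N.t) :
    N.SearchState x D (N.flip res (cur u))
      (Function.update par (N.hd (cur u)) (N.mate (cur u)))
      (Function.update d (N.hd (cur u)) (d (N.hd (cur u)) + x))
      (Function.update cur u (N.next (cur u))) (N.hd (cur u)) (N.hd (cur u) :: l) k := by
  have htl := h.labels.tl_cur u h.path.lt hc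
  have hdu := h.label_lt hs
  have hmin := h.path.le_of_mem
  have hlab := h.labels_push hc hadm
  have hflow := h.flow_push hc hr
  have hwn : N.hd (cur u) < N.n := hd_lt hc
  have hmt := tl_mate (N := N) hc
  have hmh := hd_mate (N := N) hc
  have hmr := flip_mate (N := N) res (cur u)
  have hml := mate_lt (N := N) hc
  have hself := flip_self (N := N) (res := res) hc
  have hother := fun b => flip_of_ne (N := N) (res := res) (a := cur u) (b := b)
  generalize hw : N.hd (cur u) = w at *
  have hwl : w ∉ l := fun hw' => by have := hmin w hw'; omega
  have hwu : w ≠ u := fun e => hwl (by rw [e]; exact h.path.head_mem)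
  have hd' : ∀ v, v ≠ w → Function.update d w (d w + x) v = d v :=
    fun v hv => Function.update_of_ne hv _ _
  have hdl : ∀ v ∈ l, Function.update d w (d w + x) v = d v :=
    fun v hv => hd' v (fun e => hwl (e ▸ hv))
  have hdw : Function.update d w (d w + x) w = d w + x := Function.update_self ..
  -- `d u < D ≤ 2` and `d u = d w + 1` leave only `d w = 0`: single-path search pushes to unvisited
  -- nodes only.
  have hx1 : x = 1 → d w = 0 := fun e => by have := hxD e; omega
  refine ⟨hflow, ?_, ?_, ?_, ?_, ?_, ?_, ?_, ?_⟩
  · refine .step (p := u) (h.path.congr ?_ hdl ?_) ?_ ?_ ?_ ?_ hwl ht ?_ ?_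
    · exact fun v hv => Function.update_of_ne (ne_of_mem_of_not_mem hv hwl) _ _
    -- A path arc `par v` equal to the pushed arc would have its head `w` on the path; one equal to
    -- its reverse is residual after the push.
    · intro v hv h₁ h₂ h₃ h₄
      by_cases e₁ : par v = cur u
      · rw [e₁, hw] at h₃; exact absurd h₃ hwl
      by_cases e₂ : par v = N.mate (cur u)
      · rw [e₂, hmr]
      rw [hother _ e₁ e₂, h₄]
    · rwa [Function.update_self]
    · rwa [Function.update_self]
    · rwa [Function.update_self, hmh]
    · rwa [Function.update_self]
    · intro v hv
      rw [hdw, hdl v hv]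
      have := hmin v hv
      omega
    · rw [hdw, hdl u h.path.head_mem]; omega
  · obtain rfl | rfl : x = 0 ∨ x = 1 := by omega
    · rw [Nat.add_zero, Function.update_eq_self]; exact hlab
    · have h0 := hx1 rfl
      rw [h0]
      refine hlab.raise hwn h0 ?_
      rw [Function.update_of_ne hwu]; exact h.unvisited rfl w hwn h0
  · rw [hd' _ ht.symm, h.label_sink]
  · intro v hv
    by_cases e : v = w
    · subst e; rw [hdw]; omega
    · rw [hd' v e]; exact h.le_bound v hv
  · left
    by_cases e : N.s = w
    · exact absurd (e ▸ h.path.source_mem) hwl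
    · rwa [hd' _ e]
  · intro hx v hv h0
    by_cases e : v = w
    · subst e; rw [hdw] at h0; omega
    · rw [hd' v e] at h0
      have : v ≠ u := fun e' => h.visited hx u h.path.head_mem (e' ▸ h0)
      rw [Function.update_of_ne this]; exact h.unvisited hx v hv h0
  · intro hx v hv h1
    by_cases e : v = w
    · simp [e]
    · rw [hd' v e] at h1; simp [h.mem_path hx v hv h1]
  · intro hx v hv
    rcases List.mem_cons.mp hv with rfl | hv
    · rw [hdw]; omega
    · rw [hdl v hv]; exact h.visited hx v hv

theorem arrive (h : N.SearchState x D res par d cur u l k) (hc : cur u < 2 * N.E)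
    (hr : res (cur u) = 1) (ht : N.hd (cur u) = N.t) :
    N.IsPartialFlow (N.flip res (cur u)) N.s (k + 1) :=
  (ht ▸ h.flow_push hc hr).arrive

/-- Distance labels and current arcs stay meaningful after an augmentation, so the search resumes
with them. The path is simply forgotten: its arcs are already flipped. -/
theorem restart (h : N.SearchState 0 D res par d cur u l k) (hs : d N.s < D)
    (hc : cur u < 2 * N.E) (hr : res (cur u) = 1) (hadm : d u = d (N.hd (cur u)) + 1)
    (ht : N.hd (cur u) = N.t) :
    N.SearchState 0 D (N.flip res (cur u)) par d (Function.update cur u (N.next (cur u))) N.s [N.s]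
      (k + 1) :=
  ⟨h.arrive hc hr ht, .base, h.labels_push hc hadm, h.label_sink, h.le_bound, .inl hs, nofun, nofun,
    nofun⟩

/-- A dead end is relabelled and the travelling unit goes back along `par u`. The path condition `d
p ≤ d u + 1` says exactly that, after the relabelling, this arc does not lead upwards, as
`Labels.flip` requires. -/
theorem retreat (h : N.SearchState x D res par d cur u l k) (hs : d N.s < D)
    (hc : cur u = 2 * N.E) (hu : u ≠ N.s) :
    par u < 2 * N.E ∧ ∃ l', N.SearchState x D (N.flip res (par u)) par
      (Function.update d u (d u + 1)) (Function.update cur u (N.first u)) (N.hd (par u)) l' k := by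
  have hdu := h.label_lt hs
  have hflow := h.flow
  have hlab := h.labels.relabel h.path.lt hc
  have hmem := h.mem_path
  have hvis := h.visited
  have hpath := h.path
  cases hpath with
  | base => exact absurd rfl hu
  | @step p _ l' h₀ h₁ h₂ h₃ h₄ h₅ h₆ h₇ h₈ =>
  have hd' : ∀ v, v ≠ u → Function.update d u (d u + 1) v = d v :=
    fun v hv => Function.update_of_ne hv _ _
  have hpu : p ≠ u := fun e => h₅ (e ▸ h₀.head_mem)
  refine ⟨h₁, l', ?_, ?_, ?_, ?_, ?_, ?_, ?_, ?_, ?_⟩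
  · exact IsPartialFlow.flip (by rwa [h₂]) h₁ h₄
  · rw [h₃]
    refine h₀.congr (fun _ _ => rfl) (fun v hv => hd' v fun e => h₅ (e ▸ hv)) ?_
    intro v hv _ h₂' _ h₄'
    by_cases e₁ : par v = par u
    · have : v = u := by rw [← h₂', e₁, h₂]
      exact absurd (this ▸ hv) h₅
    by_cases e₂ : par v = N.mate (par u)
    · rw [e₂, flip_mate]
    rw [flip_of_ne e₁ e₂, h₄']
  · refine hlab.flip h₁ ?_
    rw [h₂, h₃, hd' p hpu, Function.update_self]; exact h₈
  · rw [hd' _ h₆.symm, h.label_sink]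
  · intro v hv
    by_cases e : v = u
    · subst e; rw [Function.update_self]; omega
    · rw [hd' v e]; exact h.le_bound v hv
  · left; rwa [hd' _ hu.symm]
  · intro hx v hv h0
    by_cases e : v = u
    · subst e; rw [Function.update_self] at h0; omega
    · rw [Function.update_of_ne e]; rw [hd' v e] at h0; exact h.unvisited hx v hv h0
  · intro hx v hv h1
    by_cases e : v = u
    · subst e; rw [Function.update_self] at h1
      exact absurd (by omega) (hvis hx v (by simp))
    · rw [hd' v e] at h1
      exact (List.mem_cons.mp (hmem hx v hv h1)).resolve_left e
  · intro hx v hv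
    rw [hd' v fun e => h₅ (e ▸ hv)]
    exact hvis hx v (by simp [hv])

theorem relabel_source (h : N.SearchState x D res par d cur N.s l k) (hs : d N.s < D)
    (hc : cur N.s = 2 * N.E) :
    N.SearchState x D res par (Function.update d N.s (d N.s + 1))
      (Function.update cur N.s (N.first N.s)) N.s [N.s] k := by
  have hl : l = [N.s] := by
    have := h.path
    generalize hu : N.s = u at this
    cases this with
    | base => rfl
    | step h₀ _ _ _ _ h₅ => exact absurd (hu ▸ h₀.source_mem) h₅
  subst hl
  have hd' : ∀ v, v ≠ N.s → Function.update d N.s (d N.s + 1) v = d v :=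
    fun v hv => Function.update_of_ne hv _ _
  refine ⟨h.flow, .base, h.labels.relabel N.s_lt hc, ?_, ?_, .inr rfl, ?_, ?_, ?_⟩
  · rw [hd' _ N.s_ne_t.symm, h.label_sink]
  · intro v hv
    by_cases e : v = N.s
    · subst e; rw [Function.update_self]; omega
    · rw [hd' v e]; exact h.le_bound v hv
  · intro hx v hv h0
    by_cases e : v = N.s
    · subst e; rw [Function.update_self] at h0; omega
    · rw [Function.update_of_ne e]; rw [hd' v e] at h0; exact h.unvisited hx v hv h0
  · intro hx v hv h1
    by_cases e : v = N.s
    · simp [e]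
    · rw [hd' v e] at h1; exact h.mem_path hx v hv h1
  · intro hx v hv
    rw [List.mem_singleton.mp hv, Function.update_self]; omega

end SearchState

end ArcNet

/-! ### Cuts -/

namespace ArcNet

variable {N : ArcNet} {res res' par d cur : ℕ → ℕ} {k k' x D : ℕ}

theorem SearchState.initial (hf : N.IsPartialFlow res N.s k) (hx : x ≤ 1) (hD : x < D)
    (hds : d N.s = x) (hd : ∀ v < N.n, v ≠ N.s → d v = 0) (hc : ∀ v < N.n, cur v = N.first v) :
    N.SearchState x D res par d cur N.s [N.s] k := by
  have hle : ∀ v < N.n, d v ≤ 1 := by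
    intro v hv
    by_cases e : v = N.s
    · rw [e, hds]; exact hx
    · rw [hd v hv e]; omega
  refine ⟨hf, .base, ⟨?_, ?_, ?_, ?_⟩, hd _ N.t_lt N.s_ne_t.symm, ?_, .inr rfl, fun _ v hv _ => hc v hv,
    ?_, ?_⟩
  · intro a ha _
    have := hle _ (N.tl_lt a ha)
    omega
  · intro v hv; rw [hc v hv]; exact N.first_le v hv
  · intro v hv; rw [hc v hv]; exact N.tl_first v hv
  · intro a ha hlt _
    rw [hc _ (N.tl_lt a ha)] at hlt
    exact absurd rfl (N.first_min _ (N.tl_lt a ha) a hlt)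
  · intro v hv
    by_cases e : v = N.s
    · rw [e, hds]; omega
    · rw [hd v hv e]; omega
  · intro _ v hv h1
    by_cases e : v = N.s
    · simp [e]
    · rw [hd v hv e] at h1; omega
  · intro h1 v hv
    rw [List.mem_singleton.mp hv, hds]; omega

theorem Complementary.le_one (h : N.Complementary res) {a : ℕ} (ha : a < 2 * N.E) : res a ≤ 1 := by
  have := h a ha
  omega

theorem Complementary.add (h : N.Complementary res) {e : ℕ} (he : e < N.E) :
    res e + res (N.E + e) = 1 := by
  have := h e (by omega)
  rwa [mate, if_pos he] at this

theorem sum_excess (S : ℕ → Prop) [DecidablePred S] (res : ℕ → ℕ) :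
    ∑ v ∈ Finset.range N.n with S v, N.excess res v = ∑ e ∈ Finset.range N.E,
      (1 - (res e : ℤ)) * ((if S (N.hd e) then 1 else 0) - (if S (N.tl e) then 1 else 0)) := by
  unfold excess
  rw [Finset.sum_comm]
  refine Finset.sum_congr rfl fun e he => ?_
  have he := Finset.mem_range.mp he
  have h₁ := N.tl_lt e (by omega)
  have h₂ := hd_lt (N := N) (a := e) (by omega)
  rw [← Finset.mul_sum, Finset.sum_sub_distrib, Finset.sum_ite_eq, Finset.sum_ite_eq]
  simp [h₁, h₂]

theorem IsPartialFlow.value_eq (hf : N.IsPartialFlow res N.s k) (S : ℕ → Prop) [DecidablePred S]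
    (hs : S N.s) (ht : ¬ S N.t) : (k : ℤ) = ∑ e ∈ Finset.range N.E,
      (1 - (res e : ℤ)) * ((if S (N.tl e) then 1 else 0) - (if S (N.hd e) then 1 else 0)) := by
  have h := sum_excess (N := N) S res
  have h' : ∑ v ∈ Finset.range N.n with S v, N.excess res v = -k := by
    simp_rw [hf.excess_eq, sub_self, add_zero]
    rw [← Finset.mul_sum, Finset.sum_sub_distrib, Finset.sum_ite_eq, Finset.sum_ite_eq]
    simp [hs, ht, N.s_lt]
  rw [← neg_inj, ← h', h, ← Finset.sum_neg_distrib]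
  exact Finset.sum_congr rfl fun e _ => by ring

/-- The number of residual arcs that leave `S`. -/
def crossing (N : ArcNet) (res : ℕ → ℕ) (S : ℕ → Prop) [DecidablePred S] : ℕ :=
  Finset.card {a ∈ Finset.range (2 * N.E) | res a = 1 ∧ S (N.tl a) ∧ ¬ S (N.hd a)}

/-- Both values are net flows across the same cut. On each edge, their difference is at most the
number of residual arcs of that edge that leave `S`. -/
theorem IsPartialFlow.le_add_crossing (hf : N.IsPartialFlow res N.s k)
    (hf' : N.IsPartialFlow res' N.s k') (S : ℕ → Prop) [DecidablePred S]
    (hs : S N.s) (ht : ¬ S N.t) : k' ≤ k + N.crossing res S := by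
  have h := hf.value_eq S hs ht
  have h' := hf'.value_eq S hs ht
  zify
  rw [h, h', crossing, Finset.card_filter, two_mul, Finset.sum_range_add]
  push_cast
  rw [← Finset.sum_add_distrib, ← Finset.sum_add_distrib]
  refine Finset.sum_le_sum fun e he => ?_
  have he := Finset.mem_range.mp he
  have h₁ := hf.complementary.add he
  have h₂ := hf'.complementary.le_one (a := e) (by omega)
  rw [N.tl_add e he, N.hd_add e he]
  obtain h₃ | h₃ : res e = 0 ∨ res e = 1 := by omega
  · rw [h₃, show res (N.E + e) = 1 by omega]
    by_cases h₄ : S (N.tl e) <;> by_cases h₅ : S (N.hd e) <;> simp [h₄, h₅]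
    exact_mod_cast h₂
  · rw [h₃, show res (N.E + e) = 0 by omega]
    by_cases h₄ : S (N.tl e) <;> by_cases h₅ : S (N.hd e) <;> simp [h₄, h₅]
    exact_mod_cast h₂

/-- Parallel edges touch the source or the sink. -/
def ParallelOnlyAtTerminals (N : ArcNet) : Prop :=
  ∀ e < N.E, ∀ e' < N.E, N.tl e = N.tl e' → N.hd e = N.hd e' → e ≠ e' →
    N.tl e = N.s ∨ N.tl e = N.t ∨ N.hd e = N.s ∨ N.hd e = N.t

/-! ### The level cuts of Even and Tarjan. -/

theorem card_residual (h : N.Complementary res) :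
    Finset.card {a ∈ Finset.range (2 * N.E) | res a = 1} = N.E := by
  rw [Finset.card_filter, two_mul, Finset.sum_range_add, ← Finset.sum_add_distrib]
  rw [Finset.sum_congr rfl (g := fun _ => 1)]
  · simp
  · intro e he
    have := h.add (Finset.mem_range.mp he)
    split_ifs <;> omega

/-- Labels drop by at most one along a residual arc, so different level cuts are crossed by disjoint
sets of residual arcs. There are `E ≤ D * D` residual arcs and `D` levels to choose from. -/
theorem exists_crossing_le_of_le_sq (hc : N.Complementary res) (hl : N.Labels res d cur)
    {D : ℕ} (hD : N.E ≤ D * D) (hD1 : 1 ≤ D) :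
    ∃ k ∈ Finset.Icc 2 (D + 1), N.crossing res (fun v => k ≤ d v) ≤ D := by
  by_contra! hcon
  have h₁ : (Finset.Icc 2 (D + 1)).card • (D + 1) ≤
      ∑ k ∈ Finset.Icc 2 (D + 1), N.crossing res (fun v => k ≤ d v) :=
    Finset.card_nsmul_le_sum _ _ _ fun k hk => hcon k hk
  have h₂ : ∑ k ∈ Finset.Icc 2 (D + 1), N.crossing res (fun v => k ≤ d v) ≤ N.E := by
    unfold crossing
    refine le_of_le_of_eq ?_ (card_residual hc)
    rw [← Finset.card_biUnion]
    · refine Finset.card_le_card fun a ha => ?_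
      simp only [Finset.mem_biUnion, Finset.mem_filter] at ha ⊢
      obtain ⟨_, _, h₁, h₂, _⟩ := ha
      exact ⟨h₁, h₂⟩
    · intro i _ j _ hij
      rw [Function.onFun, Finset.disjoint_left]
      intro a ha ha'
      simp only [Finset.mem_filter, Finset.mem_range] at ha ha'
      have := hl.valid a ha.1 ha.2.1
      omega
  simp only [Nat.card_Icc, smul_eq_mul] at h₁
  have : (D + 1 + 1 - 2) * (D + 1) = D * D + D := by
    rw [show D + 1 + 1 - 2 = D by omega]; ring
  omega

/-- A crossing arc runs from level `k` to level `k - 1`, and both levels avoid the terminals. So an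
ordered pair of nodes carries at most one edge and at most one reverse of an edge, whence the factor
2. -/
theorem crossing_le_mul (hP : N.ParallelOnlyAtTerminals) (hl : N.Labels res d cur)
    {k : ℕ} (hk : 2 ≤ k) (hs : k < d N.s) (ht : d N.t = 0) :
    N.crossing res (fun v => k ≤ d v) ≤
      2 * (Finset.card {v ∈ Finset.range N.n | d v = k} *
        Finset.card {v ∈ Finset.range N.n | d v = k - 1}) := by
  have hcard : (Finset.range 2 ×ˢ (Finset.filter (fun v => d v = k) (Finset.range N.n) ×ˢ
      Finset.filter (fun v => d v = k - 1) (Finset.range N.n))).card =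
      2 * (Finset.card {v ∈ Finset.range N.n | d v = k} *
        Finset.card {v ∈ Finset.range N.n | d v = k - 1}) := by
    rw [Finset.card_product, Finset.card_product, Finset.card_range]
  rw [← hcard]
  have hlev : ∀ a ∈ Finset.filter (fun a => res a = 1 ∧ k ≤ d (N.tl a) ∧ ¬ k ≤ d (N.hd a))
      (Finset.range (2 * N.E)), a < 2 * N.E ∧ d (N.tl a) = k ∧ d (N.hd a) = k - 1 := by
    intro a ha
    simp only [Finset.mem_filter, Finset.mem_range] at ha
    have := hl.valid a ha.1 ha.2.1
    omega
  -- The first coordinate tells edges from reverses. Within each kind, the two ends determine the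
  -- arc because their labels lie strictly between those of sink and source.
  refine Finset.card_le_card_of_injOn (fun a => (if a < N.E then 0 else 1, N.tl a, N.hd a)) ?_ ?_
  · intro a ha
    obtain ⟨h₁, h₂, h₃⟩ := hlev a ha
    simp only [Finset.coe_product, Set.mem_prod, Finset.mem_coe, Finset.mem_filter, Finset.mem_range]
    exact ⟨by split_ifs <;> omega, ⟨N.tl_lt a h₁, h₂⟩, hd_lt h₁, h₃⟩
  · intro a ha b hb hab
    obtain ⟨h₁, h₂, h₃⟩ := hlev a ha
    obtain ⟨h₁', h₂', h₃'⟩ := hlev b hb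
    simp only [Prod.mk.injEq] at hab
    obtain ⟨hab₁, hab₂, hab₃⟩ := hab
    have e₁ : N.tl a ≠ N.s := fun e => by rw [e] at h₂; omega
    have e₂ : N.tl a ≠ N.t := fun e => by rw [e] at h₂; omega
    have e₃ : N.hd a ≠ N.s := fun e => by rw [e] at h₃; omega
    have e₄ : N.hd a ≠ N.t := fun e => by rw [e] at h₃; omega
    by_contra hne
    by_cases ha' : a < N.E
    · have hb' : b < N.E := by by_contra hb'; simp [ha', hb'] at hab₁
      rcases hP a ha' b hb' hab₂ hab₃ hne with h | h | h | h <;> contradiction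
    · have hb' : ¬ b < N.E := by intro hb'; simp [ha', hb'] at hab₁
      obtain ⟨i, rfl⟩ : ∃ i, a = N.E + i := ⟨a - N.E, by omega⟩
      obtain ⟨j, rfl⟩ : ∃ j, b = N.E + j := ⟨b - N.E, by omega⟩
      have hi : i < N.E := by omega
      have hj : j < N.E := by omega
      rw [N.tl_add i hi] at hab₂ e₁ e₂
      rw [N.hd_add i hi] at hab₃ e₃ e₄
      rw [N.tl_add j hj] at hab₂
      rw [N.hd_add j hj] at hab₃
      rcases hP i hi j hj hab₃ hab₂ (by omega) with h | h | h | h <;> contradiction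

theorem sum_card_level_le (n : ℕ) (d : ℕ → ℕ) (s : Finset ℕ) :
    ∑ k ∈ s, Finset.card {v ∈ Finset.range n | d v = k} ≤ n := by
  rw [← Finset.card_biUnion]
  · refine (Finset.card_le_card (t := Finset.range n) fun a ha => ?_).trans_eq (Finset.card_range n)
    simp only [Finset.mem_biUnion, Finset.mem_filter] at ha
    exact ha.choose_spec.2.1
  · intro i _ j _ hij
    rw [Function.onFun, Finset.disjoint_left]
    intro a ha ha'
    simp only [Finset.mem_filter] at ha ha'
    omega

/-- By averaging over `D` levels, some two consecutive levels have at most `2 * n / D` nodes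
together. By the inequality of arithmetic and geometric means the product of their sizes is at most
`(n / D) ^ 2 ≤ D`. -/
theorem exists_crossing_le_of_le_cube (hP : N.ParallelOnlyAtTerminals) (hl : N.Labels res d cur)
    {D : ℕ} (hD : N.n * N.n ≤ D * D * D) (hD1 : 1 ≤ D) (hs : D + 2 ≤ d N.s) (ht : d N.t = 0) :
    ∃ k ∈ Finset.Icc 2 (D + 1), N.crossing res (fun v => k ≤ d v) ≤ 2 * D := by
  set L : ℕ → ℕ := fun k => Finset.card {v ∈ Finset.range N.n | d v = k} with hL
  obtain ⟨k, hk, hkn⟩ : ∃ k ∈ Finset.Icc 2 (D + 1), D * (L k + L (k - 1)) ≤ 2 * N.n := by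
    by_contra! hcon
    have h₁ : (Finset.Icc 2 (D + 1)).card • (2 * N.n + 1) ≤
        ∑ k ∈ Finset.Icc 2 (D + 1), D * (L k + L (k - 1)) :=
      Finset.card_nsmul_le_sum _ _ _ fun k hk => hcon k hk
    have h₂ : ∑ k ∈ Finset.Icc 2 (D + 1), L (k - 1) ≤ N.n := by
      rw [← Finset.sum_image (f := L) (g := fun k => k - 1)]
      · exact sum_card_level_le _ _ _
      · intro i hi j hj hij
        simp only [Finset.coe_Icc, Set.mem_Icc] at hi hj hij
        omega
    have h₃ : ∑ k ∈ Finset.Icc 2 (D + 1), L k ≤ N.n := sum_card_level_le _ _ _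
    rw [← Finset.mul_sum, Finset.sum_add_distrib] at h₁
    have h₄ := Nat.mul_le_mul_left D (Nat.add_le_add h₃ h₂)
    simp only [Nat.card_Icc, smul_eq_mul] at h₁
    rw [show D + 1 + 1 - 2 = D by omega] at h₁
    have := Nat.le_of_mul_le_mul_left (h₁.trans h₄) hD1
    omega
  refine ⟨k, hk, ?_⟩
  have hk' := Finset.mem_Icc.mp hk
  refine (crossing_le_mul hP hl hk'.1 (by omega) ht).trans (Nat.mul_le_mul_left 2 ?_)
  change L k * L (k - 1) ≤ D
  generalize L k = p at *
  generalize L (k - 1) = q at *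
  have h₁ : 4 * (p * q) ≤ (p + q) * (p + q) := by
    zify; nlinarith [sq_nonneg ((p : ℤ) - q)]
  have h₂ : (D * (p + q)) * (D * (p + q)) ≤ (2 * N.n) * (2 * N.n) := Nat.mul_le_mul hkn hkn
  have h₃ : D * D * (4 * (p * q)) ≤ D * D * (4 * D) := by
    calc D * D * (4 * (p * q)) ≤ D * D * ((p + q) * (p + q)) := Nat.mul_le_mul_left _ h₁
      _ = (D * (p + q)) * (D * (p + q)) := by ring
      _ ≤ _ := h₂
      _ = 4 * (N.n * N.n) := by ring
      _ ≤ 4 * (D * D * D) := Nat.mul_le_mul_left _ hD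
      _ = _ := by ring
  have := Nat.le_of_mul_le_mul_left h₃ (by positivity)
  omega

/-- If the source has a large label, the flow is almost maximum. -/
theorem IsPartialFlow.le_add_of_label (hP : N.ParallelOnlyAtTerminals) (hl : N.Labels res d cur)
    {D : ℕ} (hD : N.E ≤ D * D ∨ N.n * N.n ≤ D * D * D) (hD1 : 1 ≤ D) (hs : D + 2 ≤ d N.s)
    (ht : d N.t = 0) (hf : N.IsPartialFlow res N.s k) (hf' : N.IsPartialFlow res' N.s k') :
    k' ≤ k + 2 * D := by
  obtain ⟨j, hj, hcr⟩ : ∃ j ∈ Finset.Icc 2 (D + 1), N.crossing res (fun v => j ≤ d v) ≤ 2 * D := by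
    rcases hD with hD | hD
    · obtain ⟨j, hj, h⟩ := exists_crossing_le_of_le_sq hf.complementary hl hD hD1
      exact ⟨j, hj, by omega⟩
    · exact exists_crossing_le_of_le_cube hP hl hD hD1 hs ht
  have hj := Finset.mem_Icc.mp hj
  exact (hf.le_add_crossing hf' (fun v => j ≤ d v) (by omega) (by omega)).trans (by omega)

/-! ### Maximum flows -/

/-- `N` is the residual form of the network `U`. -/
structure Represents (N : ArcNet) (U : UnitNetwork) : Prop where
  n_eq : N.n = U.numNodes
  E_eq : N.E = U.numEdges
  s_eq : N.s = U.source
  t_eq : N.t = U.sink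
  tl_eq : ∀ e : Fin U.numEdges, N.tl e = U.tail e
  hd_eq : ∀ e : Fin U.numEdges, N.hd e = U.head e

theorem Represents.parallelOnlyAtTerminals {U : UnitNetwork} (h : N.Represents U)
    (hU : U.ParallelOnlyAtTerminals) : N.ParallelOnlyAtTerminals := by
  intro e he e' he' h₁ h₂ hne
  rw [h.E_eq] at he he'
  have := hU ⟨e, he⟩ ⟨e', he'⟩
  rw [h.tl_eq ⟨e, he⟩, h.tl_eq ⟨e', he'⟩] at h₁
  rw [h.hd_eq ⟨e, he⟩, h.hd_eq ⟨e', he'⟩] at h₂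
  rw [h.tl_eq ⟨e, he⟩, h.hd_eq ⟨e, he⟩, h.s_eq, h.t_eq]
  simpa [Fin.ext_iff] using this (Fin.ext h₁) (Fin.ext h₂) (by simpa [Fin.ext_iff] using hne)

end ArcNet

theorem UnitNetwork.outflow_sub_inflow (U : UnitNetwork) (f : Fin U.numEdges → ℝ)
    (v : Fin U.numNodes) : U.outflow f v - U.inflow f v =
      ∑ e, f e * ((if U.tail e = v then 1 else 0) - (if U.head e = v then 1 else 0)) := by
  simp only [UnitNetwork.outflow, UnitNetwork.inflow, Finset.sum_filter, ← Finset.sum_sub_distrib]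
  refine Finset.sum_congr rfl fun e _ => ?_
  split_ifs <;> ring

theorem UnitNetwork.IsFlow.flowValue_eq {U : UnitNetwork} {f : Fin U.numEdges → ℝ} (hf : U.IsFlow f)
    (S : Fin U.numNodes → Prop) [DecidablePred S] (hs : S U.source) (ht : ¬ S U.sink) :
    U.flowValue f =
      ∑ e, f e * ((if S (U.tail e) then 1 else 0) - (if S (U.head e) then 1 else 0)) := by
  have h₁ : ∑ v with S v, (U.outflow f v - U.inflow f v) = U.flowValue f := by
    rw [Finset.sum_eq_single_of_mem U.source (by simpa using hs)]
    · rfl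
    · intro v hv hvs
      rw [hf.2 v hvs, sub_self]
      rintro rfl
      exact ht (by simpa using hv)
  rw [← h₁]
  simp_rw [U.outflow_sub_inflow]
  rw [Finset.sum_comm]
  refine Finset.sum_congr rfl fun e _ => ?_
  rw [← Finset.mul_sum, Finset.sum_sub_distrib, Finset.sum_ite_eq, Finset.sum_ite_eq]
  simp

namespace ArcNet

variable {N : ArcNet} {res res' par d cur : ℕ → ℕ} {k k' x D : ℕ}

theorem IsPartialFlow.isFlow {U : UnitNetwork} (h : N.Represents U)
    (hf : N.IsPartialFlow res N.s k) : U.IsFlow fun e => ((1 - res e : ℕ) : ℝ) := by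
  have hle : ∀ e : Fin U.numEdges, res e ≤ 1 := fun e =>
    hf.complementary.le_one (by have := e.2; rw [h.E_eq]; omega)
  refine ⟨fun e => ⟨Nat.cast_nonneg _, Nat.cast_le_one.mpr (Nat.sub_le 1 _)⟩,
    fun v hvs hvt => ?_⟩
  rw [eq_comm, ← sub_eq_zero, U.outflow_sub_inflow]
  have hv := hf.excess_eq v
  rw [h.s_eq, h.t_eq, if_neg (fun e => hvt (Fin.ext e.symm)), if_neg (fun e => hvs (Fin.ext e.symm)),
    excess, h.E_eq, Finset.sum_range] at hv
  have hv' := congrArg (fun z : ℤ => -(z : ℝ)) hv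
  push_cast at hv'
  rw [← Finset.sum_neg_distrib] at hv'
  simp only [mul_zero, add_zero, neg_zero] at hv'
  refine Eq.trans ?_ hv'
  refine Finset.sum_congr rfl fun e _ => ?_
  rw [h.tl_eq, h.hd_eq, Nat.cast_sub (hle e)]
  simp only [Fin.ext_iff]
  push_cast
  ring

/-- A flow is maximum if no residual arc leaves a set that separates the source from the sink. -/
theorem IsPartialFlow.isMaxFlow {U : UnitNetwork} (h : N.Represents U)
    (hf : N.IsPartialFlow res N.s k) (S : ℕ → Prop) (hs : S N.s) (ht : ¬ S N.t)
    (hS : ∀ a < 2 * N.E, res a = 1 → S (N.tl a) → S (N.hd a)) :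
    U.IsMaxFlow fun e => ((1 - res e : ℕ) : ℝ) := by
  classical
  refine ⟨hf.isFlow h, fun g hg => ?_⟩
  rw [h.s_eq] at hs
  rw [h.t_eq] at ht
  rw [hg.flowValue_eq (fun v => S v) hs ht, (hf.isFlow h).flowValue_eq (fun v => S v) hs ht]
  refine Finset.sum_le_sum fun e _ => ?_
  have he : (e : ℕ) < N.E := by rw [h.E_eq]; exact e.2
  have h₁ := hS e (by omega)
  have h₂ := hS (N.E + e) (by omega)
  have h₃ := hf.complementary.add he
  rw [N.tl_add e he, N.hd_add e he, h.tl_eq, h.hd_eq] at h₂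
  rw [h.tl_eq, h.hd_eq] at h₁
  have hg' := hg.1 e
  by_cases h₄ : S (U.tail e) <;> by_cases h₅ : S (U.head e)
  · simp [h₄, h₅]
  · have : res e ≠ 1 := fun h' => h₅ (h₁ h' h₄)
    rw [show res e = 0 by omega]
    simpa [h₄, h₅] using hg'.2
  · have : res (N.E + e) ≠ 1 := fun h' => h₄ (h₂ h' h₅)
    rw [show res e = 1 by omega]
    simpa [h₄, h₅] using hg'.1
  · simp [h₄, h₅]

/-- The cut consists of the exhausted nodes. A residual arc leaving it would end at a node of label
1, which lies on the current path; but the path ends at the source, whose label is at least 2, and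
no label on the path is smaller. -/
theorem SearchState.isMaxFlow {U : UnitNetwork} (h : N.Represents U) {u : ℕ} {l : List ℕ}
    (hst : N.SearchState 1 2 res par d cur u l k) (hs : 2 ≤ d N.s) :
    u = N.s ∧ U.IsMaxFlow fun e => ((1 - res e : ℕ) : ℝ) := by
  have hu : u = N.s := hst.source_lt.resolve_left (by omega)
  subst hu
  refine ⟨rfl, hst.flow.isMaxFlow h (fun v => 2 ≤ d v) hs (by rw [hst.label_sink]; omega)
    fun a ha hr htl => ?_⟩
  have h₁ := hst.labels.valid a ha hr
  have h₂ := hst.mem_path rfl (N.hd a) (hd_lt ha)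
  have h₃ := hst.path.le_of_mem (N.hd a)
  by_contra hlt
  have := h₃ (h₂ (by omega))
  omega

end ArcNet

/-! ### A max-flow program -/

namespace MaxFlow

open Program

/-- The number at which the label of the source ends the search. -/
abbrev bound : ℕ := 32
abbrev boundSq : ℕ := 33
abbrev boundCube : ℕ := 34
abbrev nodesSq : ℕ := 35
/-- The number of arcs. -/
abbrev numArcs : ℕ := 36
abbrev tl : ℕ := 37
abbrev hd : ℕ := 38
abbrev mate : ℕ := 39
abbrev res : ℕ := 40
abbrev next : ℕ := 41
abbrev first : ℕ := 42
abbrev cur : ℕ := 43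
abbrev label : ℕ := 44
abbrev par : ℕ := 45
/-- The current node. -/
abbrev node : ℕ := 46
/-- `0` in the search with distance labels, `1` in the search for a single augmenting path. -/
abbrev mode : ℕ := 47
/-- The current arc. -/
abbrev arc : ℕ := 48
/-- Loop counter. -/
abbrev idx : ℕ := 49

def buildArcs : Program := block [
  assign numArcs (.add (val Mem.netE) (val Mem.netE)),
  forRange idx (.lit 0) (val Mem.netE) (block [
    set tl (val idx) (cell Mem.netTail idx),
    set hd (val idx) (cell Mem.netHead idx),
    set mate (val idx) (.add (val Mem.netE) (val idx)),
    set res (val idx) (.lit 1),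
    set tl (.add (val Mem.netE) (val idx)) (cell Mem.netHead idx),
    set hd (.add (val Mem.netE) (val idx)) (cell Mem.netTail idx),
    set mate (.add (val Mem.netE) (val idx)) (val idx),
    set res (.add (val Mem.netE) (val idx)) (.lit 0)])]

def buildLists : Program := block [
  forRange idx (.lit 0) (val Mem.netV) (set first (val idx) (val numArcs)),
  assign idx (val numArcs),
  loop (val idx) (block [
    decr idx,
    set next (val idx) (.get first (cell tl idx)),
    set first (cell tl idx) (val idx)])]

/-- Nonzero if and only if both `e₁` and `e₂` are. -/
def both (e₁ e₂ : Expr) : Expr :=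
  .sub (.add (.sub (.lit 1) (.sub (.lit 1) e₁)) (.sub (.lit 1) (.sub (.lit 1) e₂))) (.lit 1)

/-- Zero if and only if `e₁ = e₂`. -/
def diff (e₁ e₂ : Expr) : Expr := .add (.sub e₁ e₂) (.sub e₂ e₁)

/-- The least `D ≥ 1` with `D ^ 2 ≥ |E|` or `D ^ 3 ≥ |V| ^ 2`, plus two. -/
def computeBound : Program := block [
  assign nodesSq (.lit 0),
  forRange idx (.lit 0) (val Mem.netV) (assign nodesSq (.add (val nodesSq) (val Mem.netV))),
  assign bound (.lit 1),
  assign boundSq (.lit 1),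
  assign boundCube (.lit 1),
  loop (both (lt (val boundSq) (val Mem.netE)) (lt (val boundCube) (val nodesSq))) (block [
    assign boundCube (.add (.add (val boundCube) (.add (val boundSq) (.add (val boundSq) (val boundSq))))
      (.add (.add (val bound) (.add (val bound) (val bound))) (.lit 1))),
    assign boundSq (.add (.add (val boundSq) (.add (val bound) (val bound))) (.lit 1)),
    incr bound]),
  assign bound (.add (val bound) (.lit 2))]

def startSearch : Program := block [
  forRange idx (.lit 0) (val Mem.netV) (block [
    set label (val idx) (.lit 0),
    set cur (val idx) (cell first idx)]),
  set label (val Mem.netS) (val mode),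
  assign node (val Mem.netS)]

def flipArc : Program := block [
  set res (val arc) (.lit 0),
  set res (cell mate arc) (.lit 1)]

/-- Send a unit from the current node along the current arc. -/
def push : Program := block [
  flipArc,
  ite (diff (cell hd arc) (val Mem.netT))
    (block [
      set par (cell hd arc) (cell mate arc),
      set label (cell hd arc) (.add (.get label (cell hd arc)) (val mode)),
      assign node (cell hd arc)])
    (block [
      assign node (val Mem.netS),
      assign bound (.sub (val bound) (.add (val mode) (val mode)))])]

def scan : Program := block [
  assign arc (cell cur node),
  set cur (val node) (cell next arc),
  ite (cell res arc)
    (ite (diff (cell label node) (.add (.get label (cell hd arc)) (.lit 1))) skip push) skip]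

def relabel : Program := block [
  set label (val node) (.add (cell label node) (.lit 1)),
  set cur (val node) (cell first node),
  ite (diff (val node) (val Mem.netS))
    (block [assign arc (cell par node), flipArc, assign node (cell hd arc)])
    skip]

def search : Program :=
  loop (lt (.get label (val Mem.netS)) (val bound))
    (ite (lt (cell cur node) (val numArcs)) scan relabel)

def maxFlow : Program := block [
  buildArcs,
  buildLists,
  computeBound,
  assign mode (.lit 0),
  startSearch,
  search,
  assign mode (.lit 1),
  assign bound (.lit 0),
  loop (.sub (.lit 1) (val bound)) (block [startSearch, assign bound (.lit 2), search]),
  forRange idx (.lit 0) (val Mem.netE)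
    (set Mem.netFlow (val idx) (.sub (.lit 1) (cell res idx)))]

/-- The memory `σ` holds the network `N` in the form that the search uses. -/
structure Holds (N : ArcNet) (σ : Memory) : Prop where
  n_eq : σ Mem.netV 0 = N.n
  E_eq : σ Mem.netE 0 = N.E
  s_eq : σ Mem.netS 0 = N.s
  t_eq : σ Mem.netT 0 = N.t
  numArcs_eq : σ numArcs 0 = 2 * N.E
  tl_eq : σ tl = N.tl
  hd_eq : σ hd = N.hd
  mate_eq : ∀ a < 2 * N.E, σ mate a = N.mate a
  first_eq : σ first = N.first
  next_eq : σ next = N.next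

/-- `43` is the index of `cur`; the arrays that `Holds` speaks of are all smaller, and the excluded
ones are not among them. -/
theorem Holds.congr {N : ArcNet} {σ σ' : Memory} (h : Holds N σ)
    (hσ : ∀ a < 43, a ≠ Mem.netFlow → a ≠ bound → a ≠ res → σ' a = σ a) : Holds N σ' := by
  obtain ⟨h₁, h₂, h₃, h₄, h₅, h₆, h₇, h₈, h₉, h₁₀⟩ := h
  refine ⟨?_, ?_, ?_, ?_, ?_, ?_, ?_, ?_, ?_, ?_⟩ <;> rw [hσ _ (by decide) (by decide) (by decide) (by decide)] <;>
    assumption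

/-! ### Correctness and cost of the steps of the search. -/

theorem runs_flipArc {N : ArcNet} {σ : Memory} (h : Holds N σ) (ha : σ arc 0 < 2 * N.E)
    {Q : Memory → ℕ → Prop}
    (hQ : ∀ σ', σ' res = N.flip (σ res) (σ arc 0) → (∀ b, b ≠ res → σ' b = σ b) → Q σ' 3) :
    Runs flipArc σ Q := by
  simp only [flipArc, Runs.block_cons_iff, Runs.block_nil_iff, Runs.set_iff, Expr.eval, val, cell,
    Memory.write_apply]
  refine hQ _ ?_ ?_
  · simp [Memory.write_apply, h.mate_eq _ ha, ArcNet.flip]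
  · intro b hb
    simp [Memory.write_apply, hb]

/-- What a step of the search achieves. -/
def Progress (N : ArcNet) (x D k : ℕ) (σ σ' : Memory) : Prop :=
  ((σ' bound 0 = D ∧ ∃ l k', (x = 1 → k' = k) ∧
      N.SearchState x D (σ' res) (σ' par) (σ' label) (σ' cur) (σ' node 0) l k') ∨
    x = 1 ∧ σ' bound 0 = 0 ∧ N.IsPartialFlow (σ' res) N.s (k + 1)) ∧
  N.potential (σ label) (σ cur) + 1 ≤ N.potential (σ' label) (σ' cur)

theorem diff_eq_zero {σ : Memory} {e₁ e₂ : Expr} : (diff e₁ e₂).eval σ = 0 ↔ e₁.eval σ = e₂.eval σ := by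
  simp only [diff, Expr.eval]
  omega

theorem runs_scan {N : ArcNet} {σ : Memory} (h : Holds N σ) {x D k : ℕ} {l : List ℕ}
    (hx : x ≤ 1) (hxD : x = 1 → D = 2) (hmode : σ mode 0 = x) (hbound : σ bound 0 = D)
    (hst : N.SearchState x D (σ res) (σ par) (σ label) (σ cur) (σ node 0) l k)
    (hs : σ label N.s < D) (hc : σ cur (σ node 0) < 2 * N.E) :
    Runs scan σ fun σ' t => Progress N x D k σ σ' ∧ t ≤ 20 := by
  have htl := hst.labels.tl_cur _ hst.path.lt hc
  have hpot := ArcNet.potential_advance (d := σ label) hc htl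
  rw [scan, Runs.block_cons_iff, assign, Runs.set_iff, Runs.block_cons_iff, Runs.set_iff]
  simp only [Expr.eval, val, cell]
  obtain ⟨τ, hτ⟩ : ∃ τ, τ = ((σ.write arc 0 (σ cur (σ node 0))).write cur
    ((σ.write arc 0 (σ cur (σ node 0))) node 0) ((σ.write arc 0 (σ cur (σ node 0))) next
    ((σ.write arc 0 (σ cur (σ node 0))) arc 0))) := ⟨_, rfl⟩
  rw [← hτ]
  have h₁ : τ arc 0 = σ cur (σ node 0) := by simp [hτ, Memory.write_apply]
  have h₂ : τ cur = Function.update (σ cur) (σ node 0) (N.next (σ cur (σ node 0))) := by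
    simp [hτ, Memory.write_apply, h.next_eq]
  have h₃ : ∀ b, b ≠ arc → b ≠ cur → τ b = σ b := by
    intro b hb hb'
    simp [hτ, Memory.write_apply, hb, hb']
  have hτN : Holds N τ := h.congr fun b hb _ _ _ => h₃ b (by unfold arc; omega) (by unfold cur; omega)
  clear hτ
  have hnode : τ node = σ node := h₃ _ (by decide) (by decide)
  have hres : τ res = σ res := h₃ _ (by decide) (by decide)
  have hlabel : τ label = σ label := h₃ _ (by decide) (by decide)
  have hpar : τ par = σ par := h₃ _ (by decide) (by decide)
  have hτm : τ mode 0 = x := by rw [h₃ _ (by decide) (by decide), hmode]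
  have hτb : τ bound 0 = D := by rw [h₃ _ (by decide) (by decide), hbound]
  generalize hu : σ node 0 = u at *
  generalize ha : σ cur u = a at *
  have hskip : (σ res a = 1 → σ label u ≠ σ label (N.hd a) + 1) → Progress N x D k σ τ := by
    intro hadm
    refine ⟨.inl ⟨hτb, l, k, fun _ => rfl, ?_⟩, ?_⟩
    · rw [hres, hpar, hlabel, h₂, hnode, hu, ← ha]
      exact hst.advance (by rwa [ha]) (by rwa [ha])
    · rw [hlabel, h₂, ← ha]; rw [ha]; exact hpot
  rw [Runs.block_cons_iff, Runs.ite_iff]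
  simp only [Expr.eval, h₁, hres]
  split_ifs with hr
  · rw [Runs.skip_iff, Runs.block_nil_iff]
    exact ⟨hskip (by omega), by omega⟩
  have hr1 : σ res a = 1 := by
    have := hst.flow.complementary.le_one hc
    omega
  rw [Runs.ite_iff]
  simp only [diff_eq_zero, Expr.eval, hnode, hu, hlabel, h₁, hτN.hd_eq]
  split_ifs with hadm
  swap
  · rw [Runs.skip_iff, Runs.block_nil_iff]
    exact ⟨hskip fun _ => hadm, by omega⟩
  rw [push, Runs.block_cons_iff]
  refine runs_flipArc hτN (by rwa [h₁]) fun υ hυr hυ => ?_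
  have hυN : Holds N υ := hτN.congr fun b _ _ _ hb => hυ b hb
  have g₁ : υ arc 0 = a := by rw [hυ _ (by decide), h₁]
  have g₂ : υ mode 0 = x := by rw [hυ _ (by decide), hτm]
  have g₃ : υ bound 0 = D := by rw [hυ _ (by decide), hτb]
  have g₄ : υ label = σ label := by rw [hυ _ (by decide), hlabel]
  have g₅ : υ par = σ par := by rw [hυ _ (by decide), hpar]
  have g₆ : υ cur = Function.update (σ cur) u (N.next (σ cur u)) := by rw [hυ _ (by decide), h₂, ha]
  have g₇ : υ res = N.flip (σ res) (σ cur u) := by rw [hυr, hres, h₁, ha]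
  have g₈ : υ mate a = N.mate a := hυN.mate_eq a hc
  subst ha
  rw [Runs.block_cons_iff, Runs.ite_iff]
  simp only [diff_eq_zero, Expr.eval, cell, val, g₁, hυN.hd_eq, hυN.t_eq]
  split_ifs with ht
  · simp (disch := decide) only [assign, Runs.block_cons_iff, Runs.block_nil_iff, Runs.set_iff, Expr.eval,
      Memory.write_of_ne]
    refine ⟨⟨?_, ?_⟩, by omega⟩
    -- On arrival `bound` drops by `2 * x`. For `x = 0` it is unchanged and the search goes on; for
    -- `x = 1` it falls from 2 to 0, which makes the loop test fail.
    · obtain rfl | rfl : x = 0 ∨ x = 1 := by omega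
      · left
        simp (disch := decide) only [Memory.write_same, Memory.write_of_ne, Function.update_self, g₂, g₃,
          g₄, g₅, g₆, g₇, hυN.s_eq]
        exact ⟨by simp, _, _, nofun, hst.restart hs hc hr1 hadm ht⟩
      · right
        simp (disch := decide) only [Memory.write_same, Memory.write_of_ne, Function.update_self, g₂, g₃,
          g₇, hυN.s_eq]
        exact ⟨trivial, by simp [hxD rfl], hst.arrive hc hr1 ht⟩
    · simp (disch := decide) only [Memory.write_of_ne, g₄, g₆]
      exact hpot
  · simp (disch := decide) only [assign, Runs.block_cons_iff, Runs.block_nil_iff, Runs.set_iff, Expr.eval,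
      Memory.write_of_ne, g₁, g₂, g₄, g₈, hυN.hd_eq]
    refine ⟨⟨.inl ?_, ?_⟩, by omega⟩
    · simp (disch := decide) only [Memory.write_same, Memory.write_of_ne, Function.update_self, g₃,
        g₄, g₅, g₆, g₇]
      exact ⟨trivial, _, _, fun _ => rfl,
        hst.push hx (fun e => (hxD e).le) hs hc hr1 hadm ht⟩
    · simp (disch := decide) only [Memory.write_same, Memory.write_of_ne, g₄, g₆]
      exact hpot.trans ArcNet.potential_raise

theorem runs_relabel {N : ArcNet} {σ : Memory} (h : Holds N σ) {x D k : ℕ} {l : List ℕ}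
    (hbound : σ bound 0 = D)
    (hst : N.SearchState x D (σ res) (σ par) (σ label) (σ cur) (σ node 0) l k)
    (hs : σ label N.s < D) (hc : σ cur (σ node 0) = 2 * N.E) :
    Runs relabel σ fun σ' t => Progress N x D k σ σ' ∧ t ≤ 20 := by
  have hpot := ArcNet.potential_relabel (d := σ label) hst.path.lt hc
  rw [relabel, Runs.block_cons_iff, Runs.set_iff, Runs.block_cons_iff, Runs.set_iff]
  simp only [Expr.eval, val, cell]
  obtain ⟨τ, hτ⟩ : ∃ τ, τ = ((σ.write label (σ node 0) (σ label (σ node 0) + 1)).write cur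
    ((σ.write label (σ node 0) (σ label (σ node 0) + 1)) node 0)
    ((σ.write label (σ node 0) (σ label (σ node 0) + 1)) first
    ((σ.write label (σ node 0) (σ label (σ node 0) + 1)) node 0))) := ⟨_, rfl⟩
  rw [← hτ]
  have h₁ : τ label = Function.update (σ label) (σ node 0) (σ label (σ node 0) + 1) := by
    simp [hτ, Memory.write_apply]
  have h₂ : τ cur = Function.update (σ cur) (σ node 0) (N.first (σ node 0)) := by
    simp [hτ, Memory.write_apply, h.first_eq]
  have h₃ : ∀ b, b ≠ label → b ≠ cur → τ b = σ b := by
    intro b hb hb'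
    simp [hτ, Memory.write_apply, hb, hb']
  have hτN : Holds N τ := h.congr fun b hb _ _ _ => h₃ b (by unfold label; omega) (by unfold cur; omega)
  clear hτ
  have hnode : τ node = σ node := h₃ _ (by decide) (by decide)
  have hres : τ res = σ res := h₃ _ (by decide) (by decide)
  have hpar : τ par = σ par := h₃ _ (by decide) (by decide)
  have hτb : τ bound 0 = D := by rw [h₃ _ (by decide) (by decide), hbound]
  generalize hu : σ node 0 = u at *
  rw [Runs.block_cons_iff, Runs.ite_iff]
  simp only [diff_eq_zero, Expr.eval, hτN.s_eq, hnode, hu]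
  split_ifs with hus
  · rw [Runs.skip_iff, Runs.block_nil_iff]
    subst hus
    refine ⟨⟨.inl ⟨hτb, [N.s], k, fun _ => rfl, ?_⟩, ?_⟩, by omega⟩
    · rw [hres, hpar, h₁, h₂, hnode, hu]
      exact hst.relabel_source hs hc
    · rw [h₁, h₂]; exact hpot
  · obtain ⟨hpu, l', hst'⟩ := hst.retreat hs hc hus
    rw [Runs.block_cons_iff, assign, Runs.set_iff, Runs.block_cons_iff]
    simp only [Expr.eval, hnode, hu, hpar]
    have hυ : ∀ b, b ≠ arc → (τ.write arc 0 (σ par u)) b = τ b := fun b hb => by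
      rw [Memory.write_apply, if_neg hb]
    have hυa : (τ.write arc 0 (σ par u)) arc 0 = σ par u := by simp [Memory.write_apply]
    generalize τ.write arc 0 (σ par u) = υ at *
    have hυN : Holds N υ := hτN.congr fun b hb _ _ _ => hυ b (by unfold arc; omega)
    refine runs_flipArc hυN (by rwa [hυa]) fun ω hωr hω => ?_
    have hωN : Holds N ω := hυN.congr fun b _ _ _ hb => hω b hb
    simp only [assign, Runs.block_cons_iff, Runs.block_nil_iff, Runs.set_iff, Expr.eval]
    have g₁ : ω arc 0 = σ par u := by rw [hω _ (by decide), hυa]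
    have g₂ : ω bound 0 = D := by rw [hω _ (by decide), hυ _ (by decide), hτb]
    have g₃ : ω label = Function.update (σ label) u (σ label u + 1) := by
      rw [hω _ (by decide), hυ _ (by decide), h₁]
    have g₄ : ω cur = Function.update (σ cur) u (N.first u) := by
      rw [hω _ (by decide), hυ _ (by decide), h₂]
    have g₅ : ω par = σ par := by rw [hω _ (by decide), hυ _ (by decide), hpar]
    have g₆ : ω res = N.flip (σ res) (σ par u) := by rw [hωr, hυ _ (by decide), hres, hυa]
    refine ⟨⟨.inl ?_, ?_⟩, by omega⟩
    · simp (disch := decide) only [Memory.write_same, Memory.write_of_ne, Function.update_self, g₁, g₂,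
        g₃, g₄, g₅, g₆, hωN.hd_eq]
      exact ⟨trivial, _, _, fun _ => rfl, hst'⟩
    · simp (disch := decide) only [Memory.write_of_ne, g₃, g₄]
      exact hpot

theorem of_mem_search_writes {a : ℕ} (h : a ∈ search.writes) :
    a = bound ∨ a = res ∨ a = cur ∨ a = label ∨ a = par ∨ a = node ∨ a = arc := by
  simp [search, scan, relabel, push, flipArc, assign, block, Program.writes] at h
  tauto

theorem of_mem_maxFlow_writes {a : ℕ} (h : a ∈ maxFlow.writes) : a = Mem.netFlow ∨ Mem.scratch ≤ a := by
  simp [maxFlow, buildArcs, buildLists, computeBound, startSearch, search, scan, relabel, push, flipArc,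
    assign, incr, decr, forRange, block, Program.writes, bound, boundSq, boundCube, nodesSq, numArcs, tl, hd, mate,
    res, next, first, cur, label, par, node, mode, arc, idx] at h
  change a = 26 ∨ 32 ≤ a
  unfold Mem.netFlow at h
  omega

theorem runs_search {N : ArcNet} {σ : Memory} (h : Holds N σ) {x D k : ℕ} {l : List ℕ}
    (hx : x ≤ 1) (hxD : x = 1 → D = 2) (hmode : σ mode 0 = x) (hbound : σ bound 0 = D)
    (hst : N.SearchState x D (σ res) (σ par) (σ label) (σ cur) (σ node 0) l k) :
    Runs search σ fun σ' t =>
      ((σ' bound 0 = D ∧ D ≤ σ' label N.s ∧ ∃ l k', (x = 1 → k' = k) ∧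
          N.SearchState x D (σ' res) (σ' par) (σ' label) (σ' cur) (σ' node 0) l k') ∨
        x = 1 ∧ σ' bound 0 = 0 ∧ N.IsPartialFlow (σ' res) N.s (k + 1)) ∧
      t ≤ 22 * (2 * N.E * (D + 1) + N.n * D + 1) + 1 := by
  set B := 2 * N.E * (D + 1) + N.n * D with hB
  refine (Runs.loop (Inv := fun τ => (τ bound 0 = D ∧ ∃ l k', (x = 1 → k' = k) ∧
      N.SearchState x D (τ res) (τ par) (τ label) (τ cur) (τ node 0) l k') ∨
      x = 1 ∧ τ bound 0 = 0 ∧ N.IsPartialFlow (τ res) N.s (k + 1))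
    -- A round takes at most 21 steps and one for the loop test. The extra 1 pays for a final round
    -- that reaches the sink, after which no bound on the labels is kept.
    (Φ := fun τ => 22 * (B + 1 - N.potential (τ label) (τ cur)))
    (.inl ⟨hbound, l, k, fun _ => rfl, hst⟩) ?_).frame.mono ?_
  · intro τ hτ hf hb
    have hfr : ∀ a, a ≠ bound → a ≠ res → a ≠ cur → a ≠ label → a ≠ par → a ≠ node → a ≠ arc →
        τ a = σ a := by
      intro a h₁ h₂ h₃ h₄ h₅ h₆ h₇
      refine hf a fun ha => ?_
      have := of_mem_search_writes (show a ∈ search.writes from ha)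
      tauto
    have hτN : Holds N τ := h.congr fun a ha _ h₁ h₂ =>
      hfr a h₁ h₂ (by unfold cur; omega) (by unfold label; omega) (by unfold par; omega)
        (by unfold node; omega) (by unfold arc; omega)
    have hτm : τ mode 0 = x := by
      rw [hfr _ (by decide) (by decide) (by decide) (by decide) (by decide) (by decide) (by decide),
        hmode]
    simp only [lt, val, Expr.eval, hτN.s_eq] at hb
    obtain ⟨hτb, l', k', hk', hτst⟩ | ⟨_, h0, _⟩ := hτ
    swap
    · omega
    have hs : τ label N.s < D := by omega
    have key : Runs (ite (lt (cell cur node) (val numArcs)) scan relabel) τ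
        fun τ' t => Progress N x D k' τ τ' ∧ t ≤ 21 := by
      rw [Runs.ite_iff]
      simp only [lt, cell, val, Expr.eval, hτN.numArcs_eq]
      have hle := hτst.labels.cur_le _ hτst.path.lt
      split_ifs with hc
      · exact (runs_relabel hτN hτb hτst hs (by omega)).mono fun τ' t ⟨h₁, h₂⟩ => ⟨h₁, by omega⟩
      · exact (runs_scan hτN hx hxD hτm hτb hτst hs (by omega)).mono
          fun τ' t ⟨h₁, h₂⟩ => ⟨h₁, by omega⟩
    refine key.mono fun τ' t ⟨⟨h₁, h₂⟩, h₃⟩ => ⟨?_, ?_⟩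
    · rcases h₁ with ⟨h₁, l'', k'', hk'', h₁'⟩ | ⟨h₁, h₁', h₁''⟩
      · exact .inl ⟨h₁, l'', k'', fun e => (hk'' e).trans (hk' e), h₁'⟩
      · exact .inr ⟨h₁, h₁', hk' h₁ ▸ h₁''⟩
    · have := ArcNet.potential_le (cur := τ cur) hτst.le_bound
      omega
  · rintro τ t ⟨⟨hτ, hb, ht⟩, hf⟩
    refine ⟨?_, by omega⟩
    rcases hτ with ⟨hτb, l', k', hk', hτst⟩ | hτ
    · refine .inl ⟨hτb, ?_, l', k', hk', hτst⟩
      have hτs : τ Mem.netS = σ Mem.netS := hf _ fun h' => by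
        have := of_mem_search_writes h'
        revert this
        decide
      simp only [lt, val, Expr.eval, hτb, hτs, h.s_eq] at hb
      omega
    · exact .inr hτ

theorem runs_startSearch {N : ArcNet} {σ : Memory} (h : Holds N σ) :
    Runs startSearch σ fun σ' t =>
      (σ' label N.s = σ mode 0 ∧ (∀ v < N.n, v ≠ N.s → σ' label v = 0) ∧
        (∀ v < N.n, σ' cur v = N.first v) ∧ σ' node 0 = N.s) ∧ t ≤ 6 * N.n + 5 := by
  rw [startSearch, Runs.block_cons_iff]
  refine (Runs.forRange (Inv := fun j τ => (∀ v < j, τ label v = 0) ∧ ∀ v < j, τ cur v = N.first v)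
    (c := 3) (hi := N.n) (lo := 0) rfl (Nat.zero_le _) (by simp) ?_ ?_).frame.mono ?_
  · intro τ j _ _ hf
    simp only [val, Expr.eval]
    rw [hf _ (by simp [Program.writes, block]) (by decide), h.n_eq]
  · intro τ j _ hj hI hidx hf
    have hfirst : τ first = N.first := by
      rw [hf _ (by simp [Program.writes, block]) (by decide), h.first_eq]
    simp (disch := decide) only [Runs.block_cons_iff, Runs.block_nil_iff, Runs.set_iff, val, cell,
      Expr.eval, Memory.write_same, Memory.write_of_ne, hidx, hfirst]
    refine ⟨⟨trivial, fun v hv => ?_, fun v hv => ?_⟩, le_rfl⟩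
    · rcases Nat.lt_succ_iff_lt_or_eq.mp hv with hv | rfl
      · rw [Function.update_of_ne (by omega)]; exact hI.1 v hv
      · rw [Function.update_self]
    · rcases Nat.lt_succ_iff_lt_or_eq.mp hv with hv | rfl
      · rw [Function.update_of_ne (by omega)]; exact hI.2 v hv
      · rw [Function.update_self]
  · rintro τ t ⟨⟨hI, -, ht⟩, hf⟩
    have hs : τ Mem.netS 0 = N.s := by
      rw [hf _ (by simp [Program.writes, block, forRange, incr, assign]), h.s_eq]
    have hm : τ mode 0 = σ mode 0 := by
      rw [hf _ (by simp [Program.writes, block, forRange, incr, assign])]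
    simp (disch := decide) only [assign, Runs.block_cons_iff, Runs.block_nil_iff, Runs.set_iff, val,
      Expr.eval, Memory.write_same, Memory.write_of_ne, hs, hm, Function.update_self]
    refine ⟨⟨trivial, fun v hv hvs => ?_, hI.2, trivial⟩, by omega⟩
    rw [Function.update_of_ne hvs]; exact hI.1 v hv

/-! ### Construction of the arc lists and of the stopping bound. -/

theorem runs_buildArcs {σ : Memory} {E : ℕ} (hE : σ Mem.netE 0 = E) :
    Runs buildArcs σ fun σ' t =>
      (σ' numArcs 0 = 2 * E ∧
        (∀ e < E, σ' tl e = σ Mem.netTail e ∧ σ' hd e = σ Mem.netHead e ∧ σ' mate e = E + e ∧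
          σ' res e = 1) ∧
        ∀ e < E, σ' tl (E + e) = σ Mem.netHead e ∧ σ' hd (E + e) = σ Mem.netTail e ∧
          σ' mate (E + e) = e ∧ σ' res (E + e) = 0) ∧ t ≤ 12 * E + 4 := by
  rw [buildArcs, Runs.block_cons_iff, assign, Runs.set_iff, Runs.block_cons_iff]
  refine (Runs.forRange (Inv := fun j τ =>
      (∀ e < j, τ tl e = σ Mem.netTail e ∧ τ hd e = σ Mem.netHead e ∧ τ mate e = E + e ∧
        τ res e = 1) ∧
      ∀ e < j, τ tl (E + e) = σ Mem.netHead e ∧ τ hd (E + e) = σ Mem.netTail e ∧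
        τ mate (E + e) = e ∧ τ res (E + e) = 0)
    (c := 9) (hi := E) (lo := 0) rfl (Nat.zero_le _) (by simp) ?_ ?_).frame.mono ?_
  · intro τ j _ _ hf
    simp only [val, Expr.eval]
    rw [hf _ (by simp [Program.writes, block]) (by decide), Memory.write_of_ne _ (by decide), hE]
  · intro τ j _ hj hI hidx hf
    have h₁ : τ Mem.netE 0 = E := by
      rw [hf _ (by simp [Program.writes, block]) (by decide), Memory.write_of_ne _ (by decide), hE]
    have h₂ : τ Mem.netTail = σ Mem.netTail := by
      rw [hf _ (by simp [Program.writes, block]) (by decide), Memory.write_of_ne _ (by decide)]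
    have h₃ : τ Mem.netHead = σ Mem.netHead := by
      rw [hf _ (by simp [Program.writes, block]) (by decide), Memory.write_of_ne _ (by decide)]
    simp (disch := decide) only [Runs.block_cons_iff, Runs.block_nil_iff, Runs.set_iff, val, cell,
      Expr.eval, Memory.write_same, Memory.write_of_ne, hidx, h₁, h₂, h₃]
    refine ⟨⟨trivial, fun e he => ?_, fun e he => ?_⟩, le_rfl⟩
    · have hne : e ≠ E + j := by omega
      simp only [Function.update_of_ne hne]
      rcases Nat.lt_succ_iff_lt_or_eq.mp he with he | rfl
      · have hne' : e ≠ j := by omega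
        simp only [Function.update_of_ne hne']
        exact hI.1 e he
      · simp
    · rcases Nat.lt_succ_iff_lt_or_eq.mp he with he | rfl
      · have hne : E + e ≠ E + j := by omega
        have hne' : E + e ≠ j := by omega
        simp only [Function.update_of_ne hne, Function.update_of_ne hne']
        exact hI.2 e he
      · simp
  · rintro τ t ⟨⟨hI, -, ht⟩, hf⟩
    rw [Runs.block_nil_iff]
    refine ⟨⟨?_, hI⟩, by omega⟩
    rw [hf _ (by simp [Program.writes, block, forRange, incr, assign])]
    simp [Memory.write_apply, val, Expr.eval, hE, two_mul]

/-- Arcs are put at the front of the lists in decreasing order, so each list ends up increasing. The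
invariant is the final specification restricted to arcs from `idx` on. -/
theorem runs_buildLists {σ : Memory} {n M : ℕ} (hn : σ Mem.netV 0 = n) (hM : σ numArcs 0 = M)
    (htl : ∀ a < M, σ tl a < n) :
    Runs buildLists σ fun σ' t =>
      ((∀ v < n, σ' first v ≤ M ∧ (σ' first v < M → σ tl (σ' first v) = v) ∧
          ∀ b < σ' first v, σ tl b ≠ v) ∧
        ∀ a < M, a < σ' next a ∧ σ' next a ≤ M ∧
          (σ' next a < M → σ tl (σ' next a) = σ tl a) ∧
          ∀ b, a < b → b < σ' next a → σ tl b ≠ σ tl a) ∧ t ≤ 4 * n + 5 * M + 5 := by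
  rw [buildLists, Runs.block_cons_iff]
  refine (Runs.forRange (Inv := fun j τ => ∀ v < j, τ first v = M)
    (c := 1) (hi := n) (lo := 0) rfl (Nat.zero_le _) (by simp) ?_ ?_).frame.mono ?_
  · intro τ j _ _ hf
    simp only [val, Expr.eval]
    rw [hf _ (by simp [Program.writes]) (by decide), hn]
  · intro τ j _ hj hI hidx hf
    have h₁ : τ numArcs 0 = M := by rw [hf _ (by simp [Program.writes]) (by decide), hM]
    simp (disch := decide) only [Runs.set_iff, val, Expr.eval, Memory.write_same, Memory.write_of_ne,
      hidx, h₁]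
    refine ⟨⟨trivial, fun v hv => ?_⟩, le_rfl⟩
    rcases Nat.lt_succ_iff_lt_or_eq.mp hv with hv | rfl
    · rw [Function.update_of_ne (by omega)]; exact hI v hv
    · rw [Function.update_self]
  · rintro τ t ⟨⟨hI, -, ht⟩, hf⟩
    have hτM : τ numArcs 0 = M := by
      rw [hf _ (by simp [Program.writes, forRange, incr, assign]), hM]
    have hτtl : τ tl = σ tl := hf _ (by simp [Program.writes, forRange, incr, assign])
    rw [Runs.block_cons_iff, assign, Runs.set_iff, Runs.block_cons_iff]
    simp only [val, Expr.eval, hτM]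
    refine (Runs.loop (Inv := fun υ => υ idx 0 ≤ M ∧
      (∀ v < n, υ first v ≤ M ∧ (υ first v < M → σ tl (υ first v) = v) ∧ υ idx 0 ≤ υ first v ∧
          ∀ b < υ first v, υ idx 0 ≤ b → σ tl b ≠ v) ∧
        ∀ a < M, υ idx 0 ≤ a → a < υ next a ∧ υ next a ≤ M ∧
          (υ next a < M → σ tl (υ next a) = σ tl a) ∧
          ∀ b, a < b → b < υ next a → σ tl b ≠ σ tl a) (Φ := fun υ => 5 * υ idx 0) ?_ ?_).mono ?_
    · simp (disch := decide) only [Memory.write_same, Memory.write_of_ne, Function.update_self]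
      refine ⟨le_rfl, fun v hv => ?_, fun a ha ha' => by omega⟩
      rw [hI v hv]
      exact ⟨le_rfl, by omega, le_rfl, fun b hb hb' => by omega⟩
    · rintro υ ⟨h₁, h₂, h₃⟩ hf' hb
      have hυtl : υ tl = σ tl := by
        rw [hf' _ (by simp [Program.writes, block, decr, assign]), Memory.write_of_ne _ (by decide), hτtl]
      simp only [Expr.eval] at hb
      obtain ⟨i, hi⟩ : ∃ i, υ idx 0 = i + 1 := ⟨υ idx 0 - 1, by omega⟩
      simp (disch := decide) only [decr, assign, Runs.block_cons_iff, Runs.block_nil_iff, Runs.set_iff,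
        val, cell, Expr.eval, Memory.write_same, Memory.write_of_ne, Function.update_self, hi, hυtl,
        Nat.add_sub_cancel]
      simp only [hi] at h₁ h₂ h₃
      have hw := htl i (by omega)
      obtain ⟨g₁, g₂, g₃, g₄⟩ := h₂ _ hw
      refine ⟨⟨by omega, fun v hv => ?_, fun a ha ha' => ?_⟩, by omega⟩
      · by_cases e : v = σ tl i
        · subst e
          rw [Function.update_self]
          exact ⟨by omega, fun _ => rfl, le_rfl, fun b hb hb' => by omega⟩
        · rw [Function.update_of_ne e]
          obtain ⟨k₁, k₂, k₃, k₄⟩ := h₂ v hv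
          refine ⟨k₁, k₂, by omega, fun b hb hb' => ?_⟩
          rcases hb'.eq_or_lt with rfl | hb'
          · exact fun e' => e e'.symm
          · exact k₄ b hb hb'
      · by_cases e : a = i
        · subst e
          rw [Function.update_self]
          exact ⟨by omega, g₁, g₂, fun b hb hb' => g₄ b hb' hb⟩
        · rw [Function.update_of_ne e]
          exact h₃ a ha (by omega)
    · rintro υ t' ⟨⟨-, h₂, h₃⟩, hb, ht'⟩
      simp only [Expr.eval] at hb
      simp (disch := decide) only [Memory.write_same, Function.update_self, hb] at h₂ h₃ ht'
      rw [Runs.block_nil_iff]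
      exact ⟨⟨fun v hv => ⟨(h₂ v hv).1, (h₂ v hv).2.1, fun b hb => (h₂ v hv).2.2.2 b hb (Nat.zero_le _)⟩,
        fun a ha => h₃ a ha (Nat.zero_le _)⟩, by omega⟩

theorem both_ne_zero {σ : Memory} {e₁ e₂ : Expr} :
    (both e₁ e₂).eval σ ≠ 0 ↔ e₁.eval σ ≠ 0 ∧ e₂.eval σ ≠ 0 := by
  simp only [both, Expr.eval]
  omega

/-- The least `D ≥ 1` with `D ^ 2 ≥ E` or `D ^ 3 ≥ n ^ 2`. -/
structure IsBound (n E D : ℕ) : Prop where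
  pos : 1 ≤ D
  le : E ≤ D * D ∨ n * n ≤ D * D * D
  lt : D = 1 ∨ ((D - 1) * (D - 1) < E ∧ (D - 1) * (D - 1) * (D - 1) < n * n)

/-- In the absence of multiplication, `D ^ 2` and `D ^ 3` are updated by the binomial formulas.
While the loop runs, `D ≤ D * D < E`, so `E - D` pays for the rounds. -/
theorem runs_computeBound {σ : Memory} {n E : ℕ} (hn : σ Mem.netV 0 = n) (hE : σ Mem.netE 0 = E) :
    Runs computeBound σ fun σ' t =>
      (∃ D, σ' bound 0 = D + 2 ∧ IsBound n E D) ∧ t ≤ 4 * n + 5 * E + 9 := by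
  rw [computeBound, Runs.block_cons_iff, assign, Runs.set_iff, Runs.block_cons_iff]
  refine (Runs.forRange (Inv := fun j τ => τ nodesSq 0 = j * n)
    (c := 1) (hi := n) (lo := 0) rfl (Nat.zero_le _) ?_ ?_ ?_).frame.mono ?_
  · simp [Memory.write_apply, Expr.eval]
  · intro τ j _ _ hf
    simp only [val, Expr.eval]
    rw [hf _ (by simp [Program.writes, assign]) (by decide), Memory.write_of_ne _ (by decide), hn]
  · intro τ j _ hj hI hidx hf
    have h₁ : τ Mem.netV 0 = n := by
      rw [hf _ (by simp [Program.writes, assign]) (by decide), Memory.write_of_ne _ (by decide), hn]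
    simp (disch := decide) only [assign, Runs.set_iff, val, Expr.eval, Memory.write_same,
      Memory.write_of_ne, hidx, h₁, hI, Function.update_self]
    exact ⟨⟨trivial, by ring⟩, le_rfl⟩
  · rintro τ t ⟨⟨hI, -, ht⟩, hf⟩
    have hτE : τ Mem.netE 0 = E := by
      rw [hf _ (by simp [Program.writes, forRange, incr, assign]), Memory.write_of_ne _ (by decide), hE]
    simp only [assign, Runs.block_cons_iff, Runs.set_iff]
    have h₁ : ∀ b, b ≠ bound → b ≠ boundSq → b ≠ boundCube →
        (((τ.write bound (Expr.eval τ (.lit 0)) (Expr.eval τ (.lit 1))).write boundSq 0 1).write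
          boundCube 0 1) b = τ b := by
      intro b hb₁ hb₂ hb₃
      rw [Memory.write_of_ne _ hb₃, Memory.write_of_ne _ hb₂, Memory.write_of_ne _ hb₁]
    simp only [Expr.eval] at h₁ ⊢
    refine (Runs.loop (Inv := fun υ => 1 ≤ υ bound 0 ∧ υ boundSq 0 = υ bound 0 * υ bound 0 ∧
      υ boundCube 0 = υ bound 0 * υ bound 0 * υ bound 0 ∧
      (υ bound 0 = 1 ∨ ((υ bound 0 - 1) * (υ bound 0 - 1) < E ∧
        (υ bound 0 - 1) * (υ bound 0 - 1) * (υ bound 0 - 1) < n * n)))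
      (Φ := fun υ => 5 * (E - υ bound 0)) ?_ ?_).frame.mono ?_
    · simp (disch := decide) only [Memory.write_same, Memory.write_of_ne, Function.update_self]
      simp
    · rintro υ ⟨h₂, h₃, h₄, -⟩ hf' hb
      have hυE : υ Mem.netE 0 = E := by
        rw [hf' _ (by simp [Program.writes, block, incr, assign]),
          h₁ _ (by decide) (by decide) (by decide), hτE]
      have hυn : υ nodesSq 0 = n * n := by
        rw [hf' _ (by simp [Program.writes, block, incr, assign]),
          h₁ _ (by decide) (by decide) (by decide), hI]
      rw [both_ne_zero] at hb
      simp only [lt, val, Expr.eval, hυE, hυn, h₃, h₄] at hb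
      simp (disch := decide) only [incr, Program.assign, Runs.block_cons_iff, Runs.block_nil_iff, Runs.set_iff,
        val, Expr.eval, Memory.write_same, Memory.write_of_ne, Function.update_self, h₃, h₄]
      generalize υ bound 0 = D at *
      have : D ≤ D * D := Nat.le_mul_self D
      refine ⟨⟨by omega, by ring, by ring, .inr ?_⟩, by omega⟩
      rw [Nat.add_sub_cancel]
      omega
    · rintro υ t' ⟨⟨⟨h₂, h₃, h₄, h₅⟩, hb, ht'⟩, hf'⟩
      have hυE : υ Mem.netE 0 = E := by
        rw [hf' _ (by simp [Program.writes, block, incr, Program.assign]),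
          h₁ _ (by decide) (by decide) (by decide), hτE]
      have hυn : υ nodesSq 0 = n * n := by
        rw [hf' _ (by simp [Program.writes, block, incr, Program.assign]),
          h₁ _ (by decide) (by decide) (by decide), hI]
      have hb' := (both_ne_zero (e₁ := lt (val boundSq) (val Mem.netE))
        (e₂ := lt (val boundCube) (val nodesSq)) (σ := υ)).not.mp (not_not.mpr hb)
      simp only [lt, val, Expr.eval, hυE, hυn, h₃, h₄] at hb'
      simp (disch := decide) only [Runs.block_nil_iff,
        val, Expr.eval, Memory.write_same, Memory.write_of_ne, Function.update_self] at ht' ⊢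
      exact ⟨⟨υ bound 0, rfl, h₂, by omega, h₅⟩, by omega⟩

theorem of_mem_startSearch_writes {a : ℕ} (h : a ∈ startSearch.writes) :
    a = label ∨ a = cur ∨ a = node ∨ a = idx := by
  simp [startSearch, forRange, incr, assign, block, Program.writes] at h
  tauto

/-- The second phase finds the missing augmenting paths one by one. -/
theorem runs_augment {N : ArcNet} {σ : Memory} (h : Holds N σ) {k R : ℕ} (hmode : σ mode 0 = 1)
    (hbound : σ bound 0 = 0) (hf : N.IsPartialFlow (σ res) N.s k)
    (hR : ∀ r k', N.IsPartialFlow r N.s k' → k' ≤ k + R) :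
    Runs (loop (.sub (.lit 1) (val bound)) (block [startSearch, assign bound (.lit 2), search])) σ
      fun σ' t => (∃ u l k', N.SearchState 1 2 (σ' res) (σ' par) (σ' label) (σ' cur) u l k' ∧
        2 ≤ σ' label N.s) ∧ t ≤ (22 * (6 * N.E + 2 * N.n + 1) + 6 * N.n + 9) * (R + 1) + 1 := by
  -- One round: `runs_startSearch`, `runs_search` with bound 2, and three steps for the assignment,
  -- the end of the block and the loop test.
  set C := 22 * (6 * N.E + 2 * N.n + 1) + 6 * N.n + 9 with hC
  -- The value of a flow is recovered from the memory as the excess of the sink, which lets the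
  -- potential refer to it.
  have hex : ∀ {r : ℕ → ℕ} {k' : ℕ}, N.IsPartialFlow r N.s k' → (N.excess r N.t).toNat = k' := by
    intro r k' hr
    rw [hr.excess_eq, if_neg N.s_ne_t]
    simp
  -- `bound` acts as a flag: 0 as long as another search is due, 2 after a search that found no
  -- path. At most `R` searches succeed and one fails, so the potential starts at `C * (R + 1)`.
  refine (Runs.loop (Inv := fun τ => (τ bound 0 = 0 ∧ ∃ k', N.IsPartialFlow (τ res) N.s k') ∨
      (τ bound 0 = 2 ∧ ∃ u l k', N.SearchState 1 2 (τ res) (τ par) (τ label) (τ cur) u l k' ∧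
        2 ≤ τ label N.s))
    (Φ := fun τ => if τ bound 0 = 0 then C * (k + R + 1 - (N.excess (τ res) N.t).toNat) else 0)
    (.inl ⟨hbound, k, hf⟩) ?_).mono ?_
  · intro τ hτ hfr hb
    have hfr' : ∀ a, a ≠ bound → a ≠ res → a ≠ cur → a ≠ label → a ≠ par → a ≠ node → a ≠ arc →
        a ≠ idx → τ a = σ a := by
      intro a h₁ h₂ h₃ h₄ h₅ h₆ h₇ h₈
      refine hfr a fun ha => ?_
      simp only [block, Program.writes, assign, Set.mem_union, Set.mem_singleton_iff,
        Set.mem_empty_iff_false, or_false] at ha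
      rcases ha with ha | ha | ha
      · have := of_mem_startSearch_writes ha
        tauto
      · exact h₁ ha
      · have := of_mem_search_writes ha
        tauto
    have hτN : Holds N τ := h.congr fun a ha _ h₁ h₂ =>
      hfr' a h₁ h₂ (by unfold cur; omega) (by unfold label; omega) (by unfold par; omega)
        (by unfold node; omega) (by unfold arc; omega) (by unfold idx; omega)
    have hτm : τ mode 0 = 1 := by
      rw [hfr' _ (by decide) (by decide) (by decide) (by decide) (by decide) (by decide) (by decide)
        (by decide), hmode]
    simp only [val, Expr.eval] at hb
    obtain ⟨hτb, k', hτf⟩ | ⟨h2, _⟩ := hτ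
    swap
    · omega
    have hk' := hR _ _ hτf
    rw [Runs.block_cons_iff]
    refine (runs_startSearch hτN).frame.mono ?_
    rintro υ t ⟨⟨⟨h₁, h₂, h₃, h₄⟩, ht⟩, hυ⟩
    rw [hτm] at h₁
    have hυ' : ∀ a, a ≠ label → a ≠ cur → a ≠ node → a ≠ idx → υ a = τ a := by
      intro a g₁ g₂ g₃ g₄
      refine hυ a fun ha => ?_
      have := of_mem_startSearch_writes ha
      tauto
    rw [Runs.block_cons_iff, assign, Runs.set_iff, Runs.block_cons_iff]
    simp only [Expr.eval]
    have g : ∀ a, a ≠ bound → (υ.write bound 0 2) a = υ a := fun a ha => Memory.write_of_ne _ ha _ _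
    have g' : (υ.write bound 0 2) bound 0 = 2 := by rw [Memory.write_same, Function.update_self]
    generalize υ.write bound 0 2 = ω at *
    have hωN : Holds N ω := hτN.congr fun a ha _ h₁ h₂ => by
      rw [g a h₁, hυ' a (by unfold label; omega) (by unfold cur; omega) (by unfold node; omega)
        (by unfold idx; omega)]
    have hωres : ω res = τ res := by
      rw [g _ (by decide), hυ' _ (by decide) (by decide) (by decide) (by decide)]
    have hωm : ω mode 0 = 1 := by
      rw [g _ (by decide), hυ' _ (by decide) (by decide) (by decide) (by decide), hτm]
    have hωl : ω label = υ label := g _ (by decide)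
    have hωc : ω cur = υ cur := g _ (by decide)
    have hωn : ω node 0 = N.s := by rw [g _ (by decide), h₄]
    have hst : N.SearchState 1 2 (ω res) (ω par) (ω label) (ω cur) (ω node 0) [N.s] k' := by
      rw [hωn]
      exact .initial (by rwa [hωres]) le_rfl (by omega) (by rw [hωl, h₁]) (by rwa [hωl])
        (by rwa [hωc])
    refine (runs_search hωN le_rfl (fun _ => rfl) hωm g' hst).mono ?_
    rintro ζ t' ⟨hζ, ht'⟩
    rw [Runs.block_nil_iff]
    rw [if_pos hτb, hex hτf]
    obtain ⟨d, hd⟩ : ∃ d, k + R + 1 - k' = d + 1 := ⟨k + R - k', by omega⟩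
    have hCd : C * (d + 1) = C * d + C := by ring
    rw [hd, hCd]
    rcases hζ with ⟨h₅, h₆, l, k'', -, h₇⟩ | ⟨-, h₅, h₆⟩
    · refine ⟨.inr ⟨h₅, _, l, k'', h₇, h₆⟩, ?_⟩
      rw [if_neg (by omega)]
      omega
    · refine ⟨.inl ⟨h₅, _, h₆⟩, ?_⟩
      rw [if_pos h₅, hex h₆, show k + R + 1 - (k' + 1) = d by omega]
      omega
  · rintro τ t ⟨hτ, hb, ht⟩
    simp only [val, Expr.eval] at hb
    obtain ⟨hτb, _⟩ | ⟨h2, h3⟩ := hτ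
    · omega
    refine ⟨h3, ?_⟩
    rw [if_pos hbound, hex hf, show k + R + 1 - k = R + 1 by omega] at ht
    omega

theorem runs_buildArcs_buildLists {U : UnitNetwork} {σ : Memory} (hU : U.StoredIn σ) :
    Runs (block [buildArcs, buildLists]) σ fun σ' t =>
      (∃ N : ArcNet, N.Represents U ∧ Holds N σ' ∧ N.IsPartialFlow (σ' res) N.s 0) ∧
        t ≤ 4 * U.numNodes + 22 * U.numEdges + 10 := by
  obtain ⟨hV, hE, hs, ht, htail, hhead⟩ := hU
  rw [Runs.block_cons_iff]
  refine (runs_buildArcs hE).frame.mono ?_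
  rintro τ t₁ ⟨⟨⟨h₁, h₂, h₃⟩, ht₁⟩, hτ⟩
  have hτ' : ∀ a < 32, τ a = σ a := by
    intro a ha
    refine hτ a fun h => ?_
    simp [buildArcs, forRange, incr, assign, block, Program.writes, numArcs, tl, hd, mate, res,
      idx] at h
    omega
  have hlt : ∀ a < 2 * U.numEdges, τ tl a < U.numNodes := by
    intro a ha
    by_cases h : a < U.numEdges
    · rw [(h₂ a h).1, htail ⟨a, h⟩]; exact (U.tail _).2
    · obtain ⟨e, rfl⟩ : ∃ e, a = U.numEdges + e := ⟨a - U.numEdges, by omega⟩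
      have he : e < U.numEdges := by omega
      rw [(h₃ e he).1, hhead ⟨e, he⟩]; exact (U.head _).2
  rw [Runs.block_cons_iff]
  refine (runs_buildLists (by rw [hτ' _ (by decide), hV]) h₁ hlt).frame.mono ?_
  rintro υ t₂ ⟨⟨⟨h₄, h₅⟩, ht₂⟩, hυ⟩
  have hυ' : ∀ a, a ≠ idx → a ≠ next → a ≠ first → υ a = τ a := by
    intro a g₁ g₂ g₃
    refine hυ a fun h => ?_
    simp [buildLists, forRange, incr, decr, assign, block, Program.writes] at h
    tauto
  have e₁ : υ tl = τ tl := hυ' _ (by decide) (by decide) (by decide)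
  have e₂ : υ hd = τ hd := hυ' _ (by decide) (by decide) (by decide)
  have e₃ : υ mate = τ mate := hυ' _ (by decide) (by decide) (by decide)
  have e₄ : υ res = τ res := hυ' _ (by decide) (by decide) (by decide)
  have e₅ : υ numArcs = τ numArcs := hυ' _ (by decide) (by decide) (by decide)
  have e₆ : ∀ a < 32, υ a = σ a := fun a ha => by
    rw [hυ' a (by unfold idx; omega) (by unfold next; omega) (by unfold first; omega), hτ' a ha]
  rw [← e₁] at h₂ h₃ h₄ h₅ hlt
  rw [← e₂, ← e₃, ← e₄] at h₂ h₃
  rw [Runs.block_nil_iff]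
  let N : ArcNet :=
    { n := U.numNodes
      E := U.numEdges
      s := U.source
      t := U.sink
      tl := υ tl
      hd := υ hd
      first := υ first
      next := υ next
      s_lt := U.source.2
      t_lt := U.sink.2
      s_ne_t := fun e => U.source_ne_sink (Fin.ext e)
      tl_lt := hlt
      tl_add := fun e he => by rw [(h₃ e he).1, (h₂ e he).2.1]
      hd_add := fun e he => by rw [(h₃ e he).2.1, (h₂ e he).1]
      first_le := fun v hv => (h₄ v hv).1
      tl_first := fun v hv => (h₄ v hv).2.1
      first_min := fun v hv => (h₄ v hv).2.2
      next_le := fun a ha => (h₅ a ha).2.1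
      tl_next := fun a ha => (h₅ a ha).2.2.1
      lt_next := fun a ha => (h₅ a ha).1
      next_min := fun a ha => (h₅ a ha).2.2.2 }
  have hmate : ∀ a < 2 * U.numEdges, υ mate a = N.mate a := by
    intro a ha
    rw [ArcNet.mate]
    change υ mate a = if a < U.numEdges then U.numEdges + a else a - U.numEdges
    split_ifs with h
    · exact (h₂ a h).2.2.1
    · obtain ⟨e, rfl⟩ : ∃ e, a = U.numEdges + e := ⟨a - U.numEdges, by omega⟩
      rw [(h₃ e (by omega)).2.2.1]; omega
  refine ⟨⟨N, ⟨rfl, rfl, rfl, rfl, fun e => ?_, fun e => ?_⟩, ⟨?_, ?_, ?_, ?_, ?_, rfl, rfl, hmate, rfl,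
    rfl⟩, ?_, ?_⟩, by omega⟩
  · exact ((h₂ e e.2).1).trans (htail e)
  · exact ((h₂ e e.2).2.1).trans (hhead e)
  · rw [e₆ _ (by decide), hV]
  · rw [e₆ _ (by decide), hE]
  · rw [e₆ _ (by decide), hs]
  · rw [e₆ _ (by decide), ht]
  · rw [e₅, h₁]
  · intro a ha
    change a < 2 * U.numEdges at ha
    change υ res a + υ res (if a < U.numEdges then U.numEdges + a else a - U.numEdges) = 1
    split_ifs with h
    · rw [(h₂ a h).2.2.2, (h₃ a h).2.2.2]
    · obtain ⟨e, rfl⟩ : ∃ e, a = U.numEdges + e := ⟨a - U.numEdges, by omega⟩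
      rw [Nat.add_sub_cancel_left, (h₂ e (by omega)).2.2.2, (h₃ e (by omega)).2.2.2]
  · intro v
    rw [ArcNet.excess, Finset.sum_eq_zero]
    · simp
    · intro e he
      rw [(h₂ e (Finset.mem_range.mp he)).2.2.2]
      simp

/-- The first phase ends with source label at least `D + 2` and costs O((|V| + |E|) D) by the
potential. At most `2 * D` units are then missing, so the second phase consists of at most `2 * D +
1` searches of linear cost. -/
theorem runs_maxFlow {U : UnitNetwork} (hP : U.ParallelOnlyAtTerminals) {σ : Memory}
    (hU : U.StoredIn σ) :
    Runs maxFlow σ fun σ' t => U.IsMaxFlow (fun e => (σ' Mem.netFlow e : ℝ)) ∧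
      ∃ D, IsBound U.numNodes U.numEdges D ∧ t ≤ 400 * ((U.numNodes + U.numEdges) * (D + 1)) := by
  -- Splitting off a prefix as a block of its own adds one closing `skip`, which `t₁ - 1` takes off
  -- again.
  have hsplit : ∀ ps : List Program, ∀ Q : Memory → ℕ → Prop,
      Runs (block (buildArcs :: buildLists :: ps)) σ Q ↔
      Runs (block [buildArcs, buildLists]) σ fun σ₁ t₁ => Runs (block ps) σ₁ fun σ₂ t₂ =>
        Q σ₂ (t₁ - 1 + t₂) := by
    intro ps Q
    simp only [Runs.block_cons_iff, Runs.block_nil_iff, ← add_assoc, Nat.add_sub_cancel]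
  rw [maxFlow, hsplit]
  refine (runs_buildArcs_buildLists hU).mono ?_
  rintro σ₁ t₁ ⟨⟨N, hN, h₁, hf₁⟩, ht₁⟩
  rw [Runs.block_cons_iff]
  refine (runs_computeBound h₁.n_eq h₁.E_eq).frame.mono ?_
  rintro σ₂ t₂ ⟨⟨⟨D, hb₂, hD⟩, ht₂⟩, hfr₂⟩
  have hfr₂' : ∀ a, a ≠ bound → a ≠ boundSq → a ≠ boundCube → a ≠ nodesSq → a ≠ idx →
      σ₂ a = σ₁ a := by
    intro a g₁ g₂ g₃ g₄ g₅
    refine hfr₂ a fun h => ?_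
    simp [computeBound, forRange, incr, assign, block, Program.writes] at h
    tauto
  have h₂ : Holds N σ₂ := by
    obtain ⟨g₁, g₂, g₃, g₄, g₅, g₆, g₇, g₈, g₉, g₁₀⟩ := h₁
    refine ⟨?_, ?_, ?_, ?_, ?_, ?_, ?_, ?_, ?_, ?_⟩ <;>
      rw [hfr₂' _ (by decide) (by decide) (by decide) (by decide) (by decide)] <;> assumption
  have hf₂ : N.IsPartialFlow (σ₂ res) N.s 0 := by
    rwa [hfr₂' _ (by decide) (by decide) (by decide) (by decide) (by decide)]
  rw [Runs.block_cons_iff, assign, Runs.set_iff, Runs.block_cons_iff]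
  simp only [Expr.eval]
  have e₃ : ∀ a, a ≠ mode → (σ₂.write mode 0 0) a = σ₂ a := fun a ha => Memory.write_of_ne _ ha _ _
  have m₃ : (σ₂.write mode 0 0) mode 0 = 0 := by rw [Memory.write_same, Function.update_self]
  generalize σ₂.write mode 0 0 = σ₃ at *
  have h₃ : Holds N σ₃ := h₂.congr fun a ha _ _ _ => e₃ a (by unfold mode; omega)
  refine (runs_startSearch h₃).frame.mono ?_
  rintro σ₄ t₄ ⟨⟨⟨l₄, l₄', c₄, n₄⟩, ht₄⟩, hfr₄⟩
  have hfr₄' : ∀ a, a ≠ label → a ≠ cur → a ≠ node → a ≠ idx → σ₄ a = σ₃ a := by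
    intro a g₁ g₂ g₃ g₄
    refine hfr₄ a fun ha => ?_
    have := of_mem_startSearch_writes ha
    tauto
  have h₄ : Holds N σ₄ := h₃.congr fun a ha _ _ _ => hfr₄' a (by unfold label; omega)
    (by unfold cur; omega) (by unfold node; omega) (by unfold idx; omega)
  have m₄ : σ₄ mode 0 = 0 := by rw [hfr₄' _ (by decide) (by decide) (by decide) (by decide), m₃]
  have b₄ : σ₄ bound 0 = D + 2 := by
    rw [hfr₄' _ (by decide) (by decide) (by decide) (by decide), e₃ _ (by decide), hb₂]
  have hst₄ : N.SearchState 0 (D + 2) (σ₄ res) (σ₄ par) (σ₄ label) (σ₄ cur) (σ₄ node 0) [N.s] 0 := by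
    rw [n₄]
    refine .initial ?_ (Nat.zero_le 1) (by omega) (by rw [l₄, m₃]) l₄' c₄
    rwa [hfr₄' _ (by decide) (by decide) (by decide) (by decide), e₃ _ (by decide)]
  rw [Runs.block_cons_iff]
  refine (runs_search h₄ (Nat.zero_le 1) (by omega) m₄ b₄ hst₄).frame.mono ?_
  rintro σ₅ t₅ ⟨⟨hσ₅, ht₅⟩, hfr₅⟩
  obtain ⟨-, hs₅, l, k, -, hst₅⟩ | ⟨h, -⟩ := hσ₅
  swap
  · omega
  have hu₅ : σ₅ node 0 = N.s := hst₅.source_lt.resolve_left (by omega)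
  have hf₅ : N.IsPartialFlow (σ₅ res) N.s k := hu₅ ▸ hst₅.flow
  rw [← hN.n_eq, ← hN.E_eq] at ht₁
  have hR : ∀ r k', N.IsPartialFlow r N.s k' → k' ≤ k + 2 * D := fun r k' hr =>
    hf₅.le_add_of_label (hN.parallelOnlyAtTerminals hP) hst₅.labels hD.le hD.pos hs₅
      hst₅.label_sink hr
  have h₅ : Holds N σ₅ := h₄.congr fun a ha _ g₁ g₂ => hfr₅ a fun ha' => by
    have := of_mem_search_writes ha'
    simp only [bound, res, cur, label, par, node, arc] at this g₁ g₂
    omega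
  simp only [Runs.block_cons_iff, assign, Runs.set_iff, Expr.eval]
  have e₆ : ∀ a, a ≠ mode → a ≠ bound → ((σ₅.write mode 0 1).write bound 0 0) a = σ₅ a :=
    fun a ha hb => by rw [Memory.write_of_ne _ hb, Memory.write_of_ne _ ha]
  have m₆ : ((σ₅.write mode 0 1).write bound 0 0) mode 0 = 1 := by simp [Memory.write_apply]
  have b₆ : ((σ₅.write mode 0 1).write bound 0 0) bound 0 = 0 := by simp [Memory.write_apply]
  generalize (σ₅.write mode 0 1).write bound 0 0 = σ₆ at *
  have h₆ : Holds N σ₆ := h₅.congr fun a ha _ g₁ _ => e₆ a (by unfold mode; omega) g₁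
  refine (runs_augment h₆ m₆ b₆ (by rwa [e₆ _ (by decide) (by decide)]) hR).frame.mono ?_
  rintro σ₇ t₇ ⟨⟨⟨u, l', k', hst₇, hs₇⟩, ht₇⟩, hfr₇⟩
  obtain ⟨-, hmax⟩ := hst₇.isMaxFlow hN hs₇
  have hE₇ : σ₇ Mem.netE 0 = N.E := by
    rw [hfr₇ _ fun ha => ?_, h₆.E_eq]
    simp only [block, Program.writes, assign, Set.mem_union, Set.mem_singleton_iff,
      Set.mem_empty_iff_false, or_false] at ha
    rcases ha with ha | ha | ha
    · have := of_mem_startSearch_writes ha; revert this; decide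
    · revert ha; decide
    · have := of_mem_search_writes ha; revert this; decide
  refine (Runs.forRange (Inv := fun j τ => ∀ e < j, τ Mem.netFlow e = 1 - σ₇ res e)
    (c := 1) (lo := 0) (hi := N.E) rfl (Nat.zero_le _) (by simp) ?_ ?_).mono ?_
  · intro τ j _ _ hfr
    simp only [val, Expr.eval]
    rw [hfr _ (by simp [Program.writes]) (by decide), hE₇]
  · intro τ j _ hj hI hidx hfr
    have hr : τ res = σ₇ res := hfr _ (by simp [Program.writes]) (by decide)
    simp (disch := decide) only [Runs.set_iff, val, cell, Expr.eval, Memory.write_same,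
      Memory.write_of_ne, hidx, hr]
    refine ⟨⟨trivial, fun e he => ?_⟩, le_rfl⟩
    rcases Nat.lt_succ_iff_lt_or_eq.mp he with he | rfl
    · rw [Function.update_of_ne (by omega)]; exact hI e he
    · rw [Function.update_self]
  · rintro τ t ⟨hI, -, ht⟩
    rw [Runs.block_nil_iff]
    refine ⟨?_, D, by rwa [hN.n_eq, hN.E_eq] at hD, ?_⟩
    · convert hmax using 3 with e
      exact hI e (by rw [hN.E_eq]; exact e.2)
    · rw [← hN.n_eq, ← hN.E_eq]
      -- Source and sink are distinct; so the terms in `D` alone are absorbed by `n * D`, even in a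
      -- network without edges.
      have hn : 2 ≤ N.n := by
        have := N.s_lt; have := N.t_lt; have := N.s_ne_t
        omega
      have hnD : 2 * D ≤ N.n * D := Nat.mul_le_mul_right D hn
      have r₁ : 22 * (2 * N.E * (D + 2 + 1) + N.n * (D + 2) + 1) =
        44 * (N.E * D) + 132 * N.E + 22 * (N.n * D) + 44 * N.n + 22 := by ring
      have r₂ : (22 * (6 * N.E + 2 * N.n + 1) + 6 * N.n + 9) * (2 * D + 1) =
        264 * (N.E * D) + 132 * N.E + 100 * (N.n * D) + 50 * N.n + 62 * D + 31 := by ring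
      have r₃ : (N.n + N.E) * (D + 1) = N.n * D + N.E * D + N.n + N.E := by ring
      rw [r₁] at ht₅
      rw [r₂] at ht₇
      rw [r₃]
      omega

/-- By minimality `D - 1` violates both conditions, unless `D = 1`, so it is at most both roots. -/
theorem IsBound.cast_le {n E D : ℕ} (h : IsBound n E D) :
    (D : ℝ) ≤ 1 + min ((n : ℝ) ^ (2 / 3 : ℝ)) ((E : ℝ) ^ (1 / 2 : ℝ)) := by
  have h₀ : (0 : ℝ) ≤ min ((n : ℝ) ^ (2 / 3 : ℝ)) ((E : ℝ) ^ (1 / 2 : ℝ)) := by positivity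
  rcases h.lt with h₁ | ⟨h₁, h₂⟩
  · rw [h₁]; push_cast; linarith
  obtain ⟨d, rfl⟩ : ∃ d, D = d + 1 := ⟨D - 1, by have := h.pos; omega⟩
  rw [Nat.add_sub_cancel] at h₁ h₂
  have h₁' : (d : ℝ) ^ 2 ≤ E := by rw [pow_two]; exact_mod_cast h₁.le
  have h₂' : (d : ℝ) ^ 3 ≤ (n : ℝ) ^ 2 := by
    have : d ^ 3 ≤ n ^ 2 := by rw [pow_two]; exact le_trans (le_of_eq (by ring)) h₂.le
    exact_mod_cast this
  have hd : (0 : ℝ) ≤ d := Nat.cast_nonneg d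
  push_cast
  rw [add_comm]
  refine add_le_add le_rfl (le_min ?_ ?_)
  · calc (d : ℝ) = ((d : ℝ) ^ 3) ^ (1 / 3 : ℝ) := by
          rw [← Real.rpow_natCast, ← Real.rpow_mul hd]; norm_num
      _ ≤ ((n : ℝ) ^ 2) ^ (1 / 3 : ℝ) := Real.rpow_le_rpow (by positivity) h₂' (by norm_num)
      _ = (n : ℝ) ^ (2 / 3 : ℝ) := by
          rw [← Real.rpow_natCast, ← Real.rpow_mul (Nat.cast_nonneg n)]; norm_num
  · calc (d : ℝ) = ((d : ℝ) ^ 2) ^ (1 / 2 : ℝ) := by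
          rw [← Real.rpow_natCast, ← Real.rpow_mul hd]; norm_num
      _ ≤ _ := Real.rpow_le_rpow (by positivity) h₁' (by norm_num)

theorem isUnitMaxFlowSubroutine_maxFlow : IsUnitMaxFlowSubroutine maxFlow := by
  refine ⟨800, fun U σ hP hU => ?_⟩
  obtain ⟨σ', t, hexec, hmax, D, hD, ht⟩ := runs_maxFlow hP hU
  refine ⟨σ', t, hexec, hmax, fun a ha hne => ?_, ?_⟩
  · refine hexec.eq_of_notMem_writes a fun h => ?_
    have := of_mem_maxFlow_writes h
    omega
  · have h₁ := hD.cast_le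
    have h₂ : (t : ℝ) ≤ 400 * (((U.numNodes : ℝ) + U.numEdges) * (D + 1)) := by exact_mod_cast ht
    have h₃ : (0 : ℝ) ≤ (U.numNodes : ℝ) + U.numEdges := by positivity
    have h₀ : (0 : ℝ) ≤ min ((U.numNodes : ℝ) ^ (2 / 3 : ℝ)) ((U.numEdges : ℝ) ^ (1 / 2 : ℝ)) := by
      positivity
    refine h₂.trans ?_
    rw [show (800 : ℝ) = 400 * 2 by norm_num, mul_assoc]
    refine mul_le_mul_of_nonneg_left ?_ (by norm_num)
    rw [mul_left_comm]
    refine mul_le_mul_of_nonneg_left ?_ h₃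
    linarith

end MaxFlow

/-! ### Star colorings and orientations -/

/-- The outdegree that a node of degree `d` needs to see at most `k` colors. -/
def needOf (d k : ℕ) : ℕ := if 1 < d + 1 - k then d + 1 - k else 0

/-- The number of the first `m` edges with tail `v`. -/
def outdeg (m : ℕ) (src : ℕ → ℕ) (v : ℕ) : ℕ := Finset.card {e ∈ Finset.range m | src e = v}

/-- The tails of the edges after reversing the edges of `F`. -/
def flipTail (src dst : ℕ → ℕ) (F : Finset ℕ) (e : ℕ) : ℕ := if e ∈ F then dst e else src e

/-- `src` and `dst` list the tails and heads of the edges of `G`. -/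
def Orients {n m : ℕ} (G : SimpleGraph (Fin n)) (edge : Fin m ≃ G.edgeSet) (src dst : ℕ → ℕ) : Prop :=
  ∀ e : Fin m, Sym2.map Fin.val (edge e : Sym2 (Fin n)) = s(src e, dst e)

namespace StarColoring

variable {n m : ℕ} {G : SimpleGraph (Fin n)} [DecidableRel G.Adj] {edge : Fin m ≃ G.edgeSet}

theorem card_incident (edge : Fin m ≃ G.edgeSet) (v : Fin n) :
    Finset.card {e : Fin m | v ∈ (edge e : Sym2 (Fin n))} = G.degree v := by
  rw [← G.card_incidenceFinset_eq_degree v]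
  refine Finset.card_bij (fun e _ => (edge e : Sym2 (Fin n))) ?_ ?_ ?_
  · intro e he
    simp only [Finset.mem_filter, Finset.mem_univ, true_and] at he
    simp [SimpleGraph.incidenceSet, he]
  · intro e _ e' _ h
    exact edge.injective (Subtype.ext h)
  · intro b hb
    simp only [SimpleGraph.mem_incidenceFinset, SimpleGraph.incidenceSet, Set.mem_ofPred_eq] at hb
    exact ⟨edge.symm ⟨b, hb.1⟩, by simp [hb.2], by simp⟩

/-- The edges at `v` split into those colored `v` and those colored by their other end. The latter
have pairwise distinct colors, since an edge is determined by its two ends; the former contribute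
one color together, if there are any. -/
theorem numColors_eq (C : StarColoring G) {c : ℕ → ℕ} (hc : ∀ e : Fin m, c e = C.color (edge e))
    (v : Fin n) :
    C.numColors v + outdeg m c v = G.degree v + (if 0 < outdeg m c v then 1 else 0) ∧
      outdeg m c v ≤ G.degree v := by
  set I₁ : Finset (Fin m) := {e | C.color (edge e) = v} with hI₁
  set I₂ : Finset (Fin m) := {e | v ∈ (edge e : Sym2 (Fin n)) ∧ C.color (edge e) ≠ v} with hI₂
  have h₁ : outdeg m c v = I₁.card := by
    rw [outdeg, hI₁, Finset.card_filter, Finset.card_filter, Finset.sum_range]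
    refine Finset.sum_congr rfl fun e _ => ?_
    simp only [hc, Fin.val_inj]
  have h₂ : I₁.card + I₂.card = G.degree v := by
    rw [← card_incident edge v, ← Finset.card_union_of_disjoint]
    · congr 1
      ext e
      have := C.color_mem (edge e)
      simp only [hI₁, hI₂, Finset.mem_union, Finset.mem_filter, Finset.mem_univ, true_and]
      constructor
      · rintro (rfl | h)
        · exact this
        · exact h.1
      · intro h
        by_cases h' : C.color (edge e) = v
        · exact .inl h'
        · exact .inr ⟨h, h'⟩
    · rw [Finset.disjoint_left]
      intro e h h'
      simp only [hI₁, hI₂, Finset.mem_filter, Finset.mem_univ, true_and] at h h'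
      exact h'.2 h
  have h₃ : {c : Fin n | ∃ e : G.edgeSet, v ∈ (e : Sym2 (Fin n)) ∧ C.color e = c} =
      ((I₂.image fun e => C.color (edge e)) ∪ if 0 < I₁.card then {v} else ∅ : Finset (Fin n)) := by
    ext w
    simp only [Set.mem_ofPred_eq, Finset.coe_union, Set.mem_union, Finset.mem_coe, Finset.mem_image]
    constructor
    · rintro ⟨e, he, hw⟩
      obtain ⟨e, rfl⟩ := edge.surjective e
      by_cases h : C.color (edge e) = v
      · right
        rw [if_pos (Finset.card_pos.mpr ⟨e, by simp [hI₁, h]⟩)]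
        simp [← hw, h]
      · exact .inl ⟨e, by simp [hI₂, he, h], hw⟩
    · rintro (⟨e, he, hw⟩ | h)
      · simp only [hI₂, Finset.mem_filter] at he
        exact ⟨edge e, he.2.1, hw⟩
      · split_ifs at h with h'
        · obtain ⟨e, he⟩ := Finset.card_pos.mp h'
          simp only [hI₁, Finset.mem_filter, Finset.mem_univ, true_and] at he
          rw [Finset.mem_singleton] at h
          exact ⟨edge e, he ▸ C.color_mem _, by rw [he, h]⟩
        · simp at h
  have h₄ : (I₂.image fun e => C.color (edge e)).card = I₂.card := by
    refine Finset.card_image_of_injOn fun e he e' he' h => ?_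
    simp only [hI₂, Finset.coe_filter, Finset.mem_univ, true_and, Set.mem_ofPred_eq] at he he'
    have g := (Sym2.mem_and_mem_iff he.2).mp ⟨C.color_mem _, he.1⟩
    have g' := (Sym2.mem_and_mem_iff he'.2).mp ⟨C.color_mem _, he'.1⟩
    change C.color (edge e) = C.color (edge e') at h
    rw [h] at g
    exact edge.injective (Subtype.ext (g.trans g'.symm))
  have h₅ : Disjoint (I₂.image fun e => C.color (edge e)) (if 0 < I₁.card then {v} else ∅) := by
    split_ifs
    · rw [Finset.disjoint_singleton_right, Finset.mem_image]
      rintro ⟨e, he, h⟩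
      simp only [hI₂, Finset.mem_filter] at he
      exact he.2.2 h
    · simp
  rw [numColors, h₃, Set.ncard_coe_finset, Finset.card_union_of_disjoint h₅, h₄, h₁, ← h₂]
  refine ⟨?_, Nat.le_add_right _ _⟩
  split_ifs <;> simp <;> omega

/-- For degree at most `k` there is no restriction. Otherwise outdegree 0 is impossible, and the
count becomes degree - outdegree + 1. For `k = 0` and positive degree the need is degree + 1, which
no orientation can meet. -/
theorem numColors_le_iff (C : StarColoring G) {c : ℕ → ℕ}
    (hc : ∀ e : Fin m, c e = C.color (edge e)) (v : Fin n) (k : ℕ) :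
    C.numColors v ≤ k ↔ needOf (G.degree v) k ≤ outdeg m c v := by
  have h := C.numColors_eq hc v
  unfold needOf
  split_ifs at h ⊢ <;> constructor <;> intro h' <;> omega

theorem numColors_le_degree (edge : Fin m ≃ G.edgeSet) (C : StarColoring G) (v : Fin n) :
    C.numColors v ≤ G.degree v := by
  have h := C.numColors_eq (edge := edge)
    (c := fun e => if h : e < m then C.color (edge ⟨e, h⟩) else 0) (fun e => by simp) v
  split_ifs at h <;> omega

theorem isValid_and_value_le_iff (C : StarColoring G) {c : ℕ → ℕ}
    (hc : ∀ e : Fin m, c e = C.color (edge e)) (κ : Fin n → ℕ) (x : ℕ) :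
    C.IsValid κ ∧ C.value ≤ x ↔
      ∀ v : Fin n, needOf (G.degree v) (min (κ v) x) ≤ outdeg m c v := by
  simp_rw [← C.numColors_le_iff hc, le_min_iff, forall_and]
  simp [IsValid, value]

theorem value_le_maxDegree (edge : Fin m ≃ G.edgeSet) (C : StarColoring G) :
    C.value ≤ G.maxDegree :=
  Finset.sup_le fun v _ => (C.numColors_le_degree edge v).trans (G.degree_le_maxDegree v)

end StarColoring

/-- There is a valid star coloring in which every node sees at most `x` colors. -/
def IsFeasible {n : ℕ} (G : SimpleGraph (Fin n)) (κ : Fin n → ℕ) (x : ℕ) : Prop :=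
  ∃ C : StarColoring G, C.IsValid κ ∧ C.value ≤ x

/-! ### Feasibility in terms of orientations. -/

section

variable {n m : ℕ} {G : SimpleGraph (Fin n)} {edge : Fin m ≃ G.edgeSet} {κ : Fin n → ℕ}
  {src dst : ℕ → ℕ} {x y : ℕ}

theorem IsFeasible.mono (h : IsFeasible G κ x) (hxy : x ≤ y) : IsFeasible G κ y :=
  let ⟨C, h₁, h₂⟩ := h
  ⟨C, h₁, h₂.trans hxy⟩

theorem minMaxStar_eq_of_isFeasible (h : IsFeasible G κ x) (h' : ∀ y < x, ¬ IsFeasible G κ y) :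
    minMaxStar G κ = x := by
  obtain ⟨C, h₁, h₂⟩ := h
  refine le_antisymm (iInf₂_le_of_le C h₁ (by exact_mod_cast h₂)) (le_iInf₂ fun C' hC' => ?_)
  by_contra hlt
  exact h' C'.value (by exact_mod_cast not_le.mp hlt) ⟨C', hC', le_rfl⟩

theorem minMaxStar_eq_top [DecidableRel G.Adj] (edge : Fin m ≃ G.edgeSet)
    (h : ¬ IsFeasible G κ G.maxDegree) : minMaxStar G κ = ⊤ := by
  rw [minMaxStar, iInf₂_eq_top]
  exact fun C hC => absurd ⟨C, hC, C.value_le_maxDegree edge⟩ h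

/-- A node of maximum degree has an incident edge and hence sees a color. This is why the binary
search may treat `lo = 0` as infeasible without testing it. -/
theorem not_isFeasible_zero [DecidableRel G.Adj] (edge : Fin m ≃ G.edgeSet)
    (h : 0 < G.maxDegree) : ¬ IsFeasible G κ 0 := by
  rintro ⟨C, -, hC⟩
  have : Nonempty (Fin n) := by
    by_contra hn
    rw [not_nonempty_iff] at hn
    simp [SimpleGraph.maxDegree] at h
  obtain ⟨v, hv⟩ := G.exists_maximal_degree_vertex
  have h₁ := C.numColors_eq (edge := edge)
    (c := fun e => if h : e < m then C.color (edge ⟨e, h⟩) else 0) (fun e => by simp) v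
  have h₂ : C.numColors v ≤ 0 := (Finset.le_sup (Finset.mem_univ v)).trans hC
  split_ifs at h₁ <;> omega

namespace Orients

theorem mem (h : Orients G edge src dst) (e : Fin m) :
    ∃ u w : Fin n, (edge e : Sym2 (Fin n)) = s(u, w) ∧ src e = u ∧ dst e = w ∧ u ≠ w := by
  have he := h e
  have hG := (edge e).2
  induction hs : (edge e : Sym2 (Fin n)) with
  | h u w =>
    rw [hs] at he hG
    rw [SimpleGraph.mem_edgeSet] at hG
    rw [Sym2.map_mk, Sym2.eq_iff] at he
    rcases he with ⟨h₁, h₂⟩ | ⟨h₁, h₂⟩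
    · exact ⟨u, w, rfl, h₁.symm, h₂.symm, hG.ne⟩
    · exact ⟨w, u, Sym2.eq_swap, h₂.symm, h₁.symm, hG.ne'⟩

theorem src_lt (h : Orients G edge src dst) {e : ℕ} (he : e < m) : src e < n := by
  obtain ⟨u, _, _, h', _⟩ := h.mem ⟨e, he⟩
  exact h' ▸ u.2

theorem dst_lt (h : Orients G edge src dst) {e : ℕ} (he : e < m) : dst e < n := by
  obtain ⟨_, w, _, _, h', _⟩ := h.mem ⟨e, he⟩
  exact h' ▸ w.2

theorem ne (h : Orients G edge src dst) {e : ℕ} (he : e < m) : src e ≠ dst e := by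
  obtain ⟨u, w, _, h₁, h₂, h₃⟩ := h.mem ⟨e, he⟩
  simp only at h₁ h₂
  rw [h₁, h₂]
  exact fun h => h₃ (Fin.ext h)

/-- As `G` is simple, an edge is determined by its ends; this keeps parallel edges of the slackness
network at the terminals. -/
theorem injective (h : Orients G edge src dst) {e e' : ℕ} (he : e < m) (he' : e' < m)
    (h₁ : src e = src e') (h₂ : dst e = dst e') : e = e' := by
  have g := h ⟨e, he⟩
  have g' := h ⟨e', he'⟩
  simp only [← h₁, ← h₂] at g'
  have := edge.injective (Subtype.ext (Sym2.map.injective Fin.val_injective (g.trans g'.symm)))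
  simpa using this

/-- The coloring of the edges by their tails. -/
theorem exists_coloring (h : Orients G edge src dst) :
    ∃ C : StarColoring G, ∀ e : Fin m, src e = C.color (edge e) := by
  have hex : ∀ e : Fin m, ∃ u : Fin n, u ∈ (edge e : Sym2 (Fin n)) ∧ src e = u := by
    intro e
    obtain ⟨u, w, h₁, h₂, -⟩ := h.mem e
    exact ⟨u, by rw [h₁]; exact Sym2.mem_mk_left u w, h₂⟩
  choose f hf hf' using hex
  refine ⟨⟨fun e => f (edge.symm e), fun e => ?_⟩, fun e => ?_⟩
  · simpa using hf (edge.symm e)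
  · simpa using hf' e

theorem exists_flip (h : Orients G edge src dst) (C : StarColoring G) :
    ∃ F : Finset ℕ, ∀ e : Fin m, flipTail src dst F e = C.color (edge e) := by
  classical
  refine ⟨{e ∈ Finset.range m | ∃ h : e < m, src e ≠ C.color (edge ⟨e, h⟩)}, fun e => ?_⟩
  have hm := C.color_mem (edge e)
  obtain ⟨u, w, h₁, h₂, h₃, -⟩ := h.mem e
  rw [h₁, Sym2.mem_iff] at hm
  unfold flipTail
  by_cases hu : C.color (edge e) = u
  · rw [if_neg, h₂, hu]
    simp [h₂, hu]
  · rw [if_pos, h₃, hm.resolve_left hu]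
    simp only [Finset.mem_filter, Finset.mem_range, e.2, true_and, exists_true_left, h₂]
    exact fun h => hu (Fin.ext h.symm)

/-- Relative to any reference orientation, every star coloring arises by reversing a set of edges.
So the outcome of a test does not depend on the orientation it starts from. -/
theorem isFeasible_iff [DecidableRel G.Adj] (h : Orients G edge src dst) :
    IsFeasible G κ x ↔ ∃ F : Finset ℕ, ∀ v : Fin n,
      needOf (G.degree v) (min (κ v) x) ≤ outdeg m (flipTail src dst F) v := by
  constructor
  · rintro ⟨C, hC⟩
    obtain ⟨F, hF⟩ := h.exists_flip C
    exact ⟨F, (C.isValid_and_value_le_iff hF κ x).mp hC⟩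
  · rintro ⟨F, hF⟩
    have h' : Orients G edge (flipTail src dst F) (flipTail dst src F) := by
      intro e
      unfold flipTail
      split_ifs
      · rw [h e, Sym2.eq_swap]
      · exact h e
    obtain ⟨C, hC⟩ := h'.exists_coloring
    exact ⟨C, (C.isValid_and_value_le_iff hC κ x).mpr hF⟩

end Orients

end

/-! ### The slackness network -/

theorem outdeg_eq_sum (m : ℕ) (src : ℕ → ℕ) (v : ℕ) :
    outdeg m src v = ∑ e ∈ Finset.range m, if src e = v then 1 else 0 := by
  rw [outdeg, Finset.card_filter]

theorem outdeg_flipTail_add (m : ℕ) (src dst : ℕ → ℕ) (F : Finset ℕ) (v : ℕ) :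
    outdeg m (flipTail src dst F) v + Finset.card {e ∈ Finset.range m | src e = v ∧ e ∈ F} =
      outdeg m src v + Finset.card {e ∈ Finset.range m | dst e = v ∧ e ∈ F} := by
  simp only [outdeg, Finset.card_filter, ← Finset.sum_add_distrib]
  refine Finset.sum_congr rfl fun e _ => ?_
  unfold flipTail
  by_cases h : e ∈ F <;> simp [h, add_comm]

theorem outdeg_flipTail_erase {m : ℕ} {src dst : ℕ → ℕ} {F : Finset ℕ} {e : ℕ} (he : e < m)
    (heF : e ∈ F) (v : ℕ) :
    outdeg m (flipTail src dst (F.erase e)) v + (if dst e = v then 1 else 0) =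
      outdeg m (flipTail src dst F) v + (if src e = v then 1 else 0) := by
  simp only [outdeg_eq_sum]
  rw [← Finset.add_sum_erase _ _ (Finset.mem_range.mpr he),
    ← Finset.add_sum_erase (Finset.range m) (fun e => if flipTail src dst F e = v then 1 else 0)
      (Finset.mem_range.mpr he)]
  have h : ∑ i ∈ (Finset.range m).erase e, (if flipTail src dst (F.erase e) i = v then 1 else 0) =
      ∑ i ∈ (Finset.range m).erase e, (if flipTail src dst F i = v then 1 else 0) := by
    refine Finset.sum_congr rfl fun i hi => ?_
    have : flipTail src dst (F.erase e) i = flipTail src dst F i := by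
      simp [flipTail, Finset.ne_of_mem_erase hi]
    rw [this]
  rw [h]
  simp only [flipTail, Finset.mem_erase, ne_eq, not_true_eq_false, false_and, if_false, heF, if_true]
  ring

/-- A feasible reorientation that reverses the fewest edges raises no outdegree more than needed. -/
theorem exists_flip_le_max {n m : ℕ} {src dst need : ℕ → ℕ} (hne : ∀ e < m, src e ≠ dst e)
    (h : ∃ F : Finset ℕ, ∀ v < n, need v ≤ outdeg m (flipTail src dst F) v) :
    ∃ F : Finset ℕ, ∀ v < n, need v ≤ outdeg m (flipTail src dst F) v ∧
      outdeg m (flipTail src dst F) v ≤ max (outdeg m src v) (need v) := by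
  classical
  have hex : ∃ k, ∃ F : Finset ℕ, F.card = k ∧
      ∀ v < n, need v ≤ outdeg m (flipTail src dst F) v := by
    obtain ⟨F, hF⟩ := h
    exact ⟨_, F, rfl, hF⟩
  obtain ⟨F, hFk, hF⟩ := Nat.find_spec hex
  refine ⟨F, fun v hv => ⟨hF v hv, ?_⟩⟩
  by_contra! hlt
  have h₁ := outdeg_flipTail_add m src dst F v
  -- The outdegree of `v` has grown, so some reversed edge now leaves `v`. Undoing this reversal
  -- costs only `v` a unit, which it can spare, and contradicts the choice of `F`.
  obtain ⟨e, he⟩ : ({e ∈ Finset.range m | dst e = v ∧ e ∈ F} : Finset ℕ).Nonempty := by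
    rw [← Finset.card_pos]
    have := le_max_left (outdeg m src v) (need v)
    omega
  simp only [Finset.mem_filter, Finset.mem_range] at he
  obtain ⟨he, hev, heF⟩ := he
  refine Nat.find_min hex (m := (F.erase e).card) ?_ ⟨F.erase e, rfl, fun w hw => ?_⟩
  · rw [← hFk]; exact Finset.card_erase_lt_of_mem heF
  · have h₂ := outdeg_flipTail_erase (src := src) (dst := dst) he heF w
    have h₃ := hF w hw
    by_cases hwv : w = v
    · subst hwv
      have := le_max_right (outdeg m src w) (need w)
      have hs : src e ≠ w := fun h' => hne e he (h'.trans hev.symm)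
      rw [if_pos hev, if_neg hs] at h₂
      omega
    · rw [if_neg (fun h' => hwv (h'.symm.trans hev))] at h₂
      omega

/-- The edges given by `tail` and `head` form the slackness network of the orientation given by `src`
and `dst`, when the outdegree of each node `v` should become at least `need v`. -/
structure SlackNetwork (n m : ℕ) (src dst need : ℕ → ℕ) (M : ℕ) (tail head : ℕ → ℕ) : Prop where
  le : m ≤ M
  tail_eq : ∀ e < m, tail e = src e
  head_eq : ∀ e < m, head e = dst e
  src_lt : ∀ e < m, src e < n
  dst_lt : ∀ e < m, dst e < n
  terminal : ∀ e, m ≤ e → e < M → (tail e = n ∧ head e < n) ∨ (tail e < n ∧ head e = n + 1)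
  card_source : ∀ v < n, Finset.card {e ∈ Finset.range M | tail e = n ∧ head e = v} =
    outdeg m src v - need v
  card_sink : ∀ v < n, Finset.card {e ∈ Finset.range M | tail e = v ∧ head e = n + 1} =
    need v - outdeg m src v

namespace SlackNetwork

variable {n m M : ℕ} {src dst need tail head : ℕ → ℕ}

theorem tail_lt (h : SlackNetwork n m src dst need M tail head) {e : ℕ} (he : e < M) :
    tail e < n + 1 := by
  by_cases hm : e < m
  · have := h.src_lt e hm; rw [h.tail_eq e hm]; omega
  · have := h.terminal e (by omega) he; omega

theorem head_lt (h : SlackNetwork n m src dst need M tail head) {e : ℕ} (he : e < M) :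
    head e < n + 2 := by
  by_cases hm : e < m
  · have := h.dst_lt e hm; rw [h.head_eq e hm]; omega
  · have := h.terminal e (by omega) he; omega

/-- The slackness network as a unit-capacity network. -/
def toNetwork (h : SlackNetwork n m src dst need M tail head) : UnitNetwork where
  numNodes := n + 2
  numEdges := M
  tail e := ⟨tail e, by have := h.tail_lt e.2; omega⟩
  head e := ⟨head e, h.head_lt e.2⟩
  source := ⟨n, by omega⟩
  sink := ⟨n + 1, by omega⟩
  source_ne_sink := by simp

theorem parallelOnlyAtTerminals (h : SlackNetwork n m src dst need M tail head)
    (hinj : ∀ e < m, ∀ e' < m, src e = src e' → dst e = dst e' → e = e') :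
    h.toNetwork.ParallelOnlyAtTerminals := by
  intro e e' h₁ h₂ hne
  have h₁ : tail e = tail e' := by simpa [toNetwork] using h₁
  have h₂ : head e = head e' := by simpa [toNetwork] using h₂
  suffices tail e = n ∨ tail e = n + 1 ∨ head e = n ∨ head e = n + 1 by
    simpa [toNetwork, Fin.ext_iff] using this
  by_cases hm : (e : ℕ) < m
  · by_cases hm' : (e' : ℕ) < m
    · rw [h.tail_eq _ hm, h.tail_eq _ hm'] at h₁
      rw [h.head_eq _ hm, h.head_eq _ hm'] at h₂
      exact absurd (Fin.ext (hinj e hm e' hm' h₁ h₂)) hne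
    · have := h.terminal e' (by omega) e'.2
      omega
  · have := h.terminal e (by omega) e.2
    omega

theorem outflow_eq (h : SlackNetwork n m src dst need M tail head) (g : ℕ → ℝ) {v : ℕ} (hv : v < n) :
    h.toNetwork.outflow (fun e => g e) ⟨v, by change v < n + 2; omega⟩ =
      ∑ e ∈ Finset.range m with src e = v, g e +
        ∑ e ∈ Finset.range M with tail e = v ∧ head e = n + 1, g e := by
  have h₁ : h.toNetwork.outflow (fun e => g e) ⟨v, by change v < n + 2; omega⟩ =
      ∑ e ∈ Finset.range M, if tail e = v then g e else 0 := by
    rw [UnitNetwork.outflow, Finset.sum_filter, Finset.sum_range]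
    exact Finset.sum_congr rfl fun e _ => if_congr Fin.ext_iff rfl rfl
  obtain ⟨d, rfl⟩ := Nat.exists_eq_add_of_le h.le
  rw [h₁, Finset.sum_filter, Finset.sum_filter, Finset.sum_range_add, Finset.sum_range_add, ← add_assoc,
    ← Finset.sum_add_distrib]
  congr 1
  · refine Finset.sum_congr rfl fun e he => ?_
    have he := Finset.mem_range.mp he
    have hd := h.dst_lt e he
    rw [h.tail_eq e he, h.head_eq e he, if_neg (c := src e = v ∧ _) (fun h' => by omega), add_zero]
  · refine Finset.sum_congr rfl fun e he => ?_
    have he := Finset.mem_range.mp he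
    have ht := h.terminal (m + e) (by omega) (by omega)
    by_cases hv' : tail (m + e) = v
    · rw [if_pos hv', if_pos ⟨hv', by omega⟩]
    · rw [if_neg hv', if_neg fun h' => hv' h'.1]

theorem inflow_eq (h : SlackNetwork n m src dst need M tail head) (g : ℕ → ℝ) {v : ℕ} (hv : v < n) :
    h.toNetwork.inflow (fun e => g e) ⟨v, by change v < n + 2; omega⟩ =
      ∑ e ∈ Finset.range m with dst e = v, g e +
        ∑ e ∈ Finset.range M with tail e = n ∧ head e = v, g e := by
  have h₁ : h.toNetwork.inflow (fun e => g e) ⟨v, by change v < n + 2; omega⟩ =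
      ∑ e ∈ Finset.range M, if head e = v then g e else 0 := by
    rw [UnitNetwork.inflow, Finset.sum_filter, Finset.sum_range]
    exact Finset.sum_congr rfl fun e _ => if_congr Fin.ext_iff rfl rfl
  obtain ⟨d, rfl⟩ := Nat.exists_eq_add_of_le h.le
  rw [h₁, Finset.sum_filter, Finset.sum_filter, Finset.sum_range_add, Finset.sum_range_add, ← add_assoc,
    ← Finset.sum_add_distrib]
  congr 1
  · refine Finset.sum_congr rfl fun e he => ?_
    have he := Finset.mem_range.mp he
    have hd := h.src_lt e he
    rw [h.tail_eq e he, h.head_eq e he, if_neg (c := _ ∧ dst e = v) (fun h' => by omega), add_zero]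
  · refine Finset.sum_congr rfl fun e he => ?_
    have he := Finset.mem_range.mp he
    have ht := h.terminal (m + e) (by omega) (by omega)
    by_cases hv' : head (m + e) = v
    · rw [if_pos hv', if_pos ⟨by omega, hv'⟩]
    · rw [if_neg hv', if_neg fun h' => hv' h'.2]

/-- The cut that isolates the sink; no edge leaves the sink. -/
theorem flowValue_eq (h : SlackNetwork n m src dst need M tail head) {g : ℕ → ℝ}
    (hg : h.toNetwork.IsFlow fun e => g e) :
    h.toNetwork.flowValue (fun e => g e) = ∑ e ∈ Finset.range M with head e = n + 1, g e := by
  rw [hg.flowValue_eq (fun v => v ≠ h.toNetwork.sink) h.toNetwork.source_ne_sink (by simp),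
    Finset.sum_filter, Finset.sum_range]
  refine Finset.sum_congr rfl fun e _ => ?_
  have h₁ : h.toNetwork.tail e ≠ h.toNetwork.sink := by
    have := h.tail_lt e.2
    simp only [toNetwork, ne_eq, Fin.mk.injEq]
    omega
  have h₂ : h.toNetwork.head e = h.toNetwork.sink ↔ head e = n + 1 := by
    simp [toNetwork]
  by_cases h₃ : head e = n + 1
  · simp [h₁, h₂.mpr h₃, h₃]
  · simp [h₁, h₂.not.mpr h₃, h₃]

/-- A reorientation that meets all needs gives a flow that saturates all edges into the sink. -/
theorem exists_flow (h : SlackNetwork n m src dst need M tail head) {F : Finset ℕ}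
    (hF : ∀ v < n, need v ≤ outdeg m (flipTail src dst F) v ∧
      outdeg m (flipTail src dst F) v ≤ max (outdeg m src v) (need v)) :
    ∃ g : ℕ → ℝ, h.toNetwork.IsFlow (fun e => g e) ∧ ∀ e < M, head e = n + 1 → g e = 1 := by
  set o : ℕ → ℕ := outdeg m src with ho
  set o' : ℕ → ℕ := outdeg m (flipTail src dst F) with ho'
  -- One unit on reversed edges and on sink edges. The surplus `o - o'` that a node gives away is
  -- spread evenly over its `o - need` parallel source edges; fractional values are allowed because
  -- maximality is tested against all real flows.
  set g : ℕ → ℝ := fun e => if e < m then (if e ∈ F then 1 else 0) else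
    if head e = n + 1 then 1 else ((o (head e) : ℝ) - o' (head e)) / (o (head e) - need (head e))
    with hg
  have hs : ∀ e, m ≤ e → e < M → tail e = n → need (head e) < o (head e) := by
    intro e hm hM ht
    have hlt : head e < n := by have := h.terminal e hm hM; omega
    have hpos : 0 < o (head e) - need (head e) := by
      rw [← h.card_source _ hlt, Finset.card_pos]
      exact ⟨e, by simp [hM, ht]⟩
    omega
  refine ⟨g, ⟨fun e => ?_, ?_⟩, ?_⟩
  · simp only [hg]
    split_ifs with h₁ h₂ h₃
    · norm_num
    · norm_num
    · norm_num
    · have ht := h.terminal e (by omega) e.2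
      have hlt := hs e (by omega) e.2 (by omega)
      obtain ⟨h₄, h₅⟩ := hF (head e) (by omega)
      rw [max_eq_left hlt.le] at h₅
      have h₆ : (need (head e) : ℝ) < o (head e) := by exact_mod_cast hlt
      have h₇ : (need (head e) : ℝ) ≤ o' (head e) := by exact_mod_cast h₄
      have h₈ : (o' (head e) : ℝ) ≤ o (head e) := by exact_mod_cast h₅
      constructor
      · exact div_nonneg (by linarith) (by linarith)
      · rw [div_le_one (by linarith)]; linarith
  · rintro ⟨v, hv⟩ hvs hvt
    have hvn : v < n := by
      have h₁ : v ≠ n := fun e => hvs (Fin.ext e)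
      have h₂ : v ≠ n + 1 := fun e => hvt (Fin.ext e)
      change v < n + 2 at hv
      omega
    rw [h.inflow_eq g hvn, h.outflow_eq g hvn]
    have e₁ : ∑ e ∈ Finset.range m with dst e = v, g e =
        Finset.card {e ∈ Finset.range m | dst e = v ∧ e ∈ F} := by
      rw [Finset.card_filter, Finset.sum_filter]
      push_cast
      refine Finset.sum_congr rfl fun e he => ?_
      simp only [hg, if_pos (Finset.mem_range.mp he), ite_and]
    have e₂ : ∑ e ∈ Finset.range m with src e = v, g e =
        Finset.card {e ∈ Finset.range m | src e = v ∧ e ∈ F} := by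
      rw [Finset.card_filter, Finset.sum_filter]
      push_cast
      refine Finset.sum_congr rfl fun e he => ?_
      simp only [hg, if_pos (Finset.mem_range.mp he), ite_and]
    have e₃ : ∑ e ∈ Finset.range M with tail e = v ∧ head e = n + 1, g e =
        ((need v - o v : ℕ) : ℝ) := by
      rw [← h.card_sink v hvn, Finset.card_eq_sum_ones]
      push_cast
      refine Finset.sum_congr rfl fun e he => ?_
      simp only [Finset.mem_filter, Finset.mem_range] at he
      have hm : ¬ e < m := fun hm => by
        have := h.head_eq e hm; have := h.dst_lt e hm; omega
      simp only [hg, if_neg hm, if_pos he.2.2]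
    have e₄ : ∑ e ∈ Finset.range M with tail e = n ∧ head e = v, g e =
        ((o v - need v : ℕ) : ℝ) * (((o v : ℝ) - o' v) / (o v - need v)) := by
      rw [← h.card_source v hvn, Finset.sum_congr rfl (g := fun _ => ((o v : ℝ) - o' v) / (o v - need v)),
        Finset.sum_const, nsmul_eq_mul]
      intro e he
      simp only [Finset.mem_filter, Finset.mem_range] at he
      have hm : ¬ e < m := fun hm => by
        have := h.tail_eq e hm; have := h.src_lt e hm; omega
      simp only [hg, if_neg hm, he.2.2, if_neg (show v ≠ n + 1 by omega)]
    rw [e₁, e₂, e₃, e₄]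
    have hflip := outdeg_flipTail_add m src dst F v
    rw [← ho, ← ho'] at hflip
    have hflip' : (o' v : ℝ) + Finset.card {e ∈ Finset.range m | src e = v ∧ e ∈ F} =
      o v + Finset.card {e ∈ Finset.range m | dst e = v ∧ e ∈ F} := by exact_mod_cast hflip
    obtain ⟨h₄, h₅⟩ := hF v hvn
    -- With a surplus, `o'` lies between the need and `o`, and the source edges supply `o - o'`.
    -- With a deficit, the bounds force `o'` to equal the need. If neither, `o' = o`.
    rcases lt_trichotomy (need v) (o v) with hlt | heq | hlt
    · rw [Nat.sub_eq_zero_of_le hlt.le, Nat.cast_sub hlt.le]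
      have h₆ : (need v : ℝ) < o v := by exact_mod_cast hlt
      rw [mul_div_cancel₀ _ (by linarith)]
      push_cast
      linarith
    · rw [heq, Nat.sub_self]
      rw [heq, max_self] at h₅
      have h₆ : o' v = o v := by omega
      rw [h₆] at hflip'
      push_cast
      linarith
    · rw [Nat.sub_eq_zero_of_le hlt.le, Nat.cast_sub hlt.le]
      rw [max_eq_right hlt.le] at h₅
      have h₆ : o' v = need v := by omega
      rw [h₆] at hflip'
      push_cast
      linarith
  · intro e he hhe
    have hm : ¬ e < m := fun hm => by
      have := h.head_eq e hm; have := h.dst_lt e hm; omega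
    simp only [hg, if_neg hm, if_pos hhe]

/-- If the needs can be met, then a maximum flow saturates all edges into the sink. -/
theorem saturated_of_exists (h : SlackNetwork n m src dst need M tail head)
    (hne : ∀ e < m, src e ≠ dst e)
    (hF : ∃ F : Finset ℕ, ∀ v < n, need v ≤ outdeg m (flipTail src dst F) v) {f : ℕ → ℝ}
    (hf : h.toNetwork.IsMaxFlow fun e => f e) {e : ℕ} (he : e < M) (hhe : head e = n + 1) :
    f e = 1 := by
  obtain ⟨F, hF⟩ := exists_flip_le_max hne hF
  obtain ⟨g, hg, hg1⟩ := h.exists_flow hF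
  have hle := hf.2 _ hg
  rw [h.flowValue_eq hg, h.flowValue_eq hf.1] at hle
  have hle' : ∀ i ∈ ({e ∈ Finset.range M | head e = n + 1} : Finset ℕ), f i ≤ g i := by
    intro i hi
    simp only [Finset.mem_filter, Finset.mem_range] at hi
    rw [hg1 i hi.1 hi.2]
    exact (hf.1.1 ⟨i, hi.1⟩).2
  -- `f` is at most `g = 1` on each sink edge, while its sum over them is no smaller; so the two
  -- agree termwise.
  have heq := (Finset.sum_eq_sum_iff_of_le hle').mp (le_antisymm (Finset.sum_le_sum hle') hle) e
    (by simp [he, hhe])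
  rw [heq, hg1 e he hhe]

/-- Reversing the edges that carry flow meets all needs if all edges into the sink are saturated. -/
theorem need_le_of_saturated (h : SlackNetwork n m src dst need M tail head) {f : ℕ → ℕ}
    (hf : h.toNetwork.IsFlow fun e => (f e : ℝ)) (hsat : ∀ e < M, head e = n + 1 → f e ≠ 0)
    {v : ℕ} (hv : v < n) :
    need v ≤ outdeg m (flipTail src dst {e ∈ Finset.range m | f e ≠ 0}) v := by
  have hle : ∀ e < M, f e ≤ 1 := fun e he => Nat.cast_le_one.mp (hf.1 ⟨e, he⟩).2
  have hcons := hf.2 ⟨v, by change v < n + 2; omega⟩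
    (fun e => hv.ne (Fin.ext_iff.mp e)) (fun e => (Nat.lt_succ_of_lt hv).ne (Fin.ext_iff.mp e))
  -- By conservation, the change of outdegree at `v` is its flow into the sink, equal to `need v - o
  -- v`, minus its flow from the source, at most `o v - need v` (truncated differences, `o` the old
  -- outdegree).
  rw [h.inflow_eq (fun e => (f e : ℝ)) hv, h.outflow_eq (fun e => (f e : ℝ)) hv] at hcons
  norm_cast at hcons
  have hflip := outdeg_flipTail_add m src dst {e ∈ Finset.range m | f e ≠ 0} v
  have hm := h.le
  have e₁ : ∀ a : ℕ → ℕ, ∑ e ∈ Finset.range m with a e = v, f e =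
      Finset.card {e ∈ Finset.range m | a e = v ∧ e ∈ ({e ∈ Finset.range m | f e ≠ 0} : Finset ℕ)} := by
    intro a
    rw [Finset.card_filter, Finset.sum_filter]
    refine Finset.sum_congr rfl fun e he => ?_
    have := hle e (by have := Finset.mem_range.mp he; omega)
    simp only [Finset.mem_filter, he, true_and, ite_and]
    split_ifs <;> omega
  have e₂ : ∑ e ∈ Finset.range M with tail e = v ∧ head e = n + 1, f e = need v - outdeg m src v := by
    rw [← h.card_sink v hv, Finset.card_eq_sum_ones]
    refine Finset.sum_congr rfl fun e he => ?_
    simp only [Finset.mem_filter, Finset.mem_range] at he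
    have := hle e he.1
    have := hsat e he.1 he.2.2
    omega
  have e₃ : ∑ e ∈ Finset.range M with tail e = n ∧ head e = v, f e ≤ outdeg m src v - need v := by
    rw [← h.card_source v hv, Finset.card_eq_sum_ones]
    refine Finset.sum_le_sum fun e he => ?_
    simp only [Finset.mem_filter, Finset.mem_range] at he
    exact hle e he.1
  rw [e₁, e₁, e₂] at hcons
  omega

end SlackNetwork

/-! ### The parts of the algorithm -/

theorem outdeg_succ (m : ℕ) (src : ℕ → ℕ) (v : ℕ) :
    outdeg (m + 1) src v = outdeg m src v + if src m = v then 1 else 0 := by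
  rw [outdeg_eq_sum, outdeg_eq_sum, Finset.sum_range_succ]

theorem outdeg_zero (src : ℕ → ℕ) (v : ℕ) : outdeg 0 src v = 0 := by
  simp [outdeg]

theorem sum_outdeg_le (n m : ℕ) (src : ℕ → ℕ) : ∑ v ∈ Finset.range n, outdeg m src v ≤ m := by
  simp only [outdeg_eq_sum]
  rw [Finset.sum_comm]
  refine (Finset.sum_le_card_nsmul _ _ 1 fun e _ => ?_).trans (by simp)
  rw [Finset.sum_ite_eq]
  split_ifs <;> omega

theorem Orients.degree_eq {n m : ℕ} {G : SimpleGraph (Fin n)} [DecidableRel G.Adj]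
    {edge : Fin m ≃ G.edgeSet} {src dst : ℕ → ℕ} (h : Orients G edge src dst) (v : Fin n) :
    G.degree v = outdeg m src v + outdeg m dst v := by
  rw [← StarColoring.card_incident edge v, outdeg_eq_sum, outdeg_eq_sum, Finset.card_filter,
    Finset.sum_range, Finset.sum_range, ← Finset.sum_add_distrib]
  refine Finset.sum_congr rfl fun e _ => ?_
  obtain ⟨u, w, h₁, h₂, h₃, h₄⟩ := h.mem e
  rw [h₁, h₂, h₃]
  simp only [Sym2.mem_iff, Fin.val_inj]
  by_cases hu : u = v
  · have : w ≠ v := fun hw => h₄ (hu.trans hw.symm)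
    simp [hu, this]
  · simp [hu, Ne.symm hu, eq_comm]

namespace StarColoringFlow

open Program

theorem runs_computeDegrees {n m : ℕ} {σ : Memory} (hn : σ Mem.numV 0 = n) (hm : σ Mem.numE 0 = m) :
    Runs computeDegrees σ fun σ' t =>
      ((∀ v < n, σ' Mem.deg v = outdeg m (σ Mem.src) v + outdeg m (σ Mem.dst) v) ∧
        (∀ v < n, σ' Mem.deg v ≤ σ' Mem.maxDeg 0) ∧
        (σ' Mem.maxDeg 0 = 0 ∨ ∃ v < n, σ' Mem.deg v = σ' Mem.maxDeg 0)) ∧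
      t ≤ 9 * n + 6 * m + 8 := by
  rw [computeDegrees, Runs.block_cons_iff]
  refine (Runs.forRange (Inv := fun j τ => ∀ v < j, τ Mem.deg v = 0)
    (c := 1) (lo := 0) (hi := n) rfl (Nat.zero_le _) (by simp) ?_ ?_).frame.mono ?_
  · intro τ j _ _ hf
    simp only [val, Expr.eval]
    rw [hf _ (by simp [Program.writes]) (by decide), hn]
  · intro τ j _ hj hI hidx hf
    simp (disch := decide) only [Runs.set_iff, val, Expr.eval, Memory.write_same, Memory.write_of_ne,
      hidx]
    refine ⟨⟨trivial, fun v hv => ?_⟩, le_rfl⟩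
    rcases Nat.lt_succ_iff_lt_or_eq.mp hv with hv | rfl
    · rw [Function.update_of_ne (by omega)]; exact hI v hv
    · rw [Function.update_self]
  rintro σ₁ t₁ ⟨⟨hI₁, -, ht₁⟩, hf₁⟩
  have hf₁ : ∀ a, a ≠ Mem.deg → a ≠ Mem.i → σ₁ a = σ a := fun a h₁ h₂ => hf₁ a (by
    simp [Program.writes, forRange, incr, assign, h₁, h₂])
  rw [Runs.block_cons_iff]
  refine (Runs.forRange (Inv := fun j τ => ∀ v < n,
      τ Mem.deg v = outdeg j (σ Mem.src) v + outdeg j (σ Mem.dst) v)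
    (c := 3) (lo := 0) (hi := m) rfl (Nat.zero_le _) ?_ ?_ ?_).frame.mono ?_
  · intro v hv
    rw [Memory.write_of_ne _ (by decide), outdeg_zero, outdeg_zero, hI₁ v hv]
  · intro τ j _ _ hf
    simp only [val, Expr.eval]
    rw [hf _ (by simp [Program.writes, block, incrCell]) (by decide), hf₁ _ (by decide) (by decide), hm]
  · intro τ j _ hj hI hidx hf
    have hs : τ Mem.src = σ Mem.src := by
      rw [hf _ (by simp [Program.writes, block, incrCell]) (by decide), hf₁ _ (by decide) (by decide)]
    have hd : τ Mem.dst = σ Mem.dst := by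
      rw [hf _ (by simp [Program.writes, block, incrCell]) (by decide), hf₁ _ (by decide) (by decide)]
    simp (disch := decide) only [incrCell, Runs.block_cons_iff, Runs.block_nil_iff, Runs.set_iff, val,
      cell, Expr.eval, Memory.write_same, Memory.write_of_ne, hidx, hs, hd]
    refine ⟨⟨trivial, fun v hv => ?_⟩, le_rfl⟩
    rw [outdeg_succ, outdeg_succ]
    have := hI v hv
    simp only [Function.update_apply, eq_comm (a := v)]
    by_cases h₁ : σ Mem.src j = v <;> by_cases h₂ : σ Mem.dst j = v
    · simp only [h₁, h₂, if_true]; omega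
    · simp only [h₁, h₂, if_true, if_false]; omega
    · simp only [h₂, Ne.symm h₁, h₁, if_true, if_false]; omega
    · simp only [h₁, h₂, if_false]; omega
  rintro σ₂ t₂ ⟨⟨hI₂, -, ht₂⟩, hf₂⟩
  have hn₂ : σ₂ Mem.numV 0 = n := by
    rw [hf₂ _ (by simp [Program.writes, block, forRange, incr, assign, incrCell]),
      hf₁ _ (by decide) (by decide), hn]
  rw [Runs.block_cons_iff, assign, Runs.set_iff, Runs.block_cons_iff]
  refine (Runs.forRange (Inv := fun j τ => (∀ v < j, σ₂ Mem.deg v ≤ τ Mem.maxDeg 0) ∧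
      (τ Mem.maxDeg 0 = 0 ∨ ∃ v < j, σ₂ Mem.deg v = τ Mem.maxDeg 0))
    (c := 2) (lo := 0) (hi := n) rfl (Nat.zero_le _) ?_ ?_ ?_).frame.mono ?_
  · simp [Memory.write_apply, Expr.eval]
  · intro τ j _ _ hf
    simp only [val, Expr.eval]
    rw [hf _ (by simp [Program.writes, assign]) (by decide), Memory.write_of_ne _ (by decide), hn₂]
  · intro τ j _ hj hI hidx hf
    have hd : τ Mem.deg = σ₂ Mem.deg := by
      rw [hf _ (by simp [Program.writes, assign]) (by decide), Memory.write_of_ne _ (by decide)]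
    rw [Runs.ite_iff]
    simp only [lt, cell, val, Expr.eval, hidx, hd]
    split_ifs with hlt
    · rw [Runs.skip_iff]
      simp (disch := decide) only [Memory.write_of_ne, hidx]
      refine ⟨⟨trivial, fun v hv => ?_, ?_⟩, le_rfl⟩
      · rcases Nat.lt_succ_iff_lt_or_eq.mp hv with hv | rfl
        · exact hI.1 v hv
        · omega
      · exact hI.2.imp id fun ⟨v, hv, h⟩ => ⟨v, by omega, h⟩
    · simp (disch := decide) only [assign, Runs.set_iff, Expr.eval, Memory.write_same,
        Memory.write_of_ne, hidx, hd, Function.update_self]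
      refine ⟨⟨trivial, fun v hv => ?_, .inr ⟨j, by omega, rfl⟩⟩, le_rfl⟩
      rcases Nat.lt_succ_iff_lt_or_eq.mp hv with hv | rfl
      · have := hI.1 v hv; omega
      · exact le_rfl
  rintro σ₃ t₃ ⟨⟨hI₃, -, ht₃⟩, hf₃⟩
  have hd₃ : σ₃ Mem.deg = σ₂ Mem.deg := by
    rw [hf₃ _ (by simp [Program.writes, forRange, incr, assign]), Memory.write_of_ne _ (by decide)]
  rw [Runs.block_nil_iff, hd₃]
  exact ⟨⟨hI₂, hI₃.1, hI₃.2⟩, by omega⟩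

theorem card_filter_append {M K a b : ℕ} {tail head tail' head' : ℕ → ℕ}
    (h : ∀ e < M, tail' e = tail e ∧ head' e = head e)
    (h' : ∀ e, M ≤ e → e < M + K → tail' e = a ∧ head' e = b) (p q : ℕ) :
    Finset.card {e ∈ Finset.range (M + K) | tail' e = p ∧ head' e = q} =
      Finset.card {e ∈ Finset.range M | tail e = p ∧ head e = q} +
        if a = p ∧ b = q then K else 0 := by
  simp only [Finset.card_filter]
  rw [Finset.sum_range_add]
  congr 1
  · refine Finset.sum_congr rfl fun e he => ?_
    obtain ⟨h₁, h₂⟩ := h e (Finset.mem_range.mp he)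
    rw [h₁, h₂]
  · rw [Finset.sum_congr rfl (g := fun _ => if a = p ∧ b = q then 1 else 0)]
    · simp
    · intro e he
      obtain ⟨h₁, h₂⟩ := h' (M + e) (by omega) (by have := Finset.mem_range.mp he; omega)
      rw [h₁, h₂]

/-- A loop that appends parallel edges to the network. -/
theorem runs_addEdges {σ : Memory} {u w : Expr} {c M a b : ℕ} (hM : σ Mem.netE 0 = M)
    (hc : c ≠ Mem.netE ∧ c ≠ Mem.netTail ∧ c ≠ Mem.netHead)
    (hu : ∀ τ : Memory, (∀ a, a ≠ c → a ≠ Mem.netE → a ≠ Mem.netTail → a ≠ Mem.netHead →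
      τ a = σ a) → u.eval τ = a ∧ w.eval τ = b) :
    Runs (loop (val c) (block [addEdge u w, decr c])) σ fun σ' t =>
      (σ' Mem.netE 0 = M + σ c 0 ∧
        (∀ e < M, σ' Mem.netTail e = σ Mem.netTail e ∧ σ' Mem.netHead e = σ Mem.netHead e) ∧
        (∀ e, M ≤ e → e < M + σ c 0 → σ' Mem.netTail e = a ∧ σ' Mem.netHead e = b) ∧
        ∀ a, a ≠ c → a ≠ Mem.netE → a ≠ Mem.netTail → a ≠ Mem.netHead → σ' a = σ a) ∧
      t ≤ 7 * σ c 0 + 1 := by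
  obtain ⟨hc₁, hc₂, hc₃⟩ := hc
  refine (Runs.loop (Inv := fun τ => (τ Mem.netE 0 + τ c 0 = M + σ c 0 ∧ M ≤ τ Mem.netE 0 ∧
        (∀ e < M, τ Mem.netTail e = σ Mem.netTail e ∧ τ Mem.netHead e = σ Mem.netHead e) ∧
        (∀ e, M ≤ e → e < τ Mem.netE 0 → τ Mem.netTail e = a ∧ τ Mem.netHead e = b) ∧
        ∀ a, a ≠ c → a ≠ Mem.netE → a ≠ Mem.netTail → a ≠ Mem.netHead → τ a = σ a))
    (Φ := fun τ => 7 * τ c 0) ?_ ?_).mono ?_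
  · exact ⟨by omega, by omega, fun _ _ => ⟨rfl, rfl⟩, fun e h₁ h₂ => by omega, fun _ _ _ _ _ => rfl⟩
  · rintro τ ⟨h₁, h₂, h₃, h₄, h₅⟩ - hb
    simp only [val, Expr.eval] at hb
    have hu₁ := hu τ h₅
    -- The second end is evaluated after the first has been written, hence in a different memory.
    have hu₂ := hu (τ.write Mem.netTail (τ Mem.netE 0) a) fun x k₁ k₂ k₃ k₄ => by
      rw [Memory.write_of_ne _ k₃]; exact h₅ x k₁ k₂ k₃ k₄
    have w₁ : ∀ (υ : Memory) (i k : ℕ), υ.write c i k Mem.netE = υ Mem.netE :=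
      fun υ => Memory.write_of_ne υ hc₁.symm
    have w₂ : ∀ (υ : Memory) (i k : ℕ), υ.write c i k Mem.netTail = υ Mem.netTail :=
      fun υ => Memory.write_of_ne υ hc₂.symm
    have w₃ : ∀ (υ : Memory) (i k : ℕ), υ.write c i k Mem.netHead = υ Mem.netHead :=
      fun υ => Memory.write_of_ne υ hc₃.symm
    simp (disch := first | assumption | decide) only [addEdge, decr, incr, assign, Runs.block_cons_iff,
      Runs.block_nil_iff, Runs.set_iff, val, Expr.eval, Memory.write_same, Memory.write_of_ne, hu₁, hu₂,
      Function.update_self, w₁, w₂, w₃]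
    refine ⟨⟨by omega, by omega, fun e he => ?_, fun e he he' => ?_, fun x k₁ k₂ k₃ k₄ => ?_⟩, by omega⟩
    · rw [Function.update_of_ne (by omega), Function.update_of_ne (by omega)]
      exact h₃ e he
    · by_cases e' : e = τ Mem.netE 0
      · subst e'; simp
      · rw [Function.update_of_ne e', Function.update_of_ne e']
        exact h₄ e he (by omega)
    · rw [Memory.write_of_ne _ k₁, Memory.write_of_ne _ k₂, Memory.write_of_ne _ k₄,
        Memory.write_of_ne _ k₃, h₅ x k₁ k₂ k₃ k₄]
  · rintro τ t ⟨⟨h₁, h₂, h₃, h₄, h₅⟩, hb, ht⟩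
    simp only [val, Expr.eval] at hb
    rw [hb, Nat.add_zero] at h₁
    rw [hb] at ht
    rw [h₁] at h₄
    exact ⟨⟨h₁, h₃, h₄, h₅⟩, by omega⟩

theorem runs_computeSlackness {σ : Memory} {v need : ℕ} (hv : σ Mem.i 0 = v)
    (hneed : needOf (σ Mem.deg v) (min (σ Mem.cap v) (σ Mem.x 0)) = need) :
    Runs computeSlackness σ fun σ' t => (σ' Mem.pos 0 = σ Mem.out v - need ∧
      σ' Mem.neg 0 = need - σ Mem.out v ∧
      ∀ a, a ≠ Mem.k → a ≠ Mem.need → a ≠ Mem.pos → a ≠ Mem.neg → σ' a = σ a) ∧ t ≤ 8 := by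
  obtain ⟨k, hk⟩ : ∃ k, k = min (σ Mem.cap v) (σ Mem.x 0) := ⟨_, rfl⟩
  have key : Runs (ite (lt (cell Mem.cap Mem.i) (val Mem.x))
      (assign Mem.k (cell Mem.cap Mem.i)) (assign Mem.k (val Mem.x))) σ
      fun σ' t => σ' = σ.write Mem.k 0 k ∧ t = 2 := by
    rw [Runs.ite_iff]
    simp only [lt, cell, val, Expr.eval, hv, assign, Runs.set_iff]
    split_ifs with h
    · rw [show k = σ Mem.x 0 by omega]; simp
    · rw [show k = σ Mem.cap v by omega]; simp
  rw [computeSlackness, Runs.block_cons_iff]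
  refine key.mono ?_
  rintro τ t ⟨rfl, rfl⟩
  have key' : Runs (block [
      assign Mem.need (.sub (.add (cell Mem.deg Mem.i) (.lit 1)) (val Mem.k)),
      ite (lt (.lit 1) (val Mem.need)) skip (assign Mem.need (.lit 0))]) (σ.write Mem.k 0 k)
      fun σ' t => (σ' Mem.need 0 = need ∧ ∀ a, a ≠ Mem.k → a ≠ Mem.need → σ' a = σ a) ∧ t ≤ 4 := by
    rw [Runs.block_cons_iff, assign, Runs.set_iff, Runs.block_cons_iff, Runs.ite_iff]
    simp (disch := decide) only [lt, cell, val, Expr.eval, Memory.write_same, Memory.write_of_ne, hv,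
      Function.update_self]
    rw [← hk, needOf] at hneed
    split_ifs with h
    · simp (disch := decide) only [assign, Runs.set_iff, Runs.block_nil_iff, Expr.eval,
        Memory.write_same, Function.update_self]
      rw [if_neg (by omega)] at hneed
      exact ⟨⟨hneed, fun a h₁ h₂ => by
        rw [Memory.write_of_ne _ h₂, Memory.write_of_ne _ h₂, Memory.write_of_ne _ h₁]⟩, by omega⟩
    · simp (disch := decide) only [Runs.skip_iff, Runs.block_nil_iff, Memory.write_same,
        Function.update_self]
      rw [if_pos (by omega)] at hneed
      exact ⟨⟨hneed, fun a h₁ h₂ => by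
        rw [Memory.write_of_ne _ h₂, Memory.write_of_ne _ h₁]⟩, by omega⟩
  have hsplit : ∀ (p q : Program) (ps : List Program) (τ : Memory) (Q : Memory → ℕ → Prop),
      Runs (block (p :: q :: ps)) τ Q ↔
      Runs (block [p, q]) τ fun σ₁ t₁ => Runs (block ps) σ₁ fun σ₂ t₂ => Q σ₂ (t₁ - 1 + t₂) := by
    intro p q ps τ Q
    simp only [Runs.block_cons_iff, Runs.block_nil_iff, ← add_assoc, Nat.add_sub_cancel]
  rw [hsplit]
  refine key'.mono ?_
  rintro τ t ⟨⟨h₁, h₂⟩, ht⟩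
  have ho : τ Mem.out = σ Mem.out := h₂ _ (by decide) (by decide)
  have hi : τ Mem.i = σ Mem.i := h₂ _ (by decide) (by decide)
  simp (disch := decide) only [assign, Runs.block_cons_iff, Runs.block_nil_iff, Runs.set_iff, val, cell,
    Expr.eval, Memory.write_same, Memory.write_of_ne, Function.update_self, h₁, ho, hi, hv]
  refine ⟨⟨trivial, trivial, fun a k₁ k₂ k₃ k₄ => ?_⟩, by omega⟩
  rw [Memory.write_of_ne _ k₄, Memory.write_of_ne _ k₃, h₂ a k₁ k₂]

/-- The needs in the slackness network for the tested number. -/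
def needs (σ : Memory) (v : ℕ) : ℕ := needOf (σ Mem.deg v) (min (σ Mem.cap v) (σ Mem.x 0))

theorem of_mem_buildNetwork_writes {a : ℕ} (h : a ∈ buildNetwork.writes) :
    a = Mem.out ∨ (14 ≤ a ∧ a ≤ 25) := by
  simp [buildNetwork, computeSlackness, addEdge, forRange, incrCell, incr, decr, assign, block,
    Program.writes, Mem.out, Mem.i, Mem.k, Mem.need, Mem.pos, Mem.neg, Mem.netV, Mem.netE, Mem.netS,
    Mem.netT, Mem.netTail, Mem.netHead] at h
  change a = 8 ∨ _
  omega

theorem runs_buildNetwork {n m : ℕ} {σ : Memory} (hn : σ Mem.numV 0 = n) (hm : σ Mem.numE 0 = m)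
    (hsrc : ∀ e < m, σ Mem.src e < n) (hdst : ∀ e < m, σ Mem.dst e < n) :
    Runs buildNetwork σ fun σ' t =>
      (σ' Mem.netV 0 = n + 2 ∧ σ' Mem.netS 0 = n ∧ σ' Mem.netT 0 = n + 1 ∧
        SlackNetwork n m (σ Mem.src) (σ Mem.dst) (needs σ) (σ' Mem.netE 0) (σ' Mem.netTail)
          (σ' Mem.netHead) ∧
        σ' Mem.netE 0 ≤ m + ∑ v ∈ Finset.range n, (outdeg m (σ Mem.src) v + needs σ v)) ∧
      t ≤ 18 * n + 10 * m + 7 * ∑ v ∈ Finset.range n, (outdeg m (σ Mem.src) v + needs σ v) + 11 := by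
  simp only [buildNetwork, Runs.block_cons_iff, assign, Runs.set_iff]
  obtain ⟨σ₁, hσ₁⟩ : ∃ σ₁ : Memory, σ₁ = (((σ.write Mem.netV (Expr.eval σ (.lit 0))
    (Expr.eval σ (.add (val Mem.numV) (.lit 2)))).write Mem.netE 0 0).write Mem.netS 0 n).write
    Mem.netT 0 (n + 1) := ⟨_, rfl⟩
  have hf₁ : ∀ a, a ≠ Mem.netV → a ≠ Mem.netE → a ≠ Mem.netS → a ≠ Mem.netT → σ₁ a = σ a := by
    intro a h₁ h₂ h₃ h₄
    rw [hσ₁, Memory.write_of_ne _ h₄, Memory.write_of_ne _ h₃, Memory.write_of_ne _ h₂,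
      Memory.write_of_ne _ h₁]
  have hV₁ : σ₁ Mem.netV 0 = n + 2 := by simp [hσ₁, Memory.write_apply, Expr.eval, val, hn]
  have hE₁ : σ₁ Mem.netE 0 = 0 := by simp [hσ₁, Memory.write_apply]
  have hS₁ : σ₁ Mem.netS 0 = n := by simp [hσ₁, Memory.write_apply]
  have hT₁ : σ₁ Mem.netT 0 = n + 1 := by simp [hσ₁, Memory.write_apply]
  simp (disch := decide) only [source, sink, val, Expr.eval, Memory.write_of_ne, hn] at hσ₁ ⊢
  rw [← hσ₁]
  clear hσ₁
  refine (Runs.forRange (Inv := fun j τ => ∀ v < j, τ Mem.out v = 0)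
    (c := 1) (lo := 0) (hi := n) rfl (Nat.zero_le _) (by simp) ?_ ?_).frame.mono ?_
  · intro τ j _ _ hf
    simp only [Expr.eval]
    rw [hf _ (by simp [Program.writes]) (by decide), hf₁ _ (by decide) (by decide) (by decide) (by decide),
      hn]
  · intro τ j _ hj hI hidx hf
    simp (disch := decide) only [Runs.set_iff, Expr.eval, Memory.write_same, Memory.write_of_ne, hidx]
    refine ⟨⟨trivial, fun v hv => ?_⟩, le_rfl⟩
    rcases Nat.lt_succ_iff_lt_or_eq.mp hv with hv | rfl
    · rw [Function.update_of_ne (by omega)]; exact hI v hv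
    · rw [Function.update_self]
  rintro σ₂ t₂ ⟨⟨hI₂, -, ht₂⟩, hf₂⟩
  replace hf₂ : ∀ a, a ≠ Mem.out → a ≠ Mem.i → σ₂ a = σ₁ a := fun a h₁ h₂ => hf₂ a (by
    simp [Program.writes, forRange, incr, assign, h₁, h₂])
  refine (Runs.forRange (Inv := fun j τ => τ Mem.netE 0 = j ∧
      (∀ v < n, τ Mem.out v = outdeg j (σ Mem.src) v) ∧
      ∀ e < j, τ Mem.netTail e = σ Mem.src e ∧ τ Mem.netHead e = σ Mem.dst e)
    (c := 6) (lo := 0) (hi := m) rfl (Nat.zero_le _) ?_ ?_ ?_).frame.mono ?_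
  · simp (disch := decide) only [Memory.write_of_ne]
    refine ⟨by rw [hf₂ _ (by decide) (by decide), hE₁], fun v hv => ?_, fun e he => by omega⟩
    rw [outdeg_zero, hI₂ v hv]
  · intro τ j _ _ hf
    simp only [Expr.eval]
    rw [hf _ (by simp [Program.writes, block, incrCell, addEdge, incr, assign]) (by decide),
      hf₂ _ (by decide) (by decide), hf₁ _ (by decide) (by decide) (by decide) (by decide), hm]
  · rintro τ j _ hj ⟨h₁, h₂, h₃⟩ hidx hf
    have hs : τ Mem.src = σ Mem.src := by
      rw [hf _ (by simp [Program.writes, block, incrCell, addEdge, incr, assign]) (by decide),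
        hf₂ _ (by decide) (by decide), hf₁ _ (by decide) (by decide) (by decide) (by decide)]
    have hd : τ Mem.dst = σ Mem.dst := by
      rw [hf _ (by simp [Program.writes, block, incrCell, addEdge, incr, assign]) (by decide),
        hf₂ _ (by decide) (by decide), hf₁ _ (by decide) (by decide) (by decide) (by decide)]
    simp (disch := decide) only [incrCell, addEdge, incr, assign, Runs.block_cons_iff,
      Runs.block_nil_iff, Runs.set_iff, val, cell, Expr.eval, Memory.write_same, Memory.write_of_ne, hidx,
      hs, hd, h₁, Function.update_self]
    refine ⟨⟨trivial, trivial, fun v hv => ?_, fun e he => ?_⟩, le_rfl⟩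
    · rw [outdeg_succ, Function.update_apply, ← h₂ v hv]
      by_cases h : σ Mem.src j = v
      · simp [h]
      · simp [h, Ne.symm h]
    · rcases Nat.lt_succ_iff_lt_or_eq.mp he with he | rfl
      · rw [Function.update_of_ne (by omega), Function.update_of_ne (by omega)]; exact h₃ e he
      · simp
  rintro σ₃ t₃ ⟨⟨⟨hE₃, ho₃, he₃⟩, -, ht₃⟩, hf₃⟩
  replace hf₃ : ∀ a, a ≠ Mem.out → a ≠ Mem.i → a ≠ Mem.netE → a ≠ Mem.netTail → a ≠ Mem.netHead →
      σ₃ a = σ₁ a := fun a h₁ h₂ h₃ h₄ h₅ => by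
    rw [hf₃ a (by simp [Program.writes, block, forRange, incr, assign, incrCell, addEdge, h₁, h₂, h₃, h₄,
      h₅]), hf₂ a h₁ h₂]
  set o := outdeg m (σ Mem.src) with ho
  -- Graph edges have both ends below `n`, so they never count as edges at a terminal.
  have hcard₀ : ∀ p q, (n ≤ p ∨ n ≤ q) → Finset.card {e ∈ Finset.range m | σ₃ Mem.netTail e = p ∧
      σ₃ Mem.netHead e = q} = 0 := by
    intro p q hpq
    rw [Finset.card_eq_zero, Finset.filter_eq_empty_iff]
    rintro e he ⟨rfl, rfl⟩
    have he := Finset.mem_range.mp he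
    have h₁ := he₃ e he
    have := hsrc e he
    have := hdst e he
    omega
  refine (Runs.forRange_sum (Inv := fun j τ => m ≤ τ Mem.netE 0 ∧
      τ Mem.netE 0 ≤ m + ∑ v ∈ Finset.range j, (o v + needs σ v) ∧
      (∀ e < m, τ Mem.netTail e = σ Mem.src e ∧ τ Mem.netHead e = σ Mem.dst e) ∧
      (∀ e, m ≤ e → e < τ Mem.netE 0 → (τ Mem.netTail e = n ∧ τ Mem.netHead e < n) ∨
        (τ Mem.netTail e < n ∧ τ Mem.netHead e = n + 1)) ∧
      (∀ v < n, Finset.card {e ∈ Finset.range (τ Mem.netE 0) | τ Mem.netTail e = n ∧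
        τ Mem.netHead e = v} = if v < j then o v - needs σ v else 0) ∧
      ∀ v < n, Finset.card {e ∈ Finset.range (τ Mem.netE 0) | τ Mem.netTail e = v ∧
        τ Mem.netHead e = n + 1} = if v < j then needs σ v - o v else 0)
    -- At most 8 steps for the slackness, 7 for each appended edge and 3 for the ends of the two
    -- loops and of the block. The number of appended edges is at most `o v + needs σ v`.
    (c := fun v => 11 + 7 * (o v + needs σ v)) (lo := 0) (hi := n) rfl (Nat.zero_le _)
    ?_ ?_ ?_).frame.mono ?_
  · simp (disch := decide) only [Memory.write_of_ne, hE₃]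
    refine ⟨le_rfl, by omega, he₃, fun e h₁ h₂ => by omega, fun v hv => ?_, fun v hv => ?_⟩
    · rw [hcard₀ _ _ (.inl le_rfl), if_neg (Nat.not_lt_zero v)]
    · rw [hcard₀ _ _ (.inr (by omega)), if_neg (Nat.not_lt_zero v)]
  · intro τ j _ _ hf
    simp only [Expr.eval]
    rw [hf _ (by simp [Program.writes, block, addEdge, incr, decr, assign, computeSlackness])
      (by decide), hf₃ _ (by decide) (by decide) (by decide) (by decide) (by decide),
      hf₁ _ (by decide) (by decide) (by decide) (by decide), hn]
  · rintro τ j _ hj ⟨h₁, h₂, h₃, h₄, h₅, h₆⟩ hidx hf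
    have hf' : ∀ a, a ≠ Mem.k → a ≠ Mem.need → a ≠ Mem.pos → a ≠ Mem.neg → a ≠ Mem.netE →
        a ≠ Mem.netTail → a ≠ Mem.netHead → a ≠ Mem.i → τ a = σ₃ a :=
      fun a k₁ k₂ k₃ k₄ k₅ k₆ k₇ k₈ => hf a (by
        simp [Program.writes, block, addEdge, incr, decr, assign, computeSlackness, k₁, k₂, k₃,
          k₄, k₅, k₆, k₇]) k₈
    have hst : ∀ a < 14, a ≠ Mem.out → τ a = σ a := fun a ha hne => by
      simp only [Mem.k, Mem.need, Mem.pos, Mem.neg, Mem.netE, Mem.netTail, Mem.netHead, Mem.i, Mem.netV,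
        Mem.netS, Mem.netT] at hf' hf₃ hf₁
      rw [hf' a (by omega) (by omega) (by omega) (by omega) (by omega) (by omega) (by omega) (by omega),
        hf₃ a hne (by omega) (by omega) (by omega) (by omega), hf₁ a (by omega) (by omega) (by omega)
        (by omega)]
    have hout : τ Mem.out j = o j := by
      rw [hf' _ (by decide) (by decide) (by decide) (by decide) (by decide) (by decide) (by decide)
        (by decide), ho₃ j hj]
    have hneed : needOf (τ Mem.deg j) (min (τ Mem.cap j) (τ Mem.x 0)) = needs σ j := by
      rw [hst _ (by decide) (by decide), hst _ (by decide) (by decide), hst _ (by decide) (by decide)]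
      rfl
    rw [Runs.block_cons_iff]
    refine (runs_computeSlackness hidx hneed).mono ?_
    rintro τ₁ s₁ ⟨⟨hpos, hneg, hτ₁⟩, hs₁⟩
    rw [hout] at hpos hneg
    have hnV : τ₁ Mem.numV 0 = n := by
      rw [hτ₁ _ (by decide) (by decide) (by decide) (by decide), hst _ (by decide) (by decide), hn]
    have hi₁ : τ₁ Mem.i 0 = j := by
      rw [hτ₁ _ (by decide) (by decide) (by decide) (by decide), hidx]
    rw [Runs.block_cons_iff]
    refine (runs_addEdges (c := Mem.pos) (M := τ Mem.netE 0) (a := n) (b := j)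
      (by rw [hτ₁ _ (by decide) (by decide) (by decide) (by decide)]) (by decide) ?_).mono ?_
    · intro υ hυ
      simp only [Expr.eval]
      rw [hυ _ (by decide) (by decide) (by decide) (by decide),
        hυ _ (by decide) (by decide) (by decide) (by decide)]
      exact ⟨hnV, hi₁⟩
    rintro τ₂ s₂ ⟨⟨hM₂, ho₂, hn₂, hτ₂⟩, hs₂⟩
    rw [hpos] at hM₂ hn₂ hs₂
    rw [hτ₁ Mem.netTail (by decide) (by decide) (by decide) (by decide),
      hτ₁ Mem.netHead (by decide) (by decide) (by decide) (by decide)] at ho₂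
    have hneg₂ : τ₂ Mem.neg 0 = needs σ j - o j := by
      rw [hτ₂ _ (by decide) (by decide) (by decide) (by decide), hneg]
    rw [Runs.block_cons_iff]
    refine (runs_addEdges (c := Mem.neg) (a := j) (b := n + 1) hM₂ (by decide) ?_).mono ?_
    · intro υ hυ
      simp only [Expr.eval]
      rw [hυ _ (by decide) (by decide) (by decide) (by decide),
        hυ _ (by decide) (by decide) (by decide) (by decide),
        hτ₂ _ (by decide) (by decide) (by decide) (by decide),
        hτ₂ _ (by decide) (by decide) (by decide) (by decide), hnV]
      exact ⟨hi₁, rfl⟩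
    rintro τ₃ s₃ ⟨⟨hM₃, ho₃, hn₃, hτ₃⟩, hs₃⟩
    rw [hneg₂] at hM₃ hn₃ hs₃
    rw [Runs.block_nil_iff]
    refine ⟨⟨?_, ?_⟩, by omega⟩
    · rw [hτ₃ _ (by decide) (by decide) (by decide) (by decide),
        hτ₂ _ (by decide) (by decide) (by decide) (by decide), hi₁]
    simp (disch := decide) only [Memory.write_of_ne]
    refine ⟨by omega, ?_, fun e he => ?_, fun e he he' => ?_, fun v hv => ?_, fun v hv => ?_⟩
    · rw [Finset.sum_range_succ]; omega
    · rw [(ho₃ e (by omega)).1, (ho₃ e (by omega)).2, (ho₂ e (by omega)).1, (ho₂ e (by omega)).2]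
      exact h₃ e he
    · by_cases g₁ : e < τ Mem.netE 0
      · rw [(ho₃ e (by omega)).1, (ho₃ e (by omega)).2, (ho₂ e (by omega)).1, (ho₂ e (by omega)).2]
        exact h₄ e he g₁
      by_cases g₂ : e < τ Mem.netE 0 + (o j - needs σ j)
      · rw [(ho₃ e g₂).1, (ho₃ e g₂).2, (hn₂ e (by omega) g₂).1, (hn₂ e (by omega) g₂).2]
        exact .inl ⟨rfl, hj⟩
      · obtain ⟨k₁, k₂⟩ := hn₃ e (by omega) (by omega)
        rw [k₁, k₂]
        exact .inr ⟨hj, rfl⟩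
    · rw [hM₃, card_filter_append ho₃ hn₃, card_filter_append ho₂ hn₂, h₅ v hv]
      by_cases e : j = v
      · subst e
        simp only [lt_irrefl, hj.ne, true_and, false_and, if_true, if_false, Nat.lt_succ_self]
        omega
      · rw [if_neg (c := n = n ∧ j = v) (fun h => e h.2), if_neg (c := j = n ∧ _) (fun h => by omega)]
        by_cases hlt : v < j
        · rw [if_pos hlt, if_pos (by omega), add_zero, add_zero]
        · rw [if_neg hlt, if_neg (by omega)]
    · rw [hM₃, card_filter_append ho₃ hn₃, card_filter_append ho₂ hn₂, h₆ v hv]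
      by_cases e : j = v
      · subst e
        simp only [lt_irrefl, hj.ne', and_true, false_and, if_true, if_false, Nat.lt_succ_self]
        omega
      · rw [if_neg (c := j = v ∧ _) (fun h => e h.1), if_neg (c := n = v ∧ _) (fun h => by omega)]
        by_cases hlt : v < j
        · rw [if_pos hlt, if_pos (by omega), add_zero, add_zero]
        · rw [if_neg hlt, if_neg (by omega)]
  rintro σ₄ t₄ ⟨⟨⟨h₁, h₂, h₃, h₄, h₅, h₆⟩, -, ht₄⟩, hf₄⟩
  replace hf₄ : ∀ a, a = Mem.netV ∨ a = Mem.netS ∨ a = Mem.netT → σ₄ a = σ₁ a := fun a ha => by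
    rw [hf₄ a (by rcases ha with rfl | rfl | rfl <;> simp [Program.writes, block, forRange, addEdge, incr,
      decr, assign, computeSlackness]), hf₃ a] <;> rcases ha with rfl | rfl | rfl <;> decide
  rw [Runs.block_nil_iff]
  refine ⟨⟨by rw [hf₄ _ (by decide), hV₁], by rw [hf₄ _ (by decide), hS₁],
    by rw [hf₄ _ (by decide), hT₁], ⟨h₁, fun e he => (h₃ e he).1, fun e he => (h₃ e he).2, hsrc, hdst, h₄,
    fun v hv => ?_, fun v hv => ?_⟩, h₂⟩, ?_⟩
  · rw [h₅ v hv, if_pos hv]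
  · rw [h₆ v hv, if_pos hv]
  · have hsum : ∑ j ∈ Finset.Ico 0 n, (11 + 7 * (o j + needs σ j) + 3) =
        14 * n + 7 * ∑ v ∈ Finset.range n, (o v + needs σ v) := by
      rw [Finset.mul_sum, ← Finset.range_eq_Ico, mul_comm 14 n, ← smul_eq_mul (a := n),
        ← Finset.card_range n, ← Finset.sum_const, Finset.card_range, ← Finset.sum_add_distrib]
      exact Finset.sum_congr rfl fun _ _ => by ring
    rw [hsum] at ht₄
    omega

theorem runs_checkSaturation {n m M : ℕ} {σ : Memory} (hn : σ Mem.numV 0 = n) (hm : σ Mem.numE 0 = m)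
    (hM : σ Mem.netE 0 = M) (hmM : m ≤ M) :
    Runs checkSaturation σ fun σ' t =>
      (σ' Mem.feasible 0 ≠ 0 ↔
        ∀ e, m ≤ e → e < M → n < σ Mem.netHead e → σ Mem.netFlow e ≠ 0) ∧ t ≤ 6 * M + 4 := by
  simp only [checkSaturation, Runs.block_cons_iff, assign, Runs.set_iff]
  have hw : ∀ a, a ≠ Mem.feasible → (σ.write Mem.feasible (Expr.eval σ (.lit 0))
      (Expr.eval σ (.lit 1))) a = σ a := fun a ha => Memory.write_of_ne _ ha _ _
  have hw' : (σ.write Mem.feasible (Expr.eval σ (.lit 0)) (Expr.eval σ (.lit 1))) Mem.feasible 0 = 1 := by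
    simp [Memory.write_apply, Expr.eval]
  generalize σ.write Mem.feasible (Expr.eval σ (.lit 0)) (Expr.eval σ (.lit 1)) = σ₁ at *
  refine (Runs.forRange (Inv := fun j τ => τ Mem.feasible 0 ≠ 0 ↔
      ∀ e, m ≤ e → e < j → n < σ Mem.netHead e → σ Mem.netFlow e ≠ 0)
    (c := 3) (lo := m) (hi := M) ?_ hmM ?_ ?_ ?_).mono ?_
  · simp only [val, Expr.eval]
    rw [hw _ (by decide), hm]
  · rw [Memory.write_of_ne _ (by decide), hw']
    exact ⟨fun _ e h₁ h₂ => by omega, fun _ => one_ne_zero⟩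
  · intro τ j _ _ hf
    simp only [val, Expr.eval]
    rw [hf _ (by simp [Program.writes]) (by decide), hw _ (by decide), hM]
  · intro τ j hmj hj hI hidx hf
    have h₁ : τ Mem.numV 0 = n := by
      rw [hf _ (by simp [Program.writes]) (by decide), hw _ (by decide), hn]
    have h₂ : τ Mem.netHead = σ Mem.netHead := by
      rw [hf _ (by simp [Program.writes]) (by decide), hw _ (by decide)]
    have h₃ : τ Mem.netFlow = σ Mem.netFlow := by
      rw [hf _ (by simp [Program.writes]) (by decide), hw _ (by decide)]
    have hstep : (n < σ Mem.netHead j → σ Mem.netFlow j ≠ 0) → (τ Mem.feasible 0 ≠ 0 ↔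
        ∀ e, m ≤ e → e < j + 1 → n < σ Mem.netHead e → σ Mem.netFlow e ≠ 0) := by
      intro h
      rw [hI]
      constructor
      · intro h' e he he'
        rcases Nat.lt_succ_iff_lt_or_eq.mp he' with he' | rfl
        · exact h' e he he'
        · exact h
      · exact fun h' e he he' => h' e he (by omega)
    rw [Runs.ite_iff]
    simp only [lt, val, cell, Expr.eval, h₁, h₂, hidx]
    split_ifs with hlt
    · rw [Runs.skip_iff, Memory.write_of_ne _ (by decide)]
      exact ⟨⟨hidx, hstep fun h => by omega⟩, by omega⟩
    · rw [Runs.ite_iff]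
      simp only [Expr.eval, h₃, hidx]
      split_ifs with hfl
      · rw [Runs.set_iff, Memory.write_of_ne _ (by decide), Memory.write_of_ne _ (by decide)]
        simp only [Expr.eval, Memory.write_same, Function.update_self]
        refine ⟨⟨hidx, iff_of_false (by simp) fun h => ?_⟩, by omega⟩
        exact h j hmj (by omega) (by omega) hfl
      · rw [Runs.skip_iff, Memory.write_of_ne _ (by decide)]
        exact ⟨⟨hidx, hstep fun _ => hfl⟩, by omega⟩
  · rintro τ t ⟨h₁, -, h₂⟩
    rw [Runs.block_nil_iff]
    exact ⟨h₁, by omega⟩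

theorem runs_flipOrientation {m : ℕ} {σ : Memory} (hm : σ Mem.numE 0 = m) :
    Runs flipOrientation σ fun σ' t =>
      (∀ e < m, σ' Mem.src e = (if σ Mem.netFlow e ≠ 0 then σ Mem.dst e else σ Mem.src e) ∧
        σ' Mem.dst e = if σ Mem.netFlow e ≠ 0 then σ Mem.src e else σ Mem.dst e) ∧
      t ≤ 8 * m + 2 := by
  rw [flipOrientation]
  refine (Runs.forRange (Inv := fun j τ => (∀ e < j,
      τ Mem.src e = (if σ Mem.netFlow e ≠ 0 then σ Mem.dst e else σ Mem.src e) ∧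
        τ Mem.dst e = if σ Mem.netFlow e ≠ 0 then σ Mem.src e else σ Mem.dst e) ∧
      ∀ e, j ≤ e → τ Mem.src e = σ Mem.src e ∧ τ Mem.dst e = σ Mem.dst e)
    (c := 5) (lo := 0) (hi := m) rfl (Nat.zero_le _) ?_ ?_ ?_).mono ?_
  · simp [Memory.write_apply]
  · intro τ j _ _ hf
    simp only [val, Expr.eval]
    rw [hf _ (by simp [Program.writes, block, assign]) (by decide), hm]
  · rintro τ j _ hj ⟨h₁, h₂⟩ hidx hf
    have h₃ : τ Mem.netFlow = σ Mem.netFlow :=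
      hf _ (by simp [Program.writes, block, assign]) (by decide)
    obtain ⟨h₄, h₅⟩ := h₂ j le_rfl
    rw [Runs.ite_iff]
    simp only [cell, val, Expr.eval, h₃, hidx]
    split_ifs with hfl
    · rw [Runs.skip_iff]
      simp (disch := decide) only [Memory.write_of_ne]
      refine ⟨⟨hidx, fun e he => ?_, fun e he => h₂ e (by omega)⟩, by omega⟩
      rcases Nat.lt_succ_iff_lt_or_eq.mp he with he | rfl
      · exact h₁ e he
      · simp [hfl, h₄, h₅]
    · simp (disch := decide) only [assign, Runs.block_cons_iff, Runs.block_nil_iff, Runs.set_iff,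
        Expr.eval, Memory.write_same, Memory.write_of_ne, hidx, Function.update_self, h₄, h₅]
      refine ⟨⟨trivial, fun e he => ?_, fun e he => ?_⟩, by omega⟩
      · rcases Nat.lt_succ_iff_lt_or_eq.mp he with he | rfl
        · rw [Function.update_of_ne (by omega), Function.update_of_ne (by omega)]
          exact h₁ e he
        · simp [hfl]
      · rw [Function.update_of_ne (by omega), Function.update_of_ne (by omega)]
        exact h₂ e (by omega)
  · rintro τ t ⟨h₁, -, h₂⟩
    exact ⟨h₁.1, by omega⟩

/-- The memory `σ` holds the instance `(G, κ)` together with the degrees of all nodes. -/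
structure Prepared {n m : ℕ} (G : SimpleGraph (Fin n)) [DecidableRel G.Adj] (κ : Fin n → ℕ)
    (edge : Fin m ≃ G.edgeSet) (σ : Memory) : Prop where
  numV : σ Mem.numV 0 = n
  numE : σ Mem.numE 0 = m
  cap : ∀ v : Fin n, σ Mem.cap v = κ v
  deg : ∀ v : Fin n, σ Mem.deg v = G.degree v
  orients : Orients G edge (σ Mem.src) (σ Mem.dst)

/-- The current orientation is a coloring that attains the number `x`. -/
def Attains {n : ℕ} (m : ℕ) (G : SimpleGraph (Fin n)) [DecidableRel G.Adj] (κ : Fin n → ℕ)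
    (σ : Memory) (x : ℕ) : Prop :=
  ∀ v : Fin n, needOf (G.degree v) (min (κ v) x) ≤ outdeg m (σ Mem.src) v

section

variable {n m T : ℕ} {G : SimpleGraph (Fin n)} [DecidableRel G.Adj] {κ : Fin n → ℕ}
  {edge : Fin m ≃ G.edgeSet} {σ : Memory} {F : Program}

theorem Prepared.congr (h : Prepared G κ edge σ) {σ' : Memory}
    (h' : ∀ a, a ≤ Mem.cap ∨ a = Mem.deg → σ' a = σ a) : Prepared G κ edge σ' where
  numV := by rw [h' _ (by decide), h.numV]
  numE := by rw [h' _ (by decide), h.numE]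
  cap v := by rw [h' _ (by decide), h.cap]
  deg v := by rw [h' _ (by decide), h.deg]
  orients := by rw [h' _ (by decide), h' _ (by decide)]; exact h.orients

theorem Prepared.needs_eq (h : Prepared G κ edge σ) (v : Fin n) :
    needs σ v = needOf (G.degree v) (min (κ v) (σ Mem.x 0)) := by
  rw [needs, h.deg, h.cap]

/-- A need is at most degree + 1, the degrees sum to at most `2 * m` and the outdegrees to at most
`m`. With the `m` graph edges this limits the slackness network to `4 * m + n` edges. -/
theorem Prepared.sum_le (h : Prepared G κ edge σ) :
    ∑ v ∈ Finset.range n, (outdeg m (σ Mem.src) v + needs σ v) ≤ 3 * m + n := by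
  have h₁ : ∀ v ∈ Finset.range n, outdeg m (σ Mem.src) v + needs σ v ≤
      outdeg m (σ Mem.src) v + (outdeg m (σ Mem.src) v + outdeg m (σ Mem.dst) v + 1) := by
    intro v hv
    have hd := h.orients.degree_eq ⟨v, Finset.mem_range.mp hv⟩
    have hn := h.needs_eq ⟨v, Finset.mem_range.mp hv⟩
    simp only at hd hn
    have : needOf (G.degree ⟨v, Finset.mem_range.mp hv⟩) (min (κ ⟨v, Finset.mem_range.mp hv⟩)
        (σ Mem.x 0)) ≤ G.degree ⟨v, Finset.mem_range.mp hv⟩ + 1 := by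
      unfold needOf; split_ifs <;> omega
    omega
  refine (Finset.sum_le_sum h₁).trans ?_
  simp only [Finset.sum_add_distrib, Finset.sum_const, Finset.card_range, smul_eq_mul, mul_one]
  have := sum_outdeg_le n m (σ Mem.src)
  have := sum_outdeg_le n m (σ Mem.dst)
  omega

/-- The program `F` computes maximum flows in at most `T` steps in all networks with `a` nodes and at
most `b` edges. -/
def SolvesWithin (F : Program) (a b T : ℕ) : Prop :=
  ∀ (N : UnitNetwork) (σ : Memory), N.ParallelOnlyAtTerminals → N.StoredIn σ → N.numNodes = a →
    N.numEdges ≤ b → Runs F σ fun σ' t => N.IsMaxFlow (fun e => (σ' Mem.netFlow e : ℝ)) ∧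
      (∀ a < Mem.scratch, a ≠ Mem.netFlow → σ' a = σ a) ∧ t ≤ T

theorem runs_test (hF : SolvesWithin F (n + 2) (4 * m + n) T) (h : Prepared G κ edge σ) :
    Runs (test F) σ fun σ' t => (Prepared G κ edge σ' ∧
      (∀ a < Mem.i, a ≠ Mem.src → a ≠ Mem.dst → a ≠ Mem.out → a ≠ Mem.feasible → σ' a = σ a) ∧
      (σ' Mem.feasible 0 ≠ 0 ↔ IsFeasible G κ (σ Mem.x 0)) ∧
      (σ' Mem.feasible 0 ≠ 0 → Attains m G κ σ' (σ Mem.x 0)) ∧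
      (σ' Mem.feasible 0 = 0 → σ' Mem.src = σ Mem.src)) ∧
      t ≤ 31 * n + 63 * m + 19 + T := by
  have hsum := h.sum_le
  rw [test, Runs.block_cons_iff]
  refine (runs_buildNetwork h.numV h.numE (fun _ => h.orients.src_lt)
    fun _ => h.orients.dst_lt).frame.mono ?_
  rintro σ₁ t₁ ⟨⟨⟨hV, hS, hT, hN, hM⟩, ht₁⟩, hf₁⟩
  replace hf₁ : ∀ a < Mem.i, a ≠ Mem.out → σ₁ a = σ a := fun a ha hne => hf₁ a fun hw => by
    rcases of_mem_buildNetwork_writes hw with h | h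
    · exact hne h
    · exact absurd h.1 (not_le.mpr ha)
  obtain ⟨M, hMdef⟩ : ∃ M, M = σ₁ Mem.netE 0 := ⟨_, rfl⟩
  rw [← hMdef] at hN hM
  rw [Runs.block_cons_iff]
  refine (hF hN.toNetwork σ₁ (hN.parallelOnlyAtTerminals
    fun e he e' he' => h.orients.injective he he')
    ⟨hV, hMdef.symm, hS, hT, fun _ => rfl, fun _ => rfl⟩ rfl (hM.trans (by omega))).mono ?_
  rintro σ₂ t₂ ⟨hmax, hf₂, ht₂⟩
  rw [Runs.block_cons_iff]
  refine (runs_checkSaturation (n := n) (m := m) (M := M)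
    (by rw [hf₂ _ (by decide) (by decide), hf₁ _ (by decide) (by decide), h.numV])
    (by rw [hf₂ _ (by decide) (by decide), hf₁ _ (by decide) (by decide), h.numE])
    (by rw [hf₂ _ (by decide) (by decide), hMdef]) hN.le).frame.mono ?_
  rintro σ₃ t₃ ⟨⟨hfeas, ht₃⟩, hf₃⟩
  replace hf₃ : ∀ a, a ≠ Mem.feasible → a ≠ Mem.i → σ₃ a = σ₂ a := fun a h₁ h₂ => hf₃ a (by
    simp [checkSaturation, Program.writes, block, forRange, incr, assign, h₁, h₂])
  have hf : ∀ a < Mem.i, a ≠ Mem.out → a ≠ Mem.feasible → σ₃ a = σ a := fun a ha h₁ h₂ => by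
    rw [hf₃ a h₂ ha.ne, hf₂ a (ha.trans (by decide)) (ha.trans (by decide)).ne, hf₁ a ha h₁]
  have hflow : σ₃ Mem.netFlow = σ₂ Mem.netFlow := hf₃ _ (by decide) (by decide)
  rw [hf₂ Mem.netHead (by decide) (by decide)] at hfeas
  -- The program inspects only edges from index `m` on and recognizes the sink as the one node
  -- beyond `n`; graph edges have heads below `n`.
  have hsat : (∀ e, m ≤ e → e < M → n < σ₁ Mem.netHead e → σ₂ Mem.netFlow e ≠ 0) ↔
      ∀ e < M, σ₁ Mem.netHead e = n + 1 → σ₂ Mem.netFlow e ≠ 0 := by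
    refine ⟨fun H e he he' => H e ?_ he (by omega), fun H e hme he he' => H e he ?_⟩
    · by_contra hlt
      rw [hN.head_eq e (by omega)] at he'
      have := h.orients.dst_lt (e := e) (by omega)
      omega
    · have := hN.head_lt he
      omega
  rw [hsat] at hfeas
  set D : Finset ℕ := {e ∈ Finset.range m | σ₂ Mem.netFlow e ≠ 0} with hD
  have hneed : σ₃ Mem.feasible 0 ≠ 0 → ∀ v : Fin n, needOf (G.degree v) (min (κ v) (σ Mem.x 0)) ≤
      outdeg m (flipTail (σ Mem.src) (σ Mem.dst) D) v := fun hfe v => by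
    rw [← h.needs_eq]
    exact hN.need_le_of_saturated hmax.1 (hfeas.mp hfe) v.2
  have hiff : σ₃ Mem.feasible 0 ≠ 0 ↔ IsFeasible G κ (σ Mem.x 0) := by
    rw [h.orients.isFeasible_iff]
    refine ⟨fun hfe => ⟨D, hneed hfe⟩, fun ⟨E, hE⟩ => hfeas.mpr fun e he he' => ?_⟩
    have := hN.saturated_of_exists (fun e => h.orients.ne)
      ⟨E, fun v hv => (h.needs_eq ⟨v, hv⟩).trans_le (hE ⟨v, hv⟩)⟩ (f := fun e => σ₂ Mem.netFlow e) hmax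
      he he'
    rw [Nat.cast_eq_one] at this
    omega
  rw [Runs.block_cons_iff, Runs.ite_iff]
  simp only [val, Expr.eval]
  split_ifs with hz
  · rw [Runs.skip_iff, Runs.block_nil_iff]
    exact ⟨⟨h.congr fun a ha => hf a (by rcases ha with ha | rfl; · exact ha.trans_lt (by decide)
                                         · decide)
      (by rintro rfl; revert ha; decide) (by rintro rfl; revert ha; decide),
      fun a ha _ _ h₁ h₂ => hf a ha h₁ h₂, hiff, fun h => absurd hz h,
      fun _ => hf _ (by decide) (by decide) (by decide)⟩, by omega⟩
  · refine (runs_flipOrientation (m := m) (by rw [hf _ (by decide) (by decide) (by decide),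
      h.numE])).frame.mono ?_
    rintro σ₄ t₄ ⟨⟨hflip, ht₄⟩, hf₄⟩
    rw [Runs.block_nil_iff]
    replace hf₄ : ∀ a, a ≠ Mem.src → a ≠ Mem.dst → a ≠ Mem.i → a ≠ Mem.k → σ₄ a = σ₃ a :=
      fun a h₁ h₂ h₃ h₄ => hf₄ a (by
        simp [flipOrientation, Program.writes, block, forRange, incr, assign, h₁, h₂, h₃, h₄])
    have hf' : ∀ a < Mem.i, a ≠ Mem.src → a ≠ Mem.dst → a ≠ Mem.out → a ≠ Mem.feasible → σ₄ a = σ a :=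
      fun a ha h₁ h₂ h₃ h₄ => by
        rw [hf₄ a h₁ h₂ ha.ne (ha.trans (by decide)).ne, hf a ha h₃ h₄]
    rw [hflow, hf Mem.src (by decide) (by decide) (by decide),
      hf Mem.dst (by decide) (by decide) (by decide)] at hflip
    have hfe : σ₄ Mem.feasible = σ₃ Mem.feasible := hf₄ _ (by decide) (by decide) (by decide) (by decide)
    rw [hfe]
    refine ⟨⟨⟨?_, ?_, fun v => ?_, fun v => ?_, fun e => ?_⟩, hf', hiff, fun _ v => ?_,
      fun h => absurd h hz⟩, by omega⟩
    · rw [hf' _ (by decide) (by decide) (by decide) (by decide) (by decide), h.numV]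
    · rw [hf' _ (by decide) (by decide) (by decide) (by decide) (by decide), h.numE]
    · rw [hf' _ (by decide) (by decide) (by decide) (by decide) (by decide), h.cap]
    · rw [hf' _ (by decide) (by decide) (by decide) (by decide) (by decide), h.deg]
    · rw [h.orients e, (hflip e e.2).1, (hflip e e.2).2]
      split_ifs
      · exact Sym2.eq_swap
      · rfl
    · refine (hneed hz v).trans (le_of_eq ?_)
      unfold outdeg
      congr 1
      refine Finset.filter_congr fun e he => ?_
      rw [(hflip e (Finset.mem_range.mp he)).1]
      simp only [flipTail, hD, Finset.mem_filter, he, true_and]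

end

/-- Without division, the two ends walk towards each other. This takes time linear in `hi`, which is
affordable because `hi ≤ Δ < n`. -/
theorem runs_midpoint {σ : Memory} {l h : ℕ} (hl : σ Mem.lo 0 = l) (hh : σ Mem.hi 0 = h)
    (hlh : l ≤ h) :
    Runs midpoint σ fun σ' t => (l + h ≤ 2 * σ' Mem.x 0 ∧ 2 * σ' Mem.x 0 ≤ l + h + 1) ∧
      t ≤ 4 * h + 4 := by
  simp (disch := decide) only [midpoint, Runs.block_cons_iff, assign, Runs.set_iff, val, Expr.eval,
    Memory.write_of_ne, hl, hh]
  refine (Runs.loop (Inv := fun τ => τ Mem.x 0 + τ Mem.k 0 = l + h ∧ τ Mem.x 0 ≤ τ Mem.k 0 + 1)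
    (Φ := fun τ => 4 * (τ Mem.k 0 - τ Mem.x 0)) ?_ ?_).mono ?_
  · simp (disch := decide) only [Memory.write_same, Memory.write_of_ne, Function.update_self]
    exact ⟨trivial, by omega⟩
  · rintro τ ⟨h₁, h₂⟩ - hb
    simp only [lt, Expr.eval] at hb
    simp (disch := decide) only [incr, decr, assign, Runs.block_cons_iff, Runs.block_nil_iff,
      Runs.set_iff, val, Expr.eval, Memory.write_same, Memory.write_of_ne, Function.update_self]
    omega
  · rintro τ t ⟨⟨h₁, h₂⟩, hb, ht⟩
    simp (disch := decide) only [lt, Expr.eval, Memory.write_same, Memory.write_of_ne,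
      Function.update_self] at hb ht
    rw [Runs.block_nil_iff]
    omega

/-! ### The binary search and the whole algorithm. -/

section

variable {n m T : ℕ} {G : SimpleGraph (Fin n)} [DecidableRel G.Adj] {κ : Fin n → ℕ}
  {edge : Fin m ≃ G.edgeSet} {σ : Memory} {F : Program}

theorem Attains.exists_coloring {x : ℕ} (h : Attains m G κ σ x)
    (ho : Orients G edge (σ Mem.src) (σ Mem.dst)) :
    ∃ C : StarColoring G, (C.IsValid κ ∧ C.value ≤ x) ∧
      ∀ e : Fin m, σ Mem.src e = C.color (edge e) := by
  obtain ⟨C, hC⟩ := ho.exists_coloring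
  exact ⟨C, (C.isValid_and_value_le_iff hC κ x).mpr h, hC⟩

/-- The binary search finds the smallest feasible number. -/
theorem runs_search (hF : SolvesWithin F (n + 2) (4 * m + n) T) (h : Prepared G κ edge σ)
    (hlo : σ Mem.lo 0 = 0) (hat : Attains m G κ σ (σ Mem.hi 0)) (hn : σ Mem.hi 0 ≤ n)
    (h₀ : σ Mem.hi 0 ≠ 0 → ¬ IsFeasible G κ 0) :
    Runs (loop (lt (.add (val Mem.lo) (.lit 1)) (val Mem.hi)) (block [
        midpoint,
        test F,
        ite (val Mem.feasible)
          (assign Mem.hi (val Mem.x)) (assign Mem.lo (val Mem.x))])) σ fun σ' t =>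
      (Prepared G κ edge σ' ∧ Attains m G κ σ' (σ' Mem.hi 0) ∧
        ∀ y < σ' Mem.hi 0, ¬ IsFeasible G κ y) ∧
      t ≤ (35 * n + 63 * m + 27 + T) * Nat.clog 2 (σ Mem.hi 0) + 1 := by
  -- The orientation attains `hi`, and `lo` is infeasible. The latter is void for `hi = 0`, which
  -- covers Δ = 0.
  refine (Runs.loop (Inv := fun τ => Prepared G κ edge τ ∧ Attains m G κ τ (τ Mem.hi 0) ∧
      τ Mem.hi 0 ≤ n ∧ (τ Mem.hi 0 ≠ 0 → τ Mem.lo 0 < τ Mem.hi 0 ∧ ¬ IsFeasible G κ (τ Mem.lo 0)))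
    (Φ := fun τ => (35 * n + 63 * m + 27 + T) * Nat.clog 2 (τ Mem.hi 0 - τ Mem.lo 0))
    ⟨h, hat, hn, fun h => by rw [hlo]; exact ⟨Nat.pos_of_ne_zero h, h₀ h⟩⟩ ?_).mono ?_
  · rintro τ ⟨h₁, h₂, h₃, h₄⟩ - hb
    simp only [lt, val, Expr.eval] at hb
    obtain ⟨h₄, h₅⟩ := h₄ (by omega)
    rw [Runs.block_cons_iff]
    refine (runs_midpoint rfl rfl h₄.le).frame.mono ?_
    rintro τ₁ t₁ ⟨⟨⟨hx₁, hx₂⟩, ht₁⟩, hf₁⟩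
    replace hf₁ : ∀ a, a ≠ Mem.x → a ≠ Mem.k → τ₁ a = τ a := fun a h₁ h₂ => hf₁ a (by
      simp [midpoint, Program.writes, block, incr, decr, assign, h₁, h₂])
    have hp₁ : Prepared G κ edge τ₁ := h₁.congr fun a ha => hf₁ a
      (by rintro rfl; revert ha; decide) (by rintro rfl; revert ha; decide)
    rw [Runs.block_cons_iff]
    refine (runs_test hF hp₁).mono ?_
    rintro τ₂ t₂ ⟨⟨hp₂, hf₂, hiff, hat₂, hsrc₂⟩, ht₂⟩
    have hlo₂ : τ₂ Mem.lo = τ Mem.lo := by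
      rw [hf₂ _ (by decide) (by decide) (by decide) (by decide) (by decide),
        hf₁ _ (by decide) (by decide)]
    have hhi₂ : τ₂ Mem.hi = τ Mem.hi := by
      rw [hf₂ _ (by decide) (by decide) (by decide) (by decide) (by decide),
        hf₁ _ (by decide) (by decide)]
    have hx : τ₂ Mem.x = τ₁ Mem.x :=
      hf₂ _ (by decide) (by decide) (by decide) (by decide) (by decide)
    rw [← hx] at hx₁ hx₂ hiff hat₂
    -- Rounding leaves a gap of at most half the old one, rounded up, and this is exactly the
    -- recursion of `Nat.clog 2`.
    have hclog : ∀ g, 2 * g ≤ τ Mem.hi 0 - τ Mem.lo 0 + 1 →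
        Nat.clog 2 g + 1 ≤ Nat.clog 2 (τ Mem.hi 0 - τ Mem.lo 0) := fun g hg => by
      rw [Nat.clog_of_two_le one_lt_two (n := τ Mem.hi 0 - τ Mem.lo 0) (by omega)]
      exact Nat.succ_le_succ (Nat.clog_mono_right 2 (by omega))
    have hcost : ∀ g s, 2 * g ≤ τ Mem.hi 0 - τ Mem.lo 0 + 1 → s ≤ 35 * n + 63 * m + 27 + T →
        s + (35 * n + 63 * m + 27 + T) * Nat.clog 2 g ≤
          (35 * n + 63 * m + 27 + T) * Nat.clog 2 (τ Mem.hi 0 - τ Mem.lo 0) := fun g s hg hs => by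
      refine le_trans ?_ (Nat.mul_le_mul_left _ (hclog g hg))
      rw [mul_add, mul_one, add_comm]
      exact Nat.add_le_add_left hs _
    rw [Runs.block_cons_iff, Runs.ite_iff]
    simp only [val, Expr.eval]
    split_ifs with hz
    · simp (disch := decide) only [assign, Runs.set_iff, Runs.block_nil_iff, Expr.eval,
        Memory.write_same, Memory.write_of_ne, Function.update_self, hhi₂]
      refine ⟨⟨hp₂.congr fun a ha => Memory.write_of_ne _ (by rintro rfl; revert ha; decide) _ _,
        fun v => ?_, h₃, fun _ => ⟨by omega, fun h => hiff.mpr h hz⟩⟩, hcost _ _ (by omega) (by omega)⟩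
      -- After a failed test the tails are unchanged, so they still attain the old `hi`.
      rw [Memory.write_of_ne _ (by decide), hsrc₂ hz, hf₁ _ (by decide) (by decide)]
      exact h₂ v
    · simp (disch := decide) only [assign, Runs.set_iff, Runs.block_nil_iff, Expr.eval,
        Memory.write_same, Memory.write_of_ne, Function.update_self, hlo₂]
      refine ⟨⟨hp₂.congr fun a ha => Memory.write_of_ne _ (by rintro rfl; revert ha; decide) _ _,
        fun v => ?_, by omega, fun _ => ⟨by omega, h₅⟩⟩, hcost _ _ (by omega) (by omega)⟩
      rw [Memory.write_of_ne _ (by decide)]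
      exact hat₂ hz v
  · rintro τ t ⟨⟨h₁, h₂, h₃, h₄⟩, hb, ht⟩
    simp only [lt, val, Expr.eval] at hb
    rw [hlo, Nat.sub_zero] at ht
    refine ⟨⟨h₁, h₂, fun y hy hy' => ?_⟩, by omega⟩
    -- On exit `hi ≤ lo + 1`, so every `y < hi` is at most the infeasible `lo`.
    exact (h₄ (by omega)).2 (hy'.mono (by omega))

theorem runs_minimumStarColoringFlow (hF : SolvesWithin F (n + 2) (4 * m + n) T) (hn : 0 < n)
    (h : InstanceStoredIn G κ edge σ) :
    Runs (minimumStarColoringFlow F) σ fun σ' t =>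
      (outputNumber σ' = minMaxStar G κ ∧
        (minMaxStar G κ ≠ ⊤ → ∃ C : StarColoring G, C.IsValid κ ∧
          (C.value : ℕ∞) = minMaxStar G κ ∧ ∀ e : Fin m, σ' Mem.src e = C.color (edge e))) ∧
      t ≤ (40 * n + 69 * m + 40 + T) * (1 + Nat.clog 2 G.maxDegree) := by
  obtain ⟨hV, hE, hcap, ho⟩ := h
  have ho : Orients G edge (σ Mem.src) (σ Mem.dst) := ho
  have : Nonempty (Fin n) := ⟨⟨0, hn⟩⟩
  rw [minimumStarColoringFlow, Runs.block_cons_iff]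
  refine (runs_computeDegrees hV hE).frame.mono ?_
  rintro σ₁ t₁ ⟨⟨⟨hdeg, hmax, hmax'⟩, ht₁⟩, hf₁⟩
  replace hf₁ : ∀ a, a ≠ Mem.deg → a ≠ Mem.maxDeg → a ≠ Mem.i → σ₁ a = σ a := fun a h₁ h₂ h₃ =>
    hf₁ a (by simp [computeDegrees, Program.writes, block, forRange, incr, incrCell, assign, h₁, h₂, h₃])
  have hdeg : ∀ v : Fin n, σ₁ Mem.deg v = G.degree v := fun v => by rw [hdeg v v.2, ho.degree_eq]
  have hΔ : σ₁ Mem.maxDeg 0 = G.maxDegree := by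
    refine le_antisymm ?_ (G.maxDegree_le_of_forall_degree_le _ fun v => hdeg v ▸ hmax v v.2)
    rcases hmax' with h | ⟨v, hv, h⟩
    · omega
    · rw [← h]
      exact (hdeg ⟨v, hv⟩).trans_le (G.degree_le_maxDegree _)
  have hΔn : G.maxDegree < n := by simpa using G.maxDegree_lt_card_verts
  simp (disch := decide) only [Runs.block_cons_iff, assign, Runs.set_iff, val, Expr.eval, hΔ]
  have hp : Prepared G κ edge (σ₁.write Mem.x 0 G.maxDegree) := by
    refine ⟨?_, ?_, fun v => ?_, fun v => ?_, ?_⟩ <;> simp (disch := decide) only [Memory.write_of_ne]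
    · rw [hf₁ _ (by decide) (by decide) (by decide), hV]
    · rw [hf₁ _ (by decide) (by decide) (by decide), hE]
    · rw [hf₁ _ (by decide) (by decide) (by decide), hcap]
    · exact hdeg v
    · rw [hf₁ _ (by decide) (by decide) (by decide), hf₁ _ (by decide) (by decide) (by decide)]
      exact ho
  refine (runs_test hF hp).mono ?_
  rintro σ₂ t₂ ⟨⟨hp₂, hf₂, hiff, hat₂, -⟩, ht₂⟩
  have hΔ₂ : σ₂ Mem.maxDeg 0 = G.maxDegree := by
    rw [hf₂ _ (by decide) (by decide) (by decide) (by decide) (by decide),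
      Memory.write_of_ne _ (by decide), hΔ]
  rw [Memory.write_same, Function.update_self] at hiff hat₂
  rw [Runs.ite_iff]
  by_cases hz : Expr.eval σ₂ (.get Mem.feasible (.lit 0)) = 0
  · rw [if_pos hz, Runs.set_iff, Runs.block_nil_iff]
    have htop : minMaxStar G κ = ⊤ := minMaxStar_eq_top edge fun h => hiff.mpr h hz
    refine ⟨⟨?_, fun h => absurd htop h⟩, ?_⟩
    · rw [htop, outputNumber, Memory.write_same]
      simp [Expr.eval]
    · refine le_trans ?_ (Nat.le_mul_of_pos_right _ (by omega))
      omega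
  rw [if_neg hz]
  simp only [Expr.eval] at hz
  simp (disch := decide) only [Runs.block_cons_iff, Runs.set_iff, Expr.eval, Memory.write_of_ne, hΔ₂]
  refine (runs_search (κ := κ) (edge := edge) hF (hp₂.congr fun a ha => ?_) ?_ ?_ ?_ ?_).mono ?_
  · rw [Memory.write_of_ne _ (by rintro rfl; revert ha; decide),
      Memory.write_of_ne _ (by rintro rfl; revert ha; decide)]
  · rw [Memory.write_of_ne _ (by decide), Memory.write_same, Function.update_self]
  · intro v
    simp (disch := decide) only [Memory.write_same, Memory.write_of_ne, Function.update_self]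
    exact hat₂ hz v
  · rw [Memory.write_same, Function.update_self]
    exact hΔn.le
  · rw [Memory.write_same, Function.update_self]
    exact fun h => not_isFeasible_zero edge (Nat.pos_of_ne_zero h)
  rintro σ₃ t₃ ⟨⟨hp₃, hat₃, hmin⟩, ht₃⟩
  rw [Memory.write_same, Function.update_self] at ht₃
  obtain ⟨C, hC, hC'⟩ := hat₃.exists_coloring hp₃.orients
  have heq := minMaxStar_eq_of_isFeasible ⟨C, hC⟩ hmin
  simp (disch := decide) only [Runs.block_nil_iff, Memory.write_of_ne]
  refine ⟨⟨?_, fun _ => ⟨C, hC.1, ?_, hC'⟩⟩, ?_⟩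
  · rw [outputNumber]
    simp (disch := decide) only [Memory.write_same, Memory.write_of_ne, Function.update_self]
    rw [if_neg one_ne_zero, heq]
  · rw [heq]
    exact_mod_cast le_antisymm hC.2 (not_lt.mp fun hlt => hmin _ hlt ⟨C, hC.1, le_rfl⟩)
  · have : (35 * n + 63 * m + 27 + T) * Nat.clog 2 G.maxDegree ≤
        (40 * n + 69 * m + 40 + T) * Nat.clog 2 G.maxDegree := Nat.mul_le_mul_right _ (by omega)
    rw [mul_add, mul_one]
    omega

end

/-! ### The running time in terms of the graph. -/

/-- The running time of Even and Tarjan on the slackness network is bounded in terms of the graph. -/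
theorem maxFlow_time_le {n m : ℕ} (hn : 1 ≤ n) (hm : 1 ≤ m) (hnm : n ≤ m + 1) :
    (((n + 2 : ℕ) : ℝ) + (4 * m + n : ℕ)) *
        (1 + min (((n + 2 : ℕ) : ℝ) ^ (2 / 3 : ℝ)) (((4 * m + n : ℕ) : ℝ) ^ (1 / 2 : ℝ))) ≤
      40 * (m * min ((n : ℝ) ^ (2 / 3 : ℝ)) ((m : ℝ) ^ (1 / 2 : ℝ))) := by
  have hn' : (1 : ℝ) ≤ n := by exact_mod_cast hn
  have hm' : (1 : ℝ) ≤ m := by exact_mod_cast hm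
  have hnm' : (n : ℝ) ≤ m + 1 := by exact_mod_cast hnm
  have h₁ : ((n + 2 : ℕ) : ℝ) ^ (2 / 3 : ℝ) ≤ 3 * (n : ℝ) ^ (2 / 3 : ℝ) := by
    calc ((n + 2 : ℕ) : ℝ) ^ (2 / 3 : ℝ) ≤ (3 * (n : ℝ)) ^ (2 / 3 : ℝ) :=
          Real.rpow_le_rpow (by positivity) (by push_cast; linarith) (by norm_num)
      _ = (3 : ℝ) ^ (2 / 3 : ℝ) * (n : ℝ) ^ (2 / 3 : ℝ) :=
          Real.mul_rpow (by norm_num) (by positivity)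
      _ ≤ 3 * (n : ℝ) ^ (2 / 3 : ℝ) :=
          mul_le_mul_of_nonneg_right
            (Real.rpow_le_self_of_one_le (by norm_num) (by norm_num)) (by positivity)
  have h₂ : ((4 * m + n : ℕ) : ℝ) ^ (1 / 2 : ℝ) ≤ 3 * (m : ℝ) ^ (1 / 2 : ℝ) := by
    calc ((4 * m + n : ℕ) : ℝ) ^ (1 / 2 : ℝ) ≤ (3 ^ 2 * (m : ℝ)) ^ (1 / 2 : ℝ) :=
          Real.rpow_le_rpow (by positivity) (by push_cast; linarith) (by norm_num)
      _ = 3 * (m : ℝ) ^ (1 / 2 : ℝ) := by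
          rw [Real.mul_rpow (by norm_num) (by positivity), ← Real.sqrt_eq_rpow, Real.sqrt_sq (by norm_num)]
  have hμ : 1 ≤ min ((n : ℝ) ^ (2 / 3 : ℝ)) ((m : ℝ) ^ (1 / 2 : ℝ)) :=
    le_min (Real.one_le_rpow hn' (by norm_num)) (Real.one_le_rpow hm' (by norm_num))
  have h₃ := (min_le_min h₁ h₂).trans_eq
    (mul_min_of_nonneg ((n : ℝ) ^ (2 / 3 : ℝ)) ((m : ℝ) ^ (1 / 2 : ℝ)) (by norm_num : (0 : ℝ) ≤ 3)).symm
  -- `n ≤ m + 1` and `1 ≤ m` give `4 * m + 2 * n + 2 ≤ 10 * m`; the minimum is at least 1, which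
  -- absorbs the summand 1.
  calc _ ≤ (10 * (m : ℝ)) * (4 * min ((n : ℝ) ^ (2 / 3 : ℝ)) ((m : ℝ) ^ (1 / 2 : ℝ))) :=
        mul_le_mul (by push_cast; linarith) (by linarith) (by positivity) (by positivity)
    _ = _ := by ring

/-- From `2 ^ (clog - 1) < k` and log 2 ≥ 1/2 follows clog ≤ 1 + 2 log k. The remaining 2 is at most
4 log k, since `k ≥ 2`. -/
theorem one_add_clog_le {k : ℕ} (hk : 2 ≤ k) : (1 + Nat.clog 2 k : ℝ) ≤ 6 * Real.log k := by
  have h₁ : 1 ≤ Nat.clog 2 k := Nat.clog_pos one_lt_two hk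
  have h₂ : ((2 ^ (Nat.clog 2 k).pred : ℕ) : ℝ) ≤ k :=
    Nat.cast_le.mpr (Nat.pow_pred_clog_lt_self one_lt_two hk).le
  have h₃ := Real.log_le_log (by positivity) h₂
  rw [Nat.cast_pow, Real.log_pow, Nat.pred_eq_sub_one, Nat.cast_sub h₁] at h₃
  have h₄ : Real.log 2 ≤ Real.log k := Real.log_le_log (by norm_num) (by exact_mod_cast hk)
  have h₅ := Real.log_two_gt_d9
  push_cast at h₃
  have h₆ : ((Nat.clog 2 k : ℝ) - 1) * (1 / 2) ≤ ((Nat.clog 2 k : ℝ) - 1) * Real.log 2 :=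
    mul_le_mul_of_nonneg_left (by linarith) (by have : (1 : ℝ) ≤ Nat.clog 2 k := by exact_mod_cast h₁
                                                linarith)
  linarith

/-- `40 * n + 69 * m + 40` is at most `189 * m` if `1 ≤ m`, and at most 189 if `m ≤ 1`; the flow
computation adds the multiple 40 of |c|. If `k ≤ 1`, the logarithm vanishes and the summand 1 alone
bounds the constant time. -/
theorem time_le {n m k T t : ℕ} {c : ℝ} (hn : 1 ≤ n) (hnm : n ≤ m + 1)
    (hk : 2 ≤ k ∨ k ≤ 1 ∧ m ≤ 1)
    (hT : (T : ℝ) ≤ |c| * ((((n + 2 : ℕ) : ℝ) + (4 * m + n : ℕ)) *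
      (1 + min (((n + 2 : ℕ) : ℝ) ^ (2 / 3 : ℝ)) (((4 * m + n : ℕ) : ℝ) ^ (1 / 2 : ℝ)))))
    (hkm : k ≤ m) (ht : t ≤ (40 * n + 69 * m + 40 + T) * (1 + Nat.clog 2 k)) :
    (t : ℝ) ≤ 6 * (189 + 40 * |c|) * (1 + Real.log k * (m : ℝ) *
      min ((n : ℝ) ^ (2 / 3 : ℝ)) ((m : ℝ) ^ (1 / 2 : ℝ))) := by
  have hc := abs_nonneg c
  have ht : (t : ℝ) ≤ (40 * n + 69 * m + 40 + T) * (1 + Nat.clog 2 k) := by exact_mod_cast ht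
  have hnm' : (n : ℝ) ≤ m + 1 := by exact_mod_cast hnm
  rcases hk with hk | ⟨hk, hm⟩
  · have hm : 1 ≤ m := by omega
    have hm' : (1 : ℝ) ≤ m := by exact_mod_cast hm
    have hn' : (1 : ℝ) ≤ n := by exact_mod_cast hn
    have h₁ := hT.trans (mul_le_mul_of_nonneg_left (maxFlow_time_le hn hm hnm) hc)
    have h₂ := one_add_clog_le hk
    set μ := min ((n : ℝ) ^ (2 / 3 : ℝ)) ((m : ℝ) ^ (1 / 2 : ℝ)) with hμdef
    have hμ : 1 ≤ μ := le_min (Real.one_le_rpow hn' (by norm_num)) (Real.one_le_rpow hm' (by norm_num))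
    have h₃ : (m : ℝ) ≤ m * μ := le_mul_of_one_le_right (by linarith) hμ
    have hlog : 0 ≤ Real.log k := Real.log_natCast_nonneg k
    calc (t : ℝ) ≤ (40 * n + 69 * m + 40 + T) * (1 + Nat.clog 2 k) := ht
      _ ≤ ((189 + 40 * |c|) * (m * μ)) * (6 * Real.log k) :=
          mul_le_mul (by linarith) h₂ (by positivity) (by positivity)
      _ = 6 * (189 + 40 * |c|) * (Real.log k * m * μ) := by ring
      _ ≤ _ := mul_le_mul_of_nonneg_left (by linarith) (by positivity)
  · have hm' : (m : ℝ) ≤ 1 := by exact_mod_cast hm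
    have h₁ : 0 ≤ Real.log k * (m : ℝ) * min ((n : ℝ) ^ (2 / 3 : ℝ)) ((m : ℝ) ^ (1 / 2 : ℝ)) := by
      have := Real.log_natCast_nonneg k
      positivity
    have h₂ : ((4 * m + n : ℕ) : ℝ) ^ (1 / 2 : ℝ) ≤ 3 := by
      rw [← Real.sqrt_eq_rpow, Real.sqrt_le_left (by norm_num)]
      push_cast
      linarith
    have h₃ : (((n + 2 : ℕ) : ℝ) + (4 * m + n : ℕ)) *
        (1 + min (((n + 2 : ℕ) : ℝ) ^ (2 / 3 : ℝ)) (((4 * m + n : ℕ) : ℝ) ^ (1 / 2 : ℝ))) ≤ 10 * 4 :=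
      mul_le_mul (by push_cast; linarith) (by linarith [(min_le_right (((n + 2 : ℕ) : ℝ) ^ (2 / 3 : ℝ))
        (((4 * m + n : ℕ) : ℝ) ^ (1 / 2 : ℝ))).trans h₂]) (by positivity) (by norm_num)
    have h₄ := hT.trans (mul_le_mul_of_nonneg_left h₃ hc)
    rw [Nat.clog_of_right_le_one hk] at ht
    calc (t : ℝ) ≤ 6 * (189 + 40 * |c|) * 1 := by push_cast at ht; linarith
      _ ≤ _ := mul_le_mul_of_nonneg_left (by linarith) (by positivity)

/-- Passing to |c| makes the bound monotone in the number of edges, so that one `T` serves all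
slackness networks of the same graph. -/
theorem exists_solvesWithin {F : Program} (hF : IsUnitMaxFlowSubroutine F) :
    ∃ c : ℝ, ∀ n m : ℕ, ∃ T : ℕ, SolvesWithin F (n + 2) (4 * m + n) T ∧
      (T : ℝ) ≤ |c| * ((((n + 2 : ℕ) : ℝ) + (4 * m + n : ℕ)) *
        (1 + min (((n + 2 : ℕ) : ℝ) ^ (2 / 3 : ℝ)) (((4 * m + n : ℕ) : ℝ) ^ (1 / 2 : ℝ)))) := by
  obtain ⟨c, hc⟩ := hF
  refine ⟨c, fun n m => ⟨⌊|c| * ((((n + 2 : ℕ) : ℝ) + (4 * m + n : ℕ)) *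
    (1 + min (((n + 2 : ℕ) : ℝ) ^ (2 / 3 : ℝ)) (((4 * m + n : ℕ) : ℝ) ^ (1 / 2 : ℝ))))⌋₊,
    fun N σ hp hs hV hE => ?_, Nat.floor_le (by positivity)⟩⟩
  obtain ⟨σ', t, he, hmax, hf, ht⟩ := hc N σ hp hs
  refine ⟨σ', t, he, hmax, hf, Nat.le_floor (ht.trans ?_)⟩
  have hE' : (N.numEdges : ℝ) ≤ (4 * m + n : ℕ) := Nat.cast_le.mpr hE
  rw [hV]
  refine mul_le_mul (le_abs_self c) ?_ (by positivity) (abs_nonneg c)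
  gcongr

/-- A connected graph of maximum degree at most one has at most one edge. -/
theorem card_edge_le_one {n m : ℕ} {G : SimpleGraph (Fin n)} [DecidableRel G.Adj]
    (edge : Fin m ≃ G.edgeSet) (hnm : n ≤ m + 1) (h : G.maxDegree ≤ 1) : m ≤ 1 := by
  have h₁ := G.sum_degrees_eq_twice_card_edges
  have h₂ : ∑ v, G.degree v ≤ n := by
    refine (Finset.sum_le_card_nsmul _ _ 1 fun v _ => (G.degree_le_maxDegree v).trans h).trans ?_
    simp
  have h₃ : G.edgeFinset.card = m := by
    rw [SimpleGraph.edgeFinset_card, ← Fintype.card_congr edge, Fintype.card_fin]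
  omega

theorem maxDegree_le_card_edge {n m : ℕ} {G : SimpleGraph (Fin n)} [DecidableRel G.Adj]
    (edge : Fin m ≃ G.edgeSet) : G.maxDegree ≤ m := by
  refine G.maxDegree_le_of_forall_degree_le _ fun v => ?_
  rw [← StarColoring.card_incident edge v]
  exact (Finset.card_le_univ _).trans_eq (Fintype.card_fin m)

end StarColoringFlow

theorem mainTheorem2 :
    (∃ F : Program, IsUnitMaxFlowSubroutine F) ∧
    ∀ F : Program, IsUnitMaxFlowSubroutine F →
      ∃ c : ℝ, ∀ (n m : ℕ) (G : SimpleGraph (Fin n)) [DecidableRel G.Adj] (κ : Fin n → ℕ)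
        (edge : Fin m ≃ G.edgeSet) (σ : Memory),
        G.Connected → InstanceStoredIn G κ edge σ →
        ∃ (σ' : Memory) (t : ℕ), Exec (minimumStarColoringFlow F) σ σ' t ∧
          outputNumber σ' = minMaxStar G κ ∧
          (minMaxStar G κ ≠ ⊤ → ∃ C : StarColoring G, C.IsValid κ ∧
            (C.value : ℕ∞) = minMaxStar G κ ∧
            ∀ e : Fin m, σ' Mem.src e = C.color (edge e)) ∧
          (t : ℝ) ≤ c * (1 + Real.log G.maxDegree * (m : ℝ) *
            min ((n : ℝ) ^ (2 / 3 : ℝ)) ((m : ℝ) ^ (1 / 2 : ℝ))) := by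
  refine ⟨⟨MaxFlow.maxFlow, MaxFlow.isUnitMaxFlowSubroutine_maxFlow⟩, fun F hF => ?_⟩
  obtain ⟨c, hc⟩ := StarColoringFlow.exists_solvesWithin hF
  refine ⟨6 * (189 + 40 * |c|), fun n m G _ κ edge σ hG hσ => ?_⟩
  obtain ⟨T, hT, hTc⟩ := hc n m
  have hn : 0 < n := by
    obtain ⟨v⟩ := hG.nonempty
    exact v.pos
  -- Connectedness enters the time bound here: a spanning tree has `n - 1` edges, so linear terms in
  -- `n` are linear in `m` up to a constant.
  have hnm : n ≤ m + 1 := by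
    have := hG.card_vert_le_card_edgeSet_add_one
    rwa [← Nat.card_congr edge, Nat.card_fin, Nat.card_fin] at this
  obtain ⟨σ', t, he, ⟨hout, hcol⟩, ht⟩ :=
    StarColoringFlow.runs_minimumStarColoringFlow hT hn hσ
  refine ⟨σ', t, he, hout, hcol,
    StarColoringFlow.time_le hn hnm ?_ hTc (StarColoringFlow.maxDegree_le_card_edge edge) ht⟩
  rcases Nat.lt_or_ge 1 G.maxDegree with h | h
  · exact .inl h
  · exact .inr ⟨h, StarColoringFlow.card_edge_le_one edge hnm h⟩
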